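/- **Theorem.** Let $I\subset\mathbb R$ be a nonempty open interval, and let $c=c(u)$, $q=q(u)$ be arbitrary smooth real functions on $I$ such that $q'(u)\neq 0$ for all $u\in I$. Primes and superscripts $(k)$ denote derivatives with respect to $u$. Put $$p(u)=\frac{c^2}{960}\left[5\,\frac{c'}{c}-\frac{q''}{q'}\right]:=\frac{1}{960}\left(5\,c\,c'-\frac{c^2q''}{q'}\right).$$ *Conventions.* A differential polynomial is a polynomial in $u_x,u_{xx},\dots$ whose coefficients are smooth functions of $u\in I$; it is graded by $\deg u^{(k)}=k$ for $k\ge 1$, functions of $u$ having degree $0$. Local functionals $H=\int h\,dx$ have formal power series $h$ in $\epsilon$ of differential polynomials as densities, taken modulo total $x$-derivatives, and $\frac{\delta H}{\delta u(x)}=\sum_{k\ge0}(-\partial_x)^k\frac{\partial h}{\partial u^{(k)}}$. A bracket $\{u(x),u(y)\}=\sum_{k\ge 0}\epsilon^k\sum_{s} A_{k,s}(u;u_x,\dots)\,\delta^{(s)}(x-y)$, with $A_{k,s}$ evaluated at $x$, acts by $$\{F,G\}=\int\frac{\delta F}{\delta u(x)}\,\Bigl(\sum_{k,s}\epsilon^kA_{k,s}\,\partial_x^s\Bigr)\frac{\delta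 G}{\delta u(x)}\,dx .$$ It is called graded if $A_{k,s}$ is homogeneous of degree $k+1-s$ (and zero for $s>k+1$). A functional is $O(\epsilon^6)$ if the coefficients of $\epsilon^0,\dots,\epsilon^5$ of its density are total $x$-derivatives of differential polynomials. For a smooth function $f=f(u)$ on $I$ let $H_f=\int h_f\,dx$, where $$h_f=f-\frac{\epsilon^2}{24}\,c\,f'''u_x^2+\epsilon^4\left[\left(p\,f'''+\frac{c^2f^{(4)}}{480}\right)u_{xx}^2-\left(\frac{c\,c''f^{(4)}}{1152}+\frac{c\,c'f^{(5)}}{1152}+\frac{c^2f^{(6)}}{3456}+\frac{p'f^{(4)}}{6}+\frac{p\,f^{(5)}}{6}\right)u_x^4\right].$$ Let $$\{u(x),u(y)\}_1=\delta'(x-y),\qquad \{u(x),u(y)\}_2=\{u(x),u(y)\}_2^{[0]}+\epsilon^2\{u(x),u(y)\}_2^{[2]}+\epsilon^4\{u(x),u(y)\}_2^{[4]},$$ where $$\{u(x),u(y)\}_2^{[0]}=q(u)\,\delta'(x-y)+\tfrac12 q'(u)\,u_x\,\delta(x-y),$$ $$\{u(x),u(y)\}_2^{[2]}=\begin{aligned}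 &\Bigl[\Bigl(\frac{c\,q'}{8}\Bigr)\Bigr]\delta'''(x-y)\\ &+\Bigl[\Bigl(\frac{3\,c'\,q'}{16}+\frac{3\,c\,q''}{16}\Bigr)u_{x}\Bigr]\delta''(x-y)\\ &+\Bigl[\Bigl(\frac{c''\,q'}{16}+\frac{c'\,q''}{6}+\frac{5\,c\,q'''}{48}\Bigr)u_{x}^{2}\\ &\quad+\Bigl(\frac{c'\,q'}{16}+\frac{7\,c\,q''}{48}\Bigr)u_{xx}\Bigr]\delta'(x-y)\\ &+\Bigl[\Bigl(\frac{c''\,q''}{48}+\frac{c'\,q'''}{24}+\frac{c\,q^{(4)}}{48}\Bigr)u_{x}^{3}\\ &\quad+\Bigl(\frac{c'\,q''}{12}+\frac{c\,q'''}{12}\Bigr)u_{x}\,u_{xx}\\ &\quad+\Bigl(\frac{c\,q''}{24}\Bigr)u_{xxx}\Bigr]\delta(x-y) \end{aligned}$$ and $$\{u(x),u(y)\}_2^{[4]}=\begin{aligned} &\Bigl[\Bigl(\frac{c\,c'\,q'}{64}+\frac{c^{2}\,q''}{192}\Bigr)\Bigr]\delta^{(5)}(x-y)\\ &+\Bigl[\Bigl(\frac{5\,{(c')}^{2}\,q'}{128}+\frac{5\,c\,c''\,q'}{128}+\frac{25\,c\,c'\,q''}{384}+\frac{5\,c^{2}\,q'''}{384}\Bigr)u_{x}\Bigr]\delta^{(4)}(x-y)\\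 &+\Bigl[\Bigl(\frac{3\,c'\,c''\,q'}{32}+\frac{c\,c'''\,q'}{32}+\frac{3\,{(c')}^{2}\,q''}{32}+\frac{5\,c\,c''\,q''}{48}+\frac{c^{2}\,{(q'')}^{3}}{480\,{(q')}^{2}}+\frac{19\,c\,c'\,q'''}{192}-\frac{3\,c^{2}\,q''\,q'''}{640\,q'}+\frac{c^{2}\,q^{(4)}}{64}-\frac{c\,c'\,{(q'')}^{2}}{240\,q'}\Bigr)u_{x}^{2}\\ &\quad+\Bigl(\frac{3\,{(c')}^{2}\,q'}{64}+\frac{3\,c\,c''\,q'}{64}+\frac{17\,c\,c'\,q''}{192}-\frac{c^{2}\,{(q'')}^{2}}{480\,q'}+\frac{19\,c^{2}\,q'''}{960}\Bigr)u_{xx}\Bigr]\delta'''(x-y)\\ &+\Bigl[\Bigl(\frac{3\,{(c'')}^{2}\,q'}{128}+\frac{c'\,c'''\,q'}{32}+\frac{c\,c^{(4)}\,q'}{128}+\frac{19\,c'\,c''\,q''}{128}+\frac{23\,c\,c'''\,q''}{384}+\frac{5\,c\,c'\,q^{(4)}}{64}+\frac{7\,c\,c''\,q'''}{64}+\frac{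c^{2}\,q^{(5)}}{96}+\frac{3\,{(c')}^{2}\,q'''}{32}-\frac{{(c')}^{2}\,{(q'')}^{2}}{160\,q'}-\frac{c\,c''\,{(q'')}^{2}}{160\,q'}+\frac{c\,c'\,{(q'')}^{3}}{80\,{(q')}^{2}}-\frac{c^{2}\,{(q'')}^{4}}{160\,{(q')}^{3}}-\frac{17\,c\,c'\,q''\,q'''}{640\,q'}+\frac{21\,c^{2}\,{(q'')}^{2}\,q'''}{1280\,{(q')}^{2}}-\frac{9\,c^{2}\,{(q''')}^{2}}{1280\,q'}-\frac{9\,c^{2}\,q''\,q^{(4)}}{1280\,q'}\Bigr)u_{x}^{3}\\ &\quad+\Bigl(\frac{9\,c'\,c''\,q'}{64}+\frac{3\,c\,c'''\,q'}{64}+\frac{11\,{(c')}^{2}\,q''}{64}+\frac{13\,c\,c''\,q''}{64}-\frac{3\,c\,c'\,{(q'')}^{2}}{160\,q'}+\frac{3\,c^{2}\,{(q'')}^{3}}{320\,{(q')}^{2}}+\frac{69\,c\,c'\,q'''}{320}-\frac{13\,c^{2}\,q''\,q'''}{640\,q'}+\frac{3\,c^{2}\,q^{(4)}}{80}\Bigr)u_{x}\,u_{xx}\\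 &\quad+\Bigl(\frac{{(c')}^{2}\,q'}{32}+\frac{c\,c''\,q'}{32}+\frac{13\,c\,c'\,q''}{192}-\frac{c^{2}\,{(q'')}^{2}}{320\,q'}+\frac{c^{2}\,q'''}{60}\Bigr)u_{xxx}\Bigr]\delta''(x-y)\\ &+\Bigl[\Bigl(\frac{{(c'')}^{2}\,q''}{48}+\frac{c'\,c'''\,q''}{32}+\frac{c\,c^{(4)}\,q''}{96}-\frac{c'\,c''\,{(q'')}^{2}}{160\,q'}-\frac{c\,c'''\,{(q'')}^{2}}{480\,q'}+\frac{{(c')}^{2}\,{(q'')}^{3}}{160\,{(q')}^{2}}+\frac{c\,c''\,{(q'')}^{3}}{160\,{(q')}^{2}}-\frac{c\,c'\,{(q'')}^{4}}{80\,{(q')}^{3}}+\frac{c^{2}\,{(q'')}^{5}}{160\,{(q')}^{4}}+\frac{35\,c'\,c''\,q'''}{384}+\frac{5\,c\,c'''\,q'''}{128}-\frac{9\,{(c')}^{2}\,q''\,q'''}{640\,q'}-\frac{9\,c\,c''\,q''\,q'''}{640\,q'}+\frac{11\,c\,c'\,{(q'')}^{2}\,q'''}{320\,{(q')}^{2}}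-\frac{13\,c^{2}\,{(q'')}^{3}\,q'''}{640\,{(q')}^{3}}-\frac{c\,c'\,{(q''')}^{2}}{64\,q'}+\frac{19\,c^{2}\,q''\,{(q''')}^{2}}{1280\,{(q')}^{2}}+\frac{17\,{(c')}^{2}\,q^{(4)}}{384}+\frac{5\,c\,c''\,q^{(4)}}{96}-\frac{c\,c'\,q''\,q^{(4)}}{64\,q'}+\frac{17\,c^{2}\,{(q'')}^{2}\,q^{(4)}}{1920\,{(q')}^{2}}-\frac{11\,c^{2}\,q'''\,q^{(4)}}{1280\,q'}+\frac{35\,c\,c'\,q^{(5)}}{1152}-\frac{11\,c^{2}\,q''\,q^{(5)}}{3840\,q'}+\frac{c^{2}\,q^{(6)}}{288}\Bigr)u_{x}^{4}\\ &\quad+\Bigl(\frac{3\,{(c'')}^{2}\,q'}{128}+\frac{c'\,c'''\,q'}{32}+\frac{c\,c^{(4)}\,q'}{128}+\frac{91\,c'\,c''\,q''}{384}+\frac{37\,c\,c'''\,q''}{384}-\frac{{(c')}^{2}\,{(q'')}^{2}}{60\,q'}-\frac{c\,c''\,{(q'')}^{2}}{60\,q'}+\frac{c\,c'\,{(q'')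}^{3}}{30\,{(q')}^{2}}-\frac{c^{2}\,{(q'')}^{4}}{60\,{(q')}^{3}}+\frac{59\,{(c')}^{2}\,q'''}{320}+\frac{53\,c\,c''\,q'''}{240}-\frac{47\,c\,c'\,q''\,q'''}{640\,q'}+\frac{173\,c^{2}\,{(q'')}^{2}\,q'''}{3840\,{(q')}^{2}}-\frac{77\,c^{2}\,{(q''')}^{2}}{3840\,q'}+\frac{169\,c\,c'\,q^{(4)}}{960}-\frac{77\,c^{2}\,q''\,q^{(4)}}{3840\,q'}+\frac{73\,c^{2}\,q^{(5)}}{2880}\Bigr)u_{x}^{2}\,u_{xx}\\ &\quad+\Bigl(\frac{3\,c'\,c''\,q'}{128}+\frac{c\,c'''\,q'}{128}+\frac{5\,{(c')}^{2}\,q''}{96}+\frac{c\,c''\,q''}{16}-\frac{c\,c'\,{(q'')}^{2}}{80\,q'}+\frac{c^{2}\,{(q'')}^{3}}{160\,{(q')}^{2}}+\frac{157\,c\,c'\,q'''}{1920}-\frac{5\,c^{2}\,q''\,q'''}{384\,q'}+\frac{31\,c^{2}\,q^{(4)}}{1920}\Bigr)u_{xx}^{2}\\ &\quad+\Bigl(\frac{3\,c'\,c''\,q'}{64}+\frac{c\,c'''\,q'}{64}+\frac{{(c')}^{2}\,q''}{12}+\frac{3\,c\,c''\,q''}{32}-\frac{c\,c'\,{(q'')}^{2}}{60\,q'}+\frac{c^{2}\,{(q'')}^{3}}{120\,{(q')}^{2}}+\frac{19\,c\,c'\,q'''}{160}-\frac{11\,c^{2}\,q''\,q'''}{640\,q'}+\frac{11\,c^{2}\,q^{(4)}}{480}\Bigr)u_{x}\,u_{xxx}\\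 &\quad+\Bigl(\frac{{(c')}^{2}\,q'}{128}+\frac{c\,c''\,q'}{128}+\frac{11\,c\,c'\,q''}{384}-\frac{c^{2}\,{(q'')}^{2}}{320\,q'}+\frac{17\,c^{2}\,q'''}{1920}\Bigr)u_{xxxx}\Bigr]\delta'(x-y)\\ &+\Bigl[\Bigl(\frac{{(c'')}^{2}\,q'''}{192}+\frac{c'\,c'''\,q'''}{128}+\frac{c\,c^{(4)}\,q'''}{384}-\frac{c'\,c''\,q''\,q'''}{640\,q'}-\frac{c\,c'''\,q''\,q'''}{1920\,q'}+\frac{{(c')}^{2}\,{(q'')}^{2}\,q'''}{640\,{(q')}^{2}}+\frac{c\,c''\,{(q'')}^{2}\,q'''}{640\,{(q')}^{2}}-\frac{c\,c'\,{(q'')}^{3}\,q'''}{320\,{(q')}^{3}}+\frac{c^{2}\,{(q'')}^{4}\,q'''}{640\,{(q')}^{4}}-\frac{{(c')}^{2}\,{(q''')}^{2}}{640\,q'}-\frac{c\,c''\,{(q''')}^{2}}{640\,q'}+\frac{3\,c\,c'\,q''\,{(q''')}^{2}}{640\,{(q')}^{2}}-\frac{c^{2}\,{(q'')}^{2}\,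{(q''')}^{2}}{320\,{(q')}^{3}}+\frac{c^{2}\,{(q''')}^{3}}{1280\,{(q')}^{2}}+\frac{7\,c'\,c''\,q^{(4)}}{384}+\frac{c\,c'''\,q^{(4)}}{128}-\frac{{(c')}^{2}\,q''\,q^{(4)}}{640\,q'}-\frac{c\,c''\,q''\,q^{(4)}}{640\,q'}+\frac{c\,c'\,{(q'')}^{2}\,q^{(4)}}{320\,{(q')}^{2}}-\frac{c^{2}\,{(q'')}^{3}\,q^{(4)}}{640\,{(q')}^{3}}-\frac{3\,c\,c'\,q'''\,q^{(4)}}{640\,q'}+\frac{13\,c^{2}\,q''\,q'''\,q^{(4)}}{3840\,{(q')}^{2}}-\frac{c^{2}\,{(q^{(4)})}^{2}}{1280\,q'}+\frac{17\,{(c')}^{2}\,q^{(5)}}{2304}+\frac{5\,c\,c''\,q^{(5)}}{576}-\frac{c\,c'\,q''\,q^{(5)}}{640\,q'}+\frac{c^{2}\,{(q'')}^{2}\,q^{(5)}}{1280\,{(q')}^{2}}-\frac{c^{2}\,q'''\,q^{(5)}}{960\,q'}+\frac{5\,c\,c'\,q^{(6)}}{1152}-\frac{c^{2}\,q''\,q^{(6)}}{3840\,q'}+\frac{c^{2}\,q^{(7)}}{2304}\Bigr)u_{x}^{5}\\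 &\quad+\Bigl(\frac{{(c'')}^{2}\,q''}{64}+\frac{c'\,c'''\,q''}{48}+\frac{c\,c^{(4)}\,q''}{192}-\frac{c'\,c''\,{(q'')}^{2}}{160\,q'}-\frac{c\,c'''\,{(q'')}^{2}}{480\,q'}+\frac{{(c')}^{2}\,{(q'')}^{3}}{160\,{(q')}^{2}}+\frac{c\,c''\,{(q'')}^{3}}{160\,{(q')}^{2}}-\frac{c\,c'\,{(q'')}^{4}}{80\,{(q')}^{3}}+\frac{c^{2}\,{(q'')}^{5}}{160\,{(q')}^{4}}+\frac{97\,c'\,c''\,q'''}{960}+\frac{13\,c\,c'''\,q'''}{320}-\frac{{(c')}^{2}\,q''\,q'''}{60\,q'}-\frac{c\,c''\,q''\,q'''}{60\,q'}+\frac{19\,c\,c'\,{(q'')}^{2}\,q'''}{480\,{(q')}^{2}}-\frac{11\,c^{2}\,{(q'')}^{3}\,q'''}{480\,{(q')}^{3}}-\frac{c\,c'\,{(q''')}^{2}}{48\,q'}+\frac{3\,c^{2}\,q''\,{(q''')}^{2}}{160\,{(q')}^{2}}+\frac{19\,{(c')}^{2}\,q^{(4)}}{320}+\frac{67\,c\,c''\,q^{(4)}}{960}-\frac{c\,c'\,q''\,q^{(4)}}{48\,q'}+\frac{11\,c^{2}\,{(q'')}^{2}\,q^{(4)}}{960\,{(q')}^{2}}-\frac{c^{2}\,q'''\,q^{(4)}}{80\,q'}+\frac{131\,c\,c'\,q^{(5)}}{2880}-\frac{c^{2}\,q''\,q^{(5)}}{240\,q'}+\frac{c^{2}\,q^{(6)}}{180}\Bigr)u_{x}^{3}\,u_{xx}\\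 &\quad+\Bigl(\frac{7\,c'\,c''\,q''}{128}+\frac{7\,c\,c'''\,q''}{384}-\frac{7\,{(c')}^{2}\,{(q'')}^{2}}{960\,q'}-\frac{7\,c\,c''\,{(q'')}^{2}}{960\,q'}+\frac{7\,c\,c'\,{(q'')}^{3}}{480\,{(q')}^{2}}-\frac{7\,c^{2}\,{(q'')}^{4}}{960\,{(q')}^{3}}+\frac{59\,{(c')}^{2}\,q'''}{960}+\frac{23\,c\,c''\,q'''}{320}-\frac{c\,c'\,q''\,q'''}{30\,q'}+\frac{13\,c^{2}\,{(q'')}^{2}\,q'''}{640\,{(q')}^{2}}-\frac{3\,c^{2}\,{(q''')}^{2}}{320\,q'}+\frac{131\,c\,c'\,q^{(4)}}{1920}-\frac{3\,c^{2}\,q''\,q^{(4)}}{320\,q'}+\frac{31\,c^{2}\,q^{(5)}}{2880}\Bigr)u_{x}\,u_{xx}^{2}\\ &\quad+\Bigl(\frac{3\,c'\,c''\,q''}{64}+\frac{c\,c'''\,q''}{64}-\frac{{(c')}^{2}\,{(q'')}^{2}}{160\,q'}-\frac{c\,c''\,{(q'')}^{2}}{160\,q'}+\frac{c\,c'\,{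(q'')}^{3}}{80\,{(q')}^{2}}-\frac{c^{2}\,{(q'')}^{4}}{160\,{(q')}^{3}}+\frac{47\,{(c')}^{2}\,q'''}{960}+\frac{13\,c\,c''\,q'''}{240}-\frac{13\,c\,c'\,q''\,q'''}{480\,q'}+\frac{c^{2}\,{(q'')}^{2}\,q'''}{60\,{(q')}^{2}}-\frac{7\,c^{2}\,{(q''')}^{2}}{960\,q'}+\frac{49\,c\,c'\,q^{(4)}}{960}-\frac{7\,c^{2}\,q''\,q^{(4)}}{960\,q'}+\frac{23\,c^{2}\,q^{(5)}}{2880}\Bigr)u_{x}^{2}\,u_{xxx}\\ &\quad+\Bigl(\frac{5\,{(c')}^{2}\,q''}{192}+\frac{5\,c\,c''\,q''}{192}-\frac{c\,c'\,{(q'')}^{2}}{96\,q'}+\frac{c^{2}\,{(q'')}^{3}}{192\,{(q')}^{2}}+\frac{3\,c\,c'\,q'''}{64}-\frac{c^{2}\,q''\,q'''}{96\,q'}+\frac{c^{2}\,q^{(4)}}{96}\Bigr)u_{xx}\,u_{xxx}\\ &\quad+\Bigl(\frac{{(c')}^{2}\,q''}{64}+\frac{c\,c''\,q''}{64}-\frac{c\,c'\,{(q'')}^{2}}{160\,q'}+\frac{c^{2}\,{(q'')}^{3}}{320\,{(q')}^{2}}+\frac{9\,c\,c'\,q'''}{320}-\frac{c^{2}\,q''\,q'''}{160\,q'}+\frac{c^{2}\,q^{(4)}}{160}\Bigr)u_{x}\,u_{xxxx}\\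 &\quad+\Bigl(\frac{c\,c'\,q''}{192}-\frac{c^{2}\,{(q'')}^{2}}{960\,q'}+\frac{c^{2}\,q'''}{480}\Bigr)u_{xxxxx}\Bigr]\delta(x-y) \end{aligned}$$ Then: 1. (Commutativity) $\{H_f,H_g\}_1=O(\epsilon^6)$ and $\{H_f,H_g\}_2=O(\epsilon^6)$ for all smooth functions $f,g$ on $I$. 2. (Poisson pencil) The bracket $\{\ ,\ \}_1$ and, for every $\lambda\in\mathbb R$, the bracket $\{\ ,\ \}_2-\lambda\{\ ,\ \}_1$ are antisymmetric and satisfy the Jacobi identity modulo $O(\epsilon^6)$ on all local functionals. 3. (Uniqueness) The bracket $\{\ ,\ \}_2$ is graded, and its higher order terms are uniquely determined by the commutativity: if $\{\ ,\ \}$ is any graded bracket with the same term of order $\epsilon^0$, $q(u)\,\delta'(x-y)+\frac12q'(u)\,u_x\,\delta(x-y)$, and $\{H_f,H_g\}=O(\epsilon^6)$ for all smooth $f,g$ on $I$, then its terms of orders $\epsilon^1,\dots,\epsilon^5$ coincide with those of $\{\ ,\ \}_2$; in particular those of orders $\epsilon$, $\epsilon^3$, $\epsilon^5$ vanish. -/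

import Mathlib

open scoped ContDiff

noncomputable section

namespace FormalVar

open MvPolynomial

/-! ## Smooth functions of `u` on an open set of the real line -/

/-- The real algebra of smooth real-valued functions on the open set `I` of the line.  A function
on `I` is smooth when its extension by zero to the line is smooth on `I`. -/
def SmoothFun (I : TopologicalSpace.Opens ℝ) : Subalgebra ℝ (I → ℝ) where
  carrier := {f | ContDiffOn ℝ ∞ (Function.extend Subtype.val f 0) I}
  mul_mem' := by
    intro f g hf hg
    refine (ContDiffOn.mul hf hg).congr fun x hx => ?_
    lift x to I using hx
    simp
  add_mem' := by
    intro f g hf hg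
    refine (ContDiffOn.add hf hg).congr fun x hx => ?_
    lift x to I using hx
    simp
  algebraMap_mem' := by
    intro a
    refine (contDiffOn_const (c := a)).congr fun x hx => ?_
    lift x to I using hx
    simp

variable {I : TopologicalSpace.Opens ℝ}

/-- The derivative `f ↦ f'` of smooth functions on `I`. -/
def D (f : SmoothFun I) : SmoothFun I :=
  ⟨fun x => deriv (Function.extend Subtype.val f.1 0) x, by
    have h : ContDiffOn ℝ ∞ (Function.extend Subtype.val f.1 0) I := f.2
    have h' := h.deriv_of_isOpen (m := ∞) I.isOpen (by simp)
    refine h'.congr fun x hx => ?_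
    lift x to I using hx
    simp⟩

/-- The reciprocal `1 / f` of a nowhere vanishing smooth function on `I`. -/
def recip (f : SmoothFun I) (hf : ∀ x, f.1 x ≠ 0) : SmoothFun I :=
  ⟨fun x => (f.1 x)⁻¹, by
    have h : ContDiffOn ℝ ∞ (Function.extend Subtype.val f.1 0) I := f.2
    have h' := h.inv (by
      intro x hx
      lift x to I using hx
      simpa [Subtype.val_injective.extend_apply] using hf x)
    refine h'.congr fun x hx => ?_
    lift x to I using hx
    simp⟩

/-! ## Differential polynomials -/

/-- Differential polynomials `h(u; u_x, u_xx, …)`: polynomials in the derivatives of `u`, with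
coefficients smooth functions of `u`.  The variable `X k` stands for `u^{(k+1)}`. -/
abbrev DiffPoly (I : TopologicalSpace.Opens ℝ) : Type := MvPolynomial ℕ (SmoothFun I)

/-- `u_x` -/
abbrev ux : DiffPoly I := X 0
/-- `u_xx` -/
abbrev uxx : DiffPoly I := X 1
/-- `u_xxx` -/
abbrev uxxx : DiffPoly I := X 2
/-- `u_xxxx` -/
abbrev uxxxx : DiffPoly I := X 3
/-- `u_xxxxx` -/
abbrev uxxxxx : DiffPoly I := X 4

/-- Homogeneity of degree `d` for the grading `deg u^{(k)} = k`, `deg u = 0`. -/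
def IsHomog (h : DiffPoly I) (d : ℕ) : Prop :=
  IsWeightedHomogeneous (fun k : ℕ => k + 1) h d

/-- The partial derivative `∂/∂u`, differentiating the coefficients. -/
def partialU (h : DiffPoly I) : DiffPoly I :=
  ∑ m ∈ h.support, monomial m (D (coeff m h))

/-- The total derivative `∂_x = u_x ∂/∂u + ∑_{k ≥ 1} u^{(k+1)} ∂/∂u^{(k)}`. -/
def dx (h : DiffPoly I) : DiffPoly I :=
  ux * partialU h + ∑ k ∈ h.vars, X (k + 1) * pderiv k h

/-- The Euler-Lagrange operator `∂/∂u - ∂_x ∂/∂u_x + ∂_x² ∂/∂u_xx - …`; it takes the density `h`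
to the variational derivative of `∫ h dx`. -/
def euler (h : DiffPoly I) : DiffPoly I :=
  partialU h + ∑ k ∈ h.vars, (-1) ^ (k + 1) * dx^[k + 1] (pderiv k h)

/-! ## Local functionals and local brackets, as formal series in `ε` -/

/-- A density `∑_n ε^n h_n`, given by its coefficients; it stands for the local functional
`∫ ∑_n ε^n h_n dx`. -/
abbrev Density (I : TopologicalSpace.Opens ℝ) : Type := ℕ → DiffPoly I

/-- `∫ h dx = O(ε^N)`: each coefficient of order less than `N` is a total `x`-derivative. -/
def VanishesMod (N : ℕ) (h : Density I) : Prop :=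
  ∀ n < N, ∃ r : DiffPoly I, dx r = h n

/-- Coefficients of a bracket
`{u(x), u(y)} = ∑_k ε^k ∑_{s ≤ k+1} A_{k,s}(u; u_x, …) δ^{(s)}(x-y)`, where `A k s` is taken at
the point `x`. -/
abbrev BracketCoeffs (I : TopologicalSpace.Opens ℝ) : Type := ℕ → ℕ → DiffPoly I

/-- The grading: `A_{k,s}` is homogeneous of degree `k + 1 - s`, so that there is no term with
`s > k + 1`. -/
def IsGraded (A : BracketCoeffs I) : Prop :=
  ∀ k s, (s ≤ k + 1 → IsHomog (A k s) (k + 1 - s)) ∧ (k + 1 < s → A k s = 0)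

/-- The differential operator `∑_s A_{k,s} ∂_x^s` given by the terms of order `k` of a bracket. -/
def applyOp (A : BracketCoeffs I) (k : ℕ) (h : DiffPoly I) : DiffPoly I :=
  ∑ s ∈ Finset.range (k + 2), A k s * dx^[s] h

/-- The density of the bracket `{F, G} = ∫ δF/δu(x) (∑ ε^k A_{k,s} ∂_x^s) δG/δu(x) dx` of two
local functionals: its coefficient of order `n` collects all `i + (k + j) = n`. -/
def bracket (A : BracketCoeffs I) (F G : Density I) : Density I := fun n =>
  ∑ a ∈ Finset.HasAntidiagonal.antidiagonal n, ∑ b ∈ Finset.HasAntidiagonal.antidiagonal a.2,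
    euler (F a.1) * applyOp A b.1 (euler (G b.2))

/-- Antisymmetry and the Jacobi identity, modulo `O(ε^N)`, for all local functionals. -/
def IsPoissonMod (N : ℕ) (A : BracketCoeffs I) : Prop :=
  (∀ F G : Density I, VanishesMod N (bracket A F G + bracket A G F)) ∧
  (∀ F G H : Density I, VanishesMod N
    (bracket A (bracket A F G) H + bracket A (bracket A G H) F + bracket A (bracket A H F) G))

/-- The bracket `{ , }_2 - lam { , }_1`. -/
def pencil (A₁ A₂ : BracketCoeffs I) (lam : ℝ) : BracketCoeffs I := fun k s =>
  A₂ k s - lam • A₁ k s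

/-! ## The Hamiltonians and the two brackets -/

/-- The density `h_f` of the perturbed Hamiltonian `H_f` with functional parameters
`c`, `p`, `s`. -/
def hamDensity (c p s f : SmoothFun I) : Density I
  | 0 => C f
  | 2 => -C ((1/24 : ℝ) • (c * D^[3] f)) * ux ^ 2
  | 4 =>
      C (p * D^[3] f + (1/480 : ℝ) • (c ^ 2 * D^[4] f)) * uxx ^ 2 -
      C ((1/1152 : ℝ) • (c * D^[2] c * D^[4] f) + (1/1152 : ℝ) • (c * D c * D^[5] f)
          + (1/3456 : ℝ) • (c ^ 2 * D^[6] f) + (1/6 : ℝ) • (D p * D^[4] f)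
          + (1/6 : ℝ) • (p * D^[5] f) - s * D^[3] f) * ux ^ 4
  | _ => 0

/-- The bracket `{u(x), u(y)}_1 = δ'(x-y)`. -/
def firstBracket : BracketCoeffs I
  | 0, 1 => 1
  | _, _ => 0

/-- The leading term `q(u) δ'(x-y) + ½ q'(u) u_x δ(x-y)` of the second bracket: the coefficient
of `δ^{(s)}(x-y)`. -/
def leadingTerm (q : SmoothFun I) : ℕ → DiffPoly I
  | 1 => C q
  | 0 => C ((1/2 : ℝ) • D q) * ux
  | _ => 0

/-- The terms of order `ε²` of the second bracket: the coefficient of `δ^{(s)}(x-y)`.  The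
arguments `ci` and `qi` stand for the `i`-th derivatives of `c(u)` and `q(u)`. -/
def orderTwoTerm (c c1 c2 q1 q2 q3 q4 : SmoothFun I) : ℕ → DiffPoly I
  | 3 =>
      C ((1/8 : ℝ) • (c * q1))
  | 2 =>
      C ((3/16 : ℝ) • (c1 * q1) + (3/16 : ℝ) • (c * q2)) * ux
  | 1 =>
      C ((1/16 : ℝ) • (c2 * q1) + (1/6 : ℝ) • (c1 * q2) + (5/48 : ℝ) • (c * q3)) * ux ^ 2 +
      C ((1/16 : ℝ) • (c1 * q1) + (7/48 : ℝ) • (c * q2)) * uxx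
  | 0 =>
      C ((1/48 : ℝ) • (c2 * q2) + (1/24 : ℝ) • (c1 * q3) + (1/48 : ℝ) • (c * q4)) * ux ^ 3 +
      C ((1/12 : ℝ) • (c1 * q2) + (1/12 : ℝ) • (c * q3)) * ux * uxx +
      C ((1/24 : ℝ) • (c * q2)) * uxxx
  | _ => 0

/-! The coefficients of the terms of order `ε⁴` of the second bracket.  The arguments `ci` and `qi`
stand for the `i`-th derivatives of `c(u)` and `q(u)`, and `r` stands for `1 / q'(u)`.  In the name
of a coefficient, the first digit is the order of the derivative of the delta function, and the
digits after the underscores list the derivatives of `u` in the monomial. -/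

/-- Coefficient of `ε⁴ δ^(5)(x-y)`. -/
def k5 (c c1 q1 q2 : SmoothFun I) : SmoothFun I :=
  (1/64 : ℝ) • (c * c1 * q1) + (1/192 : ℝ) • (c ^ 2 * q2)

/-- Coefficient of `ux * ε⁴ δ^(4)(x-y)`. -/
def k4_1 (c c1 c2 q1 q2 q3 : SmoothFun I) : SmoothFun I :=
  (5/128 : ℝ) • (c1 ^ 2 * q1) + (5/128 : ℝ) • (c * c2 * q1) + (25/384 : ℝ) • (c * c1 * q2)
    + (5/384 : ℝ) • (c ^ 2 * q3)

/-- Coefficient of `ux ^ 2 * ε⁴ δ^(3)(x-y)`. -/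
def k3_11 (c c1 c2 c3 q1 q2 q3 q4 r : SmoothFun I) : SmoothFun I :=
  (3/32 : ℝ) • (c1 * c2 * q1) + (1/32 : ℝ) • (c * c3 * q1) + (3/32 : ℝ) • (c1 ^ 2 * q2)
    + (5/48 : ℝ) • (c * c2 * q2) + (1/480 : ℝ) • (c ^ 2 * q2 ^ 3 * r ^ 2)
    + (19/192 : ℝ) • (c * c1 * q3) - (3/640 : ℝ) • (c ^ 2 * q2 * q3 * r)
    + (1/64 : ℝ) • (c ^ 2 * q4) - (1/240 : ℝ) • (c * c1 * q2 ^ 2 * r)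

/-- Coefficient of `uxx * ε⁴ δ^(3)(x-y)`. -/
def k3_2 (c c1 c2 q1 q2 q3 r : SmoothFun I) : SmoothFun I :=
  (3/64 : ℝ) • (c1 ^ 2 * q1) + (3/64 : ℝ) • (c * c2 * q1) + (17/192 : ℝ) • (c * c1 * q2)
    - (1/480 : ℝ) • (c ^ 2 * q2 ^ 2 * r) + (19/960 : ℝ) • (c ^ 2 * q3)

/-- Coefficient of `ux ^ 3 * ε⁴ δ^(2)(x-y)`. -/
def k2_111 (c c1 c2 c3 c4 q1 q2 q3 q4 q5 r : SmoothFun I) : SmoothFun I :=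
  (3/128 : ℝ) • (c2 ^ 2 * q1) + (1/32 : ℝ) • (c1 * c3 * q1) + (1/128 : ℝ) • (c * c4 * q1)
    + (19/128 : ℝ) • (c1 * c2 * q2) + (23/384 : ℝ) • (c * c3 * q2)
    + (5/64 : ℝ) • (c * c1 * q4) + (7/64 : ℝ) • (c * c2 * q3) + (1/96 : ℝ) • (c ^ 2 * q5)
    + (3/32 : ℝ) • (c1 ^ 2 * q3) - (1/160 : ℝ) • (c1 ^ 2 * q2 ^ 2 * r)
    - (1/160 : ℝ) • (c * c2 * q2 ^ 2 * r) + (1/80 : ℝ) • (c * c1 * q2 ^ 3 * r ^ 2)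
    - (1/160 : ℝ) • (c ^ 2 * q2 ^ 4 * r ^ 3) - (17/640 : ℝ) • (c * c1 * q2 * q3 * r)
    + (21/1280 : ℝ) • (c ^ 2 * q2 ^ 2 * q3 * r ^ 2) - (9/1280 : ℝ) • (c ^ 2 * q3 ^ 2 * r)
    - (9/1280 : ℝ) • (c ^ 2 * q2 * q4 * r)

/-- Coefficient of `ux * uxx * ε⁴ δ^(2)(x-y)`. -/
def k2_1_2 (c c1 c2 c3 q1 q2 q3 q4 r : SmoothFun I) : SmoothFun I :=
  (9/64 : ℝ) • (c1 * c2 * q1) + (3/64 : ℝ) • (c * c3 * q1) + (11/64 : ℝ) • (c1 ^ 2 * q2)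
    + (13/64 : ℝ) • (c * c2 * q2) - (3/160 : ℝ) • (c * c1 * q2 ^ 2 * r)
    + (3/320 : ℝ) • (c ^ 2 * q2 ^ 3 * r ^ 2) + (69/320 : ℝ) • (c * c1 * q3)
    - (13/640 : ℝ) • (c ^ 2 * q2 * q3 * r) + (3/80 : ℝ) • (c ^ 2 * q4)

/-- Coefficient of `uxxx * ε⁴ δ^(2)(x-y)`. -/
def k2_3 (c c1 c2 q1 q2 q3 r : SmoothFun I) : SmoothFun I :=
  (1/32 : ℝ) • (c1 ^ 2 * q1) + (1/32 : ℝ) • (c * c2 * q1) + (13/192 : ℝ) • (c * c1 * q2)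
    - (1/320 : ℝ) • (c ^ 2 * q2 ^ 2 * r) + (1/60 : ℝ) • (c ^ 2 * q3)

/-- Coefficient of `ux ^ 4 * ε⁴ δ^(1)(x-y)`. -/
def k1_1111 (c c1 c2 c3 c4 q2 q3 q4 q5 q6 r : SmoothFun I) : SmoothFun I :=
  (1/48 : ℝ) • (c2 ^ 2 * q2) + (1/32 : ℝ) • (c1 * c3 * q2) + (1/96 : ℝ) • (c * c4 * q2)
    - (1/160 : ℝ) • (c1 * c2 * q2 ^ 2 * r) - (1/480 : ℝ) • (c * c3 * q2 ^ 2 * r)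
    + (1/160 : ℝ) • (c1 ^ 2 * q2 ^ 3 * r ^ 2) + (1/160 : ℝ) • (c * c2 * q2 ^ 3 * r ^ 2)
    - (1/80 : ℝ) • (c * c1 * q2 ^ 4 * r ^ 3) + (1/160 : ℝ) • (c ^ 2 * q2 ^ 5 * r ^ 4)
    + (35/384 : ℝ) • (c1 * c2 * q3) + (5/128 : ℝ) • (c * c3 * q3)
    - (9/640 : ℝ) • (c1 ^ 2 * q2 * q3 * r) - (9/640 : ℝ) • (c * c2 * q2 * q3 * r)
    + (11/320 : ℝ) • (c * c1 * q2 ^ 2 * q3 * r ^ 2)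
    - (13/640 : ℝ) • (c ^ 2 * q2 ^ 3 * q3 * r ^ 3) - (1/64 : ℝ) • (c * c1 * q3 ^ 2 * r)
    + (19/1280 : ℝ) • (c ^ 2 * q2 * q3 ^ 2 * r ^ 2) + (17/384 : ℝ) • (c1 ^ 2 * q4)
    + (5/96 : ℝ) • (c * c2 * q4) - (1/64 : ℝ) • (c * c1 * q2 * q4 * r)
    + (17/1920 : ℝ) • (c ^ 2 * q2 ^ 2 * q4 * r ^ 2) - (11/1280 : ℝ) • (c ^ 2 * q3 * q4 * r)
    + (35/1152 : ℝ) • (c * c1 * q5) - (11/3840 : ℝ) • (c ^ 2 * q2 * q5 * r)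
    + (1/288 : ℝ) • (c ^ 2 * q6)

/-- Coefficient of `ux ^ 2 * uxx * ε⁴ δ^(1)(x-y)`. -/
def k1_11_2 (c c1 c2 c3 c4 q1 q2 q3 q4 q5 r : SmoothFun I) : SmoothFun I :=
  (3/128 : ℝ) • (c2 ^ 2 * q1) + (1/32 : ℝ) • (c1 * c3 * q1) + (1/128 : ℝ) • (c * c4 * q1)
    + (91/384 : ℝ) • (c1 * c2 * q2) + (37/384 : ℝ) • (c * c3 * q2)
    - (1/60 : ℝ) • (c1 ^ 2 * q2 ^ 2 * r) - (1/60 : ℝ) • (c * c2 * q2 ^ 2 * r)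
    + (1/30 : ℝ) • (c * c1 * q2 ^ 3 * r ^ 2) - (1/60 : ℝ) • (c ^ 2 * q2 ^ 4 * r ^ 3)
    + (59/320 : ℝ) • (c1 ^ 2 * q3) + (53/240 : ℝ) • (c * c2 * q3)
    - (47/640 : ℝ) • (c * c1 * q2 * q3 * r) + (173/3840 : ℝ) • (c ^ 2 * q2 ^ 2 * q3 * r ^ 2)
    - (77/3840 : ℝ) • (c ^ 2 * q3 ^ 2 * r) + (169/960 : ℝ) • (c * c1 * q4)
    - (77/3840 : ℝ) • (c ^ 2 * q2 * q4 * r) + (73/2880 : ℝ) • (c ^ 2 * q5)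

/-- Coefficient of `uxx ^ 2 * ε⁴ δ^(1)(x-y)`. -/
def k1_22 (c c1 c2 c3 q1 q2 q3 q4 r : SmoothFun I) : SmoothFun I :=
  (3/128 : ℝ) • (c1 * c2 * q1) + (1/128 : ℝ) • (c * c3 * q1) + (5/96 : ℝ) • (c1 ^ 2 * q2)
    + (1/16 : ℝ) • (c * c2 * q2) - (1/80 : ℝ) • (c * c1 * q2 ^ 2 * r)
    + (1/160 : ℝ) • (c ^ 2 * q2 ^ 3 * r ^ 2) + (157/1920 : ℝ) • (c * c1 * q3)
    - (5/384 : ℝ) • (c ^ 2 * q2 * q3 * r) + (31/1920 : ℝ) • (c ^ 2 * q4)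

/-- Coefficient of `ux * uxxx * ε⁴ δ^(1)(x-y)`. -/
def k1_1_3 (c c1 c2 c3 q1 q2 q3 q4 r : SmoothFun I) : SmoothFun I :=
  (3/64 : ℝ) • (c1 * c2 * q1) + (1/64 : ℝ) • (c * c3 * q1) + (1/12 : ℝ) • (c1 ^ 2 * q2)
    + (3/32 : ℝ) • (c * c2 * q2) - (1/60 : ℝ) • (c * c1 * q2 ^ 2 * r)
    + (1/120 : ℝ) • (c ^ 2 * q2 ^ 3 * r ^ 2) + (19/160 : ℝ) • (c * c1 * q3)
    - (11/640 : ℝ) • (c ^ 2 * q2 * q3 * r) + (11/480 : ℝ) • (c ^ 2 * q4)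

/-- Coefficient of `uxxxx * ε⁴ δ^(1)(x-y)`. -/
def k1_4 (c c1 c2 q1 q2 q3 r : SmoothFun I) : SmoothFun I :=
  (1/128 : ℝ) • (c1 ^ 2 * q1) + (1/128 : ℝ) • (c * c2 * q1) + (11/384 : ℝ) • (c * c1 * q2)
    - (1/320 : ℝ) • (c ^ 2 * q2 ^ 2 * r) + (17/1920 : ℝ) • (c ^ 2 * q3)

/-- Coefficient of `ux ^ 5 * ε⁴ δ^(0)(x-y)`. -/
def k0_11111 (c c1 c2 c3 c4 q2 q3 q4 q5 q6 q7 r : SmoothFun I) : SmoothFun I :=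
  (1/192 : ℝ) • (c2 ^ 2 * q3) + (1/128 : ℝ) • (c1 * c3 * q3) + (1/384 : ℝ) • (c * c4 * q3)
    - (1/640 : ℝ) • (c1 * c2 * q2 * q3 * r) - (1/1920 : ℝ) • (c * c3 * q2 * q3 * r)
    + (1/640 : ℝ) • (c1 ^ 2 * q2 ^ 2 * q3 * r ^ 2)
    + (1/640 : ℝ) • (c * c2 * q2 ^ 2 * q3 * r ^ 2)
    - (1/320 : ℝ) • (c * c1 * q2 ^ 3 * q3 * r ^ 3)
    + (1/640 : ℝ) • (c ^ 2 * q2 ^ 4 * q3 * r ^ 4) - (1/640 : ℝ) • (c1 ^ 2 * q3 ^ 2 * r)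
    - (1/640 : ℝ) • (c * c2 * q3 ^ 2 * r) + (3/640 : ℝ) • (c * c1 * q2 * q3 ^ 2 * r ^ 2)
    - (1/320 : ℝ) • (c ^ 2 * q2 ^ 2 * q3 ^ 2 * r ^ 3)
    + (1/1280 : ℝ) • (c ^ 2 * q3 ^ 3 * r ^ 2) + (7/384 : ℝ) • (c1 * c2 * q4)
    + (1/128 : ℝ) • (c * c3 * q4) - (1/640 : ℝ) • (c1 ^ 2 * q2 * q4 * r)
    - (1/640 : ℝ) • (c * c2 * q2 * q4 * r) + (1/320 : ℝ) • (c * c1 * q2 ^ 2 * q4 * r ^ 2)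
    - (1/640 : ℝ) • (c ^ 2 * q2 ^ 3 * q4 * r ^ 3) - (3/640 : ℝ) • (c * c1 * q3 * q4 * r)
    + (13/3840 : ℝ) • (c ^ 2 * q2 * q3 * q4 * r ^ 2) - (1/1280 : ℝ) • (c ^ 2 * q4 ^ 2 * r)
    + (17/2304 : ℝ) • (c1 ^ 2 * q5) + (5/576 : ℝ) • (c * c2 * q5)
    - (1/640 : ℝ) • (c * c1 * q2 * q5 * r) + (1/1280 : ℝ) • (c ^ 2 * q2 ^ 2 * q5 * r ^ 2)
    - (1/960 : ℝ) • (c ^ 2 * q3 * q5 * r) + (5/1152 : ℝ) • (c * c1 * q6)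
    - (1/3840 : ℝ) • (c ^ 2 * q2 * q6 * r) + (1/2304 : ℝ) • (c ^ 2 * q7)

/-- Coefficient of `ux ^ 3 * uxx * ε⁴ δ^(0)(x-y)`. -/
def k0_111_2 (c c1 c2 c3 c4 q2 q3 q4 q5 q6 r : SmoothFun I) : SmoothFun I :=
  (1/64 : ℝ) • (c2 ^ 2 * q2) + (1/48 : ℝ) • (c1 * c3 * q2) + (1/192 : ℝ) • (c * c4 * q2)
    - (1/160 : ℝ) • (c1 * c2 * q2 ^ 2 * r) - (1/480 : ℝ) • (c * c3 * q2 ^ 2 * r)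
    + (1/160 : ℝ) • (c1 ^ 2 * q2 ^ 3 * r ^ 2) + (1/160 : ℝ) • (c * c2 * q2 ^ 3 * r ^ 2)
    - (1/80 : ℝ) • (c * c1 * q2 ^ 4 * r ^ 3) + (1/160 : ℝ) • (c ^ 2 * q2 ^ 5 * r ^ 4)
    + (97/960 : ℝ) • (c1 * c2 * q3) + (13/320 : ℝ) • (c * c3 * q3)
    - (1/60 : ℝ) • (c1 ^ 2 * q2 * q3 * r) - (1/60 : ℝ) • (c * c2 * q2 * q3 * r)
    + (19/480 : ℝ) • (c * c1 * q2 ^ 2 * q3 * r ^ 2)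
    - (11/480 : ℝ) • (c ^ 2 * q2 ^ 3 * q3 * r ^ 3) - (1/48 : ℝ) • (c * c1 * q3 ^ 2 * r)
    + (3/160 : ℝ) • (c ^ 2 * q2 * q3 ^ 2 * r ^ 2) + (19/320 : ℝ) • (c1 ^ 2 * q4)
    + (67/960 : ℝ) • (c * c2 * q4) - (1/48 : ℝ) • (c * c1 * q2 * q4 * r)
    + (11/960 : ℝ) • (c ^ 2 * q2 ^ 2 * q4 * r ^ 2) - (1/80 : ℝ) • (c ^ 2 * q3 * q4 * r)
    + (131/2880 : ℝ) • (c * c1 * q5) - (1/240 : ℝ) • (c ^ 2 * q2 * q5 * r)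
    + (1/180 : ℝ) • (c ^ 2 * q6)

/-- Coefficient of `ux * uxx ^ 2 * ε⁴ δ^(0)(x-y)`. -/
def k0_1_22 (c c1 c2 c3 q2 q3 q4 q5 r : SmoothFun I) : SmoothFun I :=
  (7/128 : ℝ) • (c1 * c2 * q2) + (7/384 : ℝ) • (c * c3 * q2)
    - (7/960 : ℝ) • (c1 ^ 2 * q2 ^ 2 * r) - (7/960 : ℝ) • (c * c2 * q2 ^ 2 * r)
    + (7/480 : ℝ) • (c * c1 * q2 ^ 3 * r ^ 2) - (7/960 : ℝ) • (c ^ 2 * q2 ^ 4 * r ^ 3)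
    + (59/960 : ℝ) • (c1 ^ 2 * q3) + (23/320 : ℝ) • (c * c2 * q3)
    - (1/30 : ℝ) • (c * c1 * q2 * q3 * r) + (13/640 : ℝ) • (c ^ 2 * q2 ^ 2 * q3 * r ^ 2)
    - (3/320 : ℝ) • (c ^ 2 * q3 ^ 2 * r) + (131/1920 : ℝ) • (c * c1 * q4)
    - (3/320 : ℝ) • (c ^ 2 * q2 * q4 * r) + (31/2880 : ℝ) • (c ^ 2 * q5)

/-- Coefficient of `ux ^ 2 * uxxx * ε⁴ δ^(0)(x-y)`. -/
def k0_11_3 (c c1 c2 c3 q2 q3 q4 q5 r : SmoothFun I) : SmoothFun I :=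
  (3/64 : ℝ) • (c1 * c2 * q2) + (1/64 : ℝ) • (c * c3 * q2)
    - (1/160 : ℝ) • (c1 ^ 2 * q2 ^ 2 * r) - (1/160 : ℝ) • (c * c2 * q2 ^ 2 * r)
    + (1/80 : ℝ) • (c * c1 * q2 ^ 3 * r ^ 2) - (1/160 : ℝ) • (c ^ 2 * q2 ^ 4 * r ^ 3)
    + (47/960 : ℝ) • (c1 ^ 2 * q3) + (13/240 : ℝ) • (c * c2 * q3)
    - (13/480 : ℝ) • (c * c1 * q2 * q3 * r) + (1/60 : ℝ) • (c ^ 2 * q2 ^ 2 * q3 * r ^ 2)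
    - (7/960 : ℝ) • (c ^ 2 * q3 ^ 2 * r) + (49/960 : ℝ) • (c * c1 * q4)
    - (7/960 : ℝ) • (c ^ 2 * q2 * q4 * r) + (23/2880 : ℝ) • (c ^ 2 * q5)

/-- Coefficient of `uxx * uxxx * ε⁴ δ^(0)(x-y)`. -/
def k0_2_3 (c c1 c2 q2 q3 q4 r : SmoothFun I) : SmoothFun I :=
  (5/192 : ℝ) • (c1 ^ 2 * q2) + (5/192 : ℝ) • (c * c2 * q2)
    - (1/96 : ℝ) • (c * c1 * q2 ^ 2 * r) + (1/192 : ℝ) • (c ^ 2 * q2 ^ 3 * r ^ 2)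
    + (3/64 : ℝ) • (c * c1 * q3) - (1/96 : ℝ) • (c ^ 2 * q2 * q3 * r)
    + (1/96 : ℝ) • (c ^ 2 * q4)

/-- Coefficient of `ux * uxxxx * ε⁴ δ^(0)(x-y)`. -/
def k0_1_4 (c c1 c2 q2 q3 q4 r : SmoothFun I) : SmoothFun I :=
  (1/64 : ℝ) • (c1 ^ 2 * q2) + (1/64 : ℝ) • (c * c2 * q2)
    - (1/160 : ℝ) • (c * c1 * q2 ^ 2 * r) + (1/320 : ℝ) • (c ^ 2 * q2 ^ 3 * r ^ 2)
    + (9/320 : ℝ) • (c * c1 * q3) - (1/160 : ℝ) • (c ^ 2 * q2 * q3 * r)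
    + (1/160 : ℝ) • (c ^ 2 * q4)

/-- Coefficient of `uxxxxx * ε⁴ δ^(0)(x-y)`. -/
def k0_5 (c c1 q2 q3 r : SmoothFun I) : SmoothFun I :=
  (1/192 : ℝ) • (c * c1 * q2) - (1/960 : ℝ) • (c ^ 2 * q2 ^ 2 * r)
    + (1/480 : ℝ) • (c ^ 2 * q3)

/-- The terms of order `ε⁴` of the second bracket: the coefficient of `δ^{(s)}(x-y)`.  The
arguments `ci` and `qi` stand for the `i`-th derivatives of `c(u)` and `q(u)`, and `r` stands for
`1 / q'(u)`. -/
def orderFourTerm (c c1 c2 c3 c4 q1 q2 q3 q4 q5 q6 q7 r : SmoothFun I) : ℕ → DiffPoly I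
  | 5 =>
      C (k5 c c1 q1 q2)
  | 4 =>
      C (k4_1 c c1 c2 q1 q2 q3) * ux
  | 3 =>
      C (k3_11 c c1 c2 c3 q1 q2 q3 q4 r) * ux ^ 2 +
      C (k3_2 c c1 c2 q1 q2 q3 r) * uxx
  | 2 =>
      C (k2_111 c c1 c2 c3 c4 q1 q2 q3 q4 q5 r) * ux ^ 3 +
      C (k2_1_2 c c1 c2 c3 q1 q2 q3 q4 r) * ux * uxx +
      C (k2_3 c c1 c2 q1 q2 q3 r) * uxxx
  | 1 =>
      C (k1_1111 c c1 c2 c3 c4 q2 q3 q4 q5 q6 r) * ux ^ 4 +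
      C (k1_11_2 c c1 c2 c3 c4 q1 q2 q3 q4 q5 r) * ux ^ 2 * uxx +
      C (k1_22 c c1 c2 c3 q1 q2 q3 q4 r) * uxx ^ 2 +
      C (k1_1_3 c c1 c2 c3 q1 q2 q3 q4 r) * ux * uxxx +
      C (k1_4 c c1 c2 q1 q2 q3 r) * uxxxx
  | 0 =>
      C (k0_11111 c c1 c2 c3 c4 q2 q3 q4 q5 q6 q7 r) * ux ^ 5 +
      C (k0_111_2 c c1 c2 c3 c4 q2 q3 q4 q5 q6 r) * ux ^ 3 * uxx +
      C (k0_1_22 c c1 c2 c3 q2 q3 q4 q5 r) * ux * uxx ^ 2 +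
      C (k0_11_3 c c1 c2 c3 q2 q3 q4 q5 r) * ux ^ 2 * uxxx +
      C (k0_2_3 c c1 c2 q2 q3 q4 r) * uxx * uxxx +
      C (k0_1_4 c c1 c2 q2 q3 q4 r) * ux * uxxxx +
      C (k0_5 c c1 q2 q3 r) * uxxxxx
  | _ => 0

/-- The second bracket, through the order `ε⁴`. -/
def secondBracket (c q : SmoothFun I) (hq : ∀ x, (D q).1 x ≠ 0) : BracketCoeffs I
  | 0 => leadingTerm q
  | 2 => orderTwoTerm c (D c) (D^[2] c) (D q) (D^[2] q) (D^[3] q) (D^[4] q)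
  | 4 => orderFourTerm c (D c) (D^[2] c) (D^[3] c) (D^[4] c) (D q) (D^[2] q) (D^[3] q) (D^[4] q)
      (D^[5] q) (D^[6] q) (D^[7] q) (recip (D q) hq)
  | _ => 0

end FormalVar

end

open scoped ContDiff

noncomputable section

namespace FormalVar

open MvPolynomial Finset.HasAntidiagonal

variable {I : TopologicalSpace.Opens ℝ}

/-! ## The derivation of smooth functions -/

/-! Two independent mechanisms carry the theorem: a Lenard recursion, which reduces the second
bracket to the first, and a rigidity principle, which makes the Poisson property and the uniqueness
consequences of commutativity.

Lenard recursion. Write `P₁ = ∂_x` and `P₂` for the operators of the two brackets. Given `g`, choose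
`t` with `t'' = q g'' + ½ q' g'`; this is solvable because smooth functions on an interval have
smooth primitives (`exists_D_eq`). At order zero the equation says that `P₂ δH_g = ∂_x δH_t`. The
corrections of `H` and of the second bracket are such that this relation persists at orders two and
four (`orderTwo_identity`, `orderFour_identity`, collected in `sum_applyOp_secondBracket`); the
formula for `p` is needed only at order four. Hence `{H_f, H_g}_2` and `{H_f, H_t}_1` have the same
density below order six, and commutativity for the second bracket follows from commutativity for the
first. The latter holds for every `p`, by exhibiting primitives (`dx_mul_identity_two`,
`dx_mul_identity_four`, `firstBracket_commute`).

Rigidity. If `W` is homogeneous of degree at least two and `f(u) W` is a total derivative for every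
function `f`, then `W = 0` (`eq_zero_of_intx_C_mul`). An operator that kills all functions of `u` is
zero as well (`diffOp_coeff_eq_zero`). The Hamiltonians `H_f` start with an arbitrary function `f`,
and `δH_f` starts with `f'`, which is again arbitrary. Arguing by induction on the order in `ε`, the
contributions of the lower orders of the bracket cancel, and commutativity at order `k` becomes a
statement about the order `k` term of the bracket evaluated on functions of `u` alone; rigidity
extends it to all differential polynomials. This yields uniqueness (`jetBracket_unique`) and
antisymmetry (`isSkewOp_of_commute`).

The Jacobi identity is obtained in the same way rather than by expansion. For skew operators the
second variations drop out of the Jacobi sum, leaving a form in `δF`, `δG`, `δH` themselves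
(`jacobiSum_eq`). It vanishes on triples of functions of `u`, since a bracket of two commuting
Hamiltonians has zero variational derivative, and therefore it vanishes identically
(`jacobiForm_eq_zero`). The pencil inherits commutativity by linearity, so only the skewness of its
leading term has to be checked by hand. -/

@[ext] theorem smoothFun_ext {f g : SmoothFun I} (h : ∀ x, f.1 x = g.1 x) : f = g :=
  Subtype.ext (funext h)

theorem extend_apply_mem (f : I → ℝ) (x : I) : Function.extend Subtype.val f 0 (x : ℝ) = f x :=
  Subtype.val_injective.extend_apply f 0 x

theorem differentiableAt_extend (f : SmoothFun I) (x : I) :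
    DifferentiableAt ℝ (Function.extend Subtype.val f.1 0) x :=
  ((f.2 : ContDiffOn ℝ ∞ _ _).differentiableOn (by simp)).differentiableAt
    (I.isOpen.mem_nhds x.2)

theorem hasDerivAt_extend (f : SmoothFun I) (x : I) :
    HasDerivAt (Function.extend Subtype.val f.1 0) ((D f).1 x) x :=
  (differentiableAt_extend f x).hasDerivAt

/-- The derivative may be computed with any function agreeing with `f` on `I`. -/
theorem D_apply_of_hasDerivAt {f : SmoothFun I} {F : ℝ → ℝ} {x : I} {a : ℝ}
    (hF : ∀ y : I, F y = f.1 y) (h : HasDerivAt F a x) : (D f).1 x = a := by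
  refine (hasDerivAt_extend f x).unique (h.congr_of_eventuallyEq ?_)
  filter_upwards [I.isOpen.mem_nhds x.2] with y hy
  lift y to I using hy
  rw [extend_apply_mem, hF]

theorem D_add (f g : SmoothFun I) : D (f + g) = D f + D g := by
  ext x
  refine D_apply_of_hasDerivAt (fun y => ?_) ((hasDerivAt_extend f x).add (hasDerivAt_extend g x))
  simp

theorem D_mul (f g : SmoothFun I) : D (f * g) = f * D g + g * D f := by
  ext x
  refine D_apply_of_hasDerivAt (fun y => ?_) (((hasDerivAt_extend f x).mul (hasDerivAt_extend g x)).congr_deriv ?_)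
  · simp
  · simp; ring

theorem D_smul (a : ℝ) (f : SmoothFun I) : D (a • f) = a • D f := by
  ext x
  refine D_apply_of_hasDerivAt (fun y => ?_) ((hasDerivAt_extend f x).const_mul a)
  simp

/-- The derivative as a derivation of the algebra of smooth functions. -/
def derivD : Derivation ℝ (SmoothFun I) (SmoothFun I) :=
  Derivation.mk' { toFun := D, map_add' := D_add, map_smul' := D_smul } fun f g => by
    simpa [smul_eq_mul] using D_mul f g

theorem D_zero : D (0 : SmoothFun I) = 0 := map_zero derivD
theorem D_one : D (1 : SmoothFun I) = 0 := derivD.map_one_eq_zero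
theorem D_neg (f : SmoothFun I) : D (-f) = -D f := map_neg derivD f
theorem D_sub (f g : SmoothFun I) : D (f - g) = D f - D g := map_sub derivD f g

theorem D_recip (f : SmoothFun I) (hf : ∀ x, f.1 x ≠ 0) :
    D (recip f hf) = -(recip f hf ^ 2 * D f) := by
  ext x
  have h := (hasDerivAt_extend f x).inv (by rw [extend_apply_mem]; exact hf x)
  rw [D_apply_of_hasDerivAt (fun y => ?_) h]
  · simp only [extend_apply_mem, recip]
    change _ = -(((f.1 x)⁻¹) ^ 2 * (D f).1 x)
    field_simp
  · simp [recip]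

/-- The coordinate function `u ↦ u - a`. -/
def coordSub (a : ℝ) : SmoothFun I :=
  ⟨fun x => x - a, by
    refine (contDiff_id.sub (contDiff_const (c := a))).contDiffOn.congr fun x hx => ?_
    lift x to I using hx
    rw [extend_apply_mem, id]⟩

theorem coordSub_apply (a : ℝ) (x : I) : (coordSub a : SmoothFun I).1 x = x - a := rfl

theorem D_coordSub (a : ℝ) : D (coordSub a : SmoothFun I) = 1 := by
  ext x
  exact D_apply_of_hasDerivAt (fun y => rfl) ((hasDerivAt_id (x : ℝ)).sub_const a)

/-- Smooth functions on an interval have smooth primitives. -/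
theorem exists_D_eq (hI : IsConnected (I : Set ℝ)) (f : SmoothFun I) : ∃ g, D g = f := by
  obtain ⟨a, ha⟩ := hI.nonempty
  have hord : (I : Set ℝ).OrdConnected := hI.isPreconnected.ordConnected
  set F := Function.extend Subtype.val f.1 0 with hF
  have hc : ContDiffOn ℝ ∞ F I := f.2
  have hd : ∀ x ∈ I, HasDerivAt (fun x => ∫ t in a..x, F t) (F x) x := by
    intro x hx
    -- Connectedness enters here: the path of integration must stay inside the open set, outside
    -- which the extension is merely zero.
    have hsub : Set.uIcc a x ⊆ I := hord.uIcc_subset ha hx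
    refine intervalIntegral.integral_hasDerivAt_right
      (hc.continuousOn.mono hsub).intervalIntegrable ?_
      (hc.continuousOn.continuousAt (I.isOpen.mem_nhds hx))
    exact hc.continuousOn.stronglyMeasurableAtFilter I.isOpen x hx
  have hs : ContDiffOn ℝ ∞ (fun x => ∫ t in a..x, F t) I := by
    -- A function is smooth as soon as it is differentiable with smooth derivative, and here the
    -- derivative is `F` itself.
    rw [contDiffOn_infty_iff_deriv_of_isOpen I.isOpen]
    exact ⟨fun x hx => (hd x hx).differentiableAt.differentiableWithinAt,
      hc.congr fun x hx => (hd x hx).deriv⟩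
  refine ⟨⟨fun x => ∫ t in a..(x : ℝ), F t, hs.congr fun x hx => ?_⟩, ?_⟩
  · lift x to I using hx
    rw [extend_apply_mem]
  · ext x
    rw [D_apply_of_hasDerivAt (fun y => rfl) (hd x x.2), hF, extend_apply_mem]

/-! ## Values of smooth functions -/

/-- The value of a smooth function at a point, as a ring homomorphism. -/
def evalFun (x : I) : SmoothFun I →+* ℝ :=
  (Pi.evalRingHom (fun _ : I => ℝ) x).comp (SmoothFun I).val.toRingHom

@[simp] theorem evalFun_apply (x : I) (f : SmoothFun I) : evalFun x f = f.1 x := rfl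

/-! ## Differential polynomials over a differential algebra

The formal variational calculus works over any commutative real algebra `S` with a derivation `δ`
in place of the smooth functions of `u` and their derivative. -/

section Jets

variable {S : Type*} [CommRing S]

/-- Both sides are derivations with the same values on the variables occurring in `h`. The freedom
in `T` allows several polynomials to be expanded over one common range. -/
theorem mkDerivation_eq_sum (R : ℕ → MvPolynomial ℕ S) (h : MvPolynomial ℕ S) {T : Finset ℕ}
    (hT : h.vars ⊆ T) : mkDerivation S R h = ∑ k ∈ T, R k * pderiv k h := by
  classical
  have hsum (p : MvPolynomial ℕ S) : (∑ k ∈ T, R k • pderiv k : Derivation S _ _) p =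
      ∑ k ∈ T, R k * pderiv k p := by
    exact (congrFun (map_sum Derivation.coeFnAddMonoidHom (fun k => R k • pderiv k) T) p).trans
      (Finset.sum_apply ..)
  have key : mkDerivation S R h = (∑ k ∈ T, R k • pderiv k : Derivation S _ _) h := by
    refine derivation_eq_of_forall_mem_vars fun i hi => ?_
    rw [mkDerivation_X, hsum,
      Finset.sum_eq_single_of_mem i (hT hi) fun k _ hk => ?_]
    · simp
    · simp [pderiv_X_of_ne hk.symm]
  rw [key, hsum]

/-- A bound, exclusive, for the orders of the derivatives of `u` on which `h` depends. -/
def order (h : MvPolynomial ℕ S) : ℕ := h.vars.sup (· + 1) + 1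

/-- The shift by one comes from the indexing: `X k` is the jet coordinate of index `k + 1`, index
zero being `u` itself. For the same reason `order` is never zero, even for constants. -/
theorem vars_subset_range {h : MvPolynomial ℕ S} {N : ℕ} (hN : order h ≤ N + 1) :
    h.vars ⊆ Finset.range N := by
  intro k hk
  have := Finset.le_sup (f := (· + 1)) hk
  simp only [order] at hN
  rw [Finset.mem_range]
  omega

variable [Algebra ℝ S] (δ : Derivation ℝ S S)

/-- `∂/∂u` as a derivation. -/
def jetPartialU : Derivation ℝ (MvPolynomial ℕ S) (MvPolynomial ℕ S) :=
  -- The sum over the support is not visibly additive, since supports change under addition. Reading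
  -- it coefficient by coefficient removes the support.
  have hc : ∀ (h : MvPolynomial ℕ S) (m : ℕ →₀ ℕ),
      coeff m (∑ n ∈ h.support, monomial n (δ (coeff n h))) = δ (coeff m h) := by
    classical
    intro h m
    simp only [coeff_sum, coeff_monomial]
    rw [Finset.sum_ite_eq' h.support m (fun n => δ (coeff n h))]
    split_ifs with hm
    · rfl
    · rw [notMem_support_iff.1 hm, map_zero]
  Derivation.mk'
    { toFun := fun h => ∑ m ∈ h.support, monomial m (δ (coeff m h))
      map_add' := fun p q => by ext1 m; rw [hc, coeff_add, coeff_add, hc, hc, map_add]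
      map_smul' := fun a p => by
        ext1 m; rw [hc, coeff_smul, RingHom.id_apply, coeff_smul, hc, Derivation.map_smul] }
    fun p q => by
      classical
      ext1 m
      simp only [LinearMap.coe_mk, AddHom.coe_mk, smul_eq_mul]
      rw [mul_comm q, coeff_add, coeff_mul, coeff_mul, hc, coeff_mul, map_sum,
        ← Finset.sum_add_distrib]
      refine Finset.sum_congr rfl fun n _ => ?_
      rw [Derivation.leibniz, hc, hc, smul_eq_mul, smul_eq_mul, mul_comm (δ _)]

theorem jetPartialU_apply (h : MvPolynomial ℕ S) :
    jetPartialU δ h = ∑ m ∈ h.support, monomial m (δ (coeff m h)) := rfl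

theorem coeff_jetPartialU (h : MvPolynomial ℕ S) (m : ℕ →₀ ℕ) :
    coeff m (jetPartialU δ h) = δ (coeff m h) := by
  classical
  rw [jetPartialU_apply]
  simp only [coeff_sum, coeff_monomial]
  rw [Finset.sum_ite_eq' h.support m (fun n => δ (coeff n h))]
  split_ifs with hm
  · rfl
  · rw [notMem_support_iff.1 hm, map_zero]

@[simp] theorem jetPartialU_C (f : S) : jetPartialU δ (C f) = C (δ f) := by
  ext1 m
  classical
  rw [coeff_jetPartialU, coeff_C, coeff_C]
  split_ifs <;> simp

@[simp] theorem jetPartialU_X (k : ℕ) : jetPartialU δ (X k) = 0 := by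
  ext1 m
  classical
  rw [coeff_jetPartialU, coeff_X]
  split_ifs <;> simp

/-- The derivation with values `C f ↦ R 0 * C f'` and `X k ↦ R (k + 1)`. -/
def gen (R : ℕ → MvPolynomial ℕ S) : Derivation ℝ (MvPolynomial ℕ S) (MvPolynomial ℕ S) :=
  R 0 • jetPartialU δ + (mkDerivation S fun k => R (k + 1)).restrictScalars ℝ

theorem gen_apply (R : ℕ → MvPolynomial ℕ S) (h : MvPolynomial ℕ S) :
    gen δ R h = R 0 * jetPartialU δ h + mkDerivation S (fun k => R (k + 1)) h := rfl

@[simp] theorem gen_C (R : ℕ → MvPolynomial ℕ S) (f : S) : gen δ R (C f) = R 0 * C (δ f) := by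
  simp [gen_apply]

@[simp] theorem gen_X (R : ℕ → MvPolynomial ℕ S) (k : ℕ) : gen δ R (X k) = R (k + 1) := by
  simp [gen_apply]

/-- These derivations are only real-linear and move the coefficients, so agreement on the variables
must be supplemented by agreement on constants. All commutator identities are checked on generators
through this lemma. -/
theorem derivation_ext_of_C_X {d e : Derivation ℝ (MvPolynomial ℕ S) (MvPolynomial ℕ S)}
    (hC : ∀ f, d (C f) = e (C f)) (hX : ∀ k, d (X k) = e (X k)) : d = e := by
  ext1 p
  induction p using MvPolynomial.induction_on with
  | C a => exact hC a
  | add p q hp hq => rw [map_add, map_add, hp, hq]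
  | mul_X p n hp => rw [Derivation.leibniz, Derivation.leibniz, hp, hX]

/-- `∂/∂u^{(k)}`, with `u^{(0)} = u`. -/
def jetDeriv : ℕ → Derivation ℝ (MvPolynomial ℕ S) (MvPolynomial ℕ S)
  | 0 => jetPartialU δ
  | k + 1 => (pderiv k).restrictScalars ℝ

theorem jetDeriv_zero : jetDeriv δ 0 = jetPartialU δ := rfl

theorem jetDeriv_succ_apply (k : ℕ) (h : MvPolynomial ℕ S) : jetDeriv δ (k + 1) h = pderiv k h :=
  rfl

variable {δ} in
theorem jetDeriv_eq_zero_of_order_le {h : MvPolynomial ℕ S} {k : ℕ} (hk : order h ≤ k) :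
    jetDeriv δ k h = 0 := by
  obtain _ | k := k
  · simp [order] at hk
  · rw [jetDeriv_succ_apply]
    exact pderiv_eq_zero_of_notMem_vars fun hm => by simpa using vars_subset_range hk hm

theorem gen_eq_sum (R : ℕ → MvPolynomial ℕ S) (h : MvPolynomial ℕ S) {N : ℕ} (hN : order h ≤ N) :
    gen δ R h = ∑ k ∈ Finset.range N, R k * jetDeriv δ k h := by
  obtain _ | N := N
  · simp [order] at hN
  · rw [Finset.sum_range_succ', gen_apply, mkDerivation_eq_sum _ _ (vars_subset_range hN), add_comm]
    rfl

/-- The total derivative `∂_x`. -/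
def totalDeriv : Derivation ℝ (MvPolynomial ℕ S) (MvPolynomial ℕ S) := gen δ X

theorem totalDeriv_apply (h : MvPolynomial ℕ S) :
    totalDeriv δ h = X 0 * jetPartialU δ h + ∑ k ∈ h.vars, X (k + 1) * pderiv k h := by
  rw [totalDeriv, gen_apply, mkDerivation_eq_sum _ _ subset_rfl]

@[simp] theorem totalDeriv_C (f : S) : totalDeriv δ (C f) = X 0 * C (δ f) := gen_C ..
@[simp] theorem totalDeriv_X (k : ℕ) : totalDeriv δ (X k) = X (k + 1) := gen_X ..

/-- The powers `∂_x^k`. -/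
def totalPow (k : ℕ) : MvPolynomial ℕ S →ₗ[ℝ] MvPolynomial ℕ S :=
  (totalDeriv δ : MvPolynomial ℕ S →ₗ[ℝ] MvPolynomial ℕ S) ^ k

theorem totalPow_apply (k : ℕ) (h : MvPolynomial ℕ S) :
    totalPow δ k h = (totalDeriv δ)^[k] h := by
  rw [totalPow, Module.End.pow_apply]
  rfl

@[simp] theorem totalPow_zero (h : MvPolynomial ℕ S) : totalPow δ 0 h = h := rfl

theorem totalPow_succ (k : ℕ) (h : MvPolynomial ℕ S) :
    totalPow δ (k + 1) h = totalDeriv δ (totalPow δ k h) := by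
  rw [totalPow_apply, totalPow_apply, Function.iterate_succ_apply']

theorem totalPow_totalDeriv (k : ℕ) (h : MvPolynomial ℕ S) :
    totalPow δ k (totalDeriv δ h) = totalPow δ (k + 1) h := by
  rw [totalPow_apply, totalPow_apply, Function.iterate_succ_apply]

/-- The Euler-Lagrange operator. -/
def jetEuler (h : MvPolynomial ℕ S) : MvPolynomial ℕ S :=
  jetPartialU δ h + ∑ k ∈ h.vars, (-1) ^ (k + 1) * totalPow δ (k + 1) (pderiv k h)

theorem jetEuler_eq_sum (h : MvPolynomial ℕ S) {N : ℕ} (hN : order h ≤ N) :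
    jetEuler δ h = ∑ k ∈ Finset.range N, (-1) ^ k * totalPow δ k (jetDeriv δ k h) := by
  obtain _ | N := N
  · simp [order] at hN
  · rw [Finset.sum_range_succ', add_comm, jetEuler]
    simp only [jetDeriv_succ_apply, jetDeriv_zero, pow_zero, one_mul, totalPow_zero]
    rw [Finset.sum_subset (vars_subset_range hN) fun k _ hk => ?_]
    rw [pderiv_eq_zero_of_notMem_vars hk, map_zero, mul_zero]

theorem jetEuler_add (a b : MvPolynomial ℕ S) :
    jetEuler δ (a + b) = jetEuler δ a + jetEuler δ b := by
  obtain ⟨N, hN⟩ : ∃ N, max (max (order a) (order b)) (order (a + b)) = N := ⟨_, rfl⟩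
  rw [jetEuler_eq_sum δ (N := N) (a + b) (by omega), jetEuler_eq_sum δ (N := N) a (by omega),
    jetEuler_eq_sum δ (N := N) b (by omega), ← Finset.sum_add_distrib]
  simp only [map_add, mul_add]

theorem jetDeriv_zero_totalDeriv (h : MvPolynomial ℕ S) :
    jetDeriv δ 0 (totalDeriv δ h) = totalDeriv δ (jetDeriv δ 0 h) := by
  have : ⁅jetDeriv δ 0, totalDeriv δ⁆ = 0 := by
    refine derivation_ext_of_C_X (fun f => ?_) fun k => ?_ <;>
    simp [Derivation.commutator_apply, jetDeriv]
  have := congrArg (fun d => d h) this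
  simpa [Derivation.commutator_apply, sub_eq_zero] using this

/-- The extra term arises because `∂_x` contains `u^{(k+1)} ∂/∂u^{(k)}`. A commutator of derivations
is a derivation, so generators suffice. -/
theorem jetDeriv_succ_totalDeriv (k : ℕ) (h : MvPolynomial ℕ S) :
    jetDeriv δ (k + 1) (totalDeriv δ h) = totalDeriv δ (jetDeriv δ (k + 1) h) + jetDeriv δ k h := by
  have : ⁅jetDeriv δ (k + 1), totalDeriv δ⁆ = jetDeriv δ k := by
    classical
    refine derivation_ext_of_C_X (fun f => ?_) fun l => ?_ <;> obtain _ | k := k <;>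
    simp [Derivation.commutator_apply, jetDeriv, pderiv_X, Pi.single_apply, apply_ite]
    split_ifs <;> simp_all
  have := congrArg (fun d => d h) this
  simpa [Derivation.commutator_apply, sub_eq_iff_eq_add'] using this

theorem jetEuler_totalDeriv (h : MvPolynomial ℕ S) : jetEuler δ (totalDeriv δ h) = 0 := by
  obtain ⟨N, hN⟩ : ∃ N, max (order h) (order (totalDeriv δ h)) = N := ⟨_, rfl⟩
  -- Inserting the commutation rule makes the alternating sum telescope; the one term left over
  -- contains `∂/∂u^{(M)}` and vanishes once `M` reaches the order of `h`.
  have key : ∀ M, ∑ k ∈ Finset.range (M + 1), (-1) ^ k *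
      totalPow δ k (jetDeriv δ k (totalDeriv δ h)) =
      (-1) ^ M * totalPow δ (M + 1) (jetDeriv δ M h) := by
    intro M
    induction M with
    | zero => simp [jetDeriv_zero_totalDeriv, totalPow_succ]
    | succ M ih =>
      rw [Finset.sum_range_succ, ih, jetDeriv_succ_totalDeriv, map_add, totalPow_totalDeriv]
      ring
  rw [jetEuler_eq_sum δ (N := N + 1) _ (by omega), key,
    jetDeriv_eq_zero_of_order_le (by omega), map_zero, mul_zero]

/-! ## Local functionals -/

/-- The class of a density modulo total `x`-derivatives. -/
def intx : MvPolynomial ℕ S →ₗ[ℝ]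
    MvPolynomial ℕ S ⧸ LinearMap.range (totalDeriv δ : MvPolynomial ℕ S →ₗ[ℝ] MvPolynomial ℕ S) :=
  Submodule.mkQ _

variable {δ} in
theorem intx_eq_zero_iff {h : MvPolynomial ℕ S} : intx δ h = 0 ↔ ∃ r, totalDeriv δ r = h := by
  rw [intx, Submodule.mkQ_apply, Submodule.Quotient.mk_eq_zero]
  rfl

theorem intx_totalDeriv (h : MvPolynomial ℕ S) : intx δ (totalDeriv δ h) = 0 :=
  intx_eq_zero_iff.2 ⟨h, rfl⟩

variable {δ} in
theorem jetEuler_eq_zero {h : MvPolynomial ℕ S} (hh : intx δ h = 0) : jetEuler δ h = 0 := by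
  obtain ⟨r, rfl⟩ := intx_eq_zero_iff.1 hh
  exact jetEuler_totalDeriv δ r

/-- Integration by parts, `k` times. -/
theorem intx_mul_totalPow (k : ℕ) (a b : MvPolynomial ℕ S) :
    intx δ (a * totalPow δ k b) = intx δ (b * ((-1) ^ k * totalPow δ k a)) := by
  induction k generalizing a with
  | zero => simp [mul_comm]
  | succ k ih =>
    have h : a * totalPow δ (k + 1) b =
        totalDeriv δ (a * totalPow δ k b) + (-totalDeriv δ a) * totalPow δ k b := by
      rw [Derivation.leibniz, totalPow_succ, smul_eq_mul, smul_eq_mul]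
      ring
    rw [h, map_add, intx_totalDeriv, zero_add, ih, map_neg, totalPow_totalDeriv, pow_succ]
    congr 1
    ring

/-! ### Evolutionary derivations and the second variation. -/

/-- The evolutionary derivation with `u_t = R`. -/
def evo (R : MvPolynomial ℕ S) : Derivation ℝ (MvPolynomial ℕ S) (MvPolynomial ℕ S) :=
  gen δ fun k => totalPow δ k R

@[simp] theorem evo_C (R : MvPolynomial ℕ S) (f : S) : evo δ R (C f) = R * C (δ f) := gen_C ..
@[simp] theorem evo_X (R : MvPolynomial ℕ S) (k : ℕ) :
    evo δ R (X k) = totalPow δ (k + 1) R := gen_X ..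

/-- The formal adjoint of `R ↦ evo R b`. -/
def evoAdj (b a : MvPolynomial ℕ S) : MvPolynomial ℕ S :=
  ∑ k ∈ Finset.range (order b), (-1) ^ k * totalPow δ k (a * jetDeriv δ k b)

theorem intx_mul_evo (a R b : MvPolynomial ℕ S) :
    intx δ (a * evo δ R b) = intx δ (R * evoAdj δ b a) := by
  rw [evo, gen_eq_sum δ _ _ le_rfl, evoAdj, Finset.mul_sum, Finset.mul_sum, map_sum, map_sum]
  refine Finset.sum_congr rfl fun k _ => ?_
  rw [← intx_mul_totalPow]
  congr 1
  ring

/-- The first variation formula: along `u_t = R`, the functional with density `h` changes at the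
rate `∫ R δh/δu`. It is the case `a = 1` of the adjoint formula. -/
theorem intx_evo (R h : MvPolynomial ℕ S) : intx δ (evo δ R h) = intx δ (R * jetEuler δ h) := by
  have := intx_mul_evo δ 1 R h
  simpa only [one_mul, evoAdj, ← jetEuler_eq_sum δ h le_rfl] using this

/-- This is what makes `evo` descend to functionals: it maps total derivatives to total derivatives.
-/
theorem evo_totalDeriv (R h : MvPolynomial ℕ S) :
    evo δ R (totalDeriv δ h) = totalDeriv δ (evo δ R h) := by
  have : ⁅evo δ R, totalDeriv δ⁆ = 0 := by
    refine derivation_ext_of_C_X (fun f => ?_) fun k => ?_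
    · simp [Derivation.commutator_apply, evo, totalPow_succ]
      ring
    · simp [Derivation.commutator_apply, evo, totalPow_succ]
  have := congrArg (fun d => d h) this
  simpa [Derivation.commutator_apply, sub_eq_zero] using this

theorem evo_totalPow (R h : MvPolynomial ℕ S) (k : ℕ) :
    evo δ R (totalPow δ k h) = totalPow δ k (evo δ R h) := by
  induction k with
  | zero => rfl
  | succ k ih => rw [totalPow_succ, totalPow_succ, evo_totalDeriv, ih]

variable {δ} in
theorem intx_evo_eq_zero {h : MvPolynomial ℕ S} (R : MvPolynomial ℕ S) (hh : intx δ h = 0) :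
    intx δ (evo δ R h) = 0 := by
  obtain ⟨r, rfl⟩ := intx_eq_zero_iff.1 hh
  rw [evo_totalDeriv, intx_totalDeriv]

variable {δ} in
theorem intx_evo_congr {h k : MvPolynomial ℕ S} (R : MvPolynomial ℕ S) (hh : intx δ h = intx δ k) :
    intx δ (evo δ R h) = intx δ (evo δ R k) := by
  rw [← sub_eq_zero, ← map_sub, ← map_sub]
  exact intx_evo_eq_zero R (by rw [map_sub, hh, sub_self])

/-- Since both flows commute with `∂_x`, their commutator is again evolutionary and is determined by
what it does to `u`. -/
theorem commutator_evo (Q R : MvPolynomial ℕ S) :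
    ⁅evo δ Q, evo δ R⁆ = evo δ (evo δ Q R - evo δ R Q) := by
  refine derivation_ext_of_C_X (fun f => ?_) fun k => ?_
  · simp only [Derivation.commutator_apply, evo_C, Derivation.leibniz, smul_eq_mul]
    ring
  · simp only [Derivation.commutator_apply, evo_X, evo_totalPow, map_sub]

/-- The second variation of a functional is symmetric. -/
theorem intx_evo_jetEuler_mul (h Q R : MvPolynomial ℕ S) :
    intx δ (evo δ Q (jetEuler δ h) * R) = intx δ (evo δ R (jetEuler δ h) * Q) := by
  -- Differentiate along `R` and then along `Q`. The term without second variation is accounted for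
  -- by the commutator of the two flows, so the rest must be symmetric in `Q` and `R`.
  have h1 : ∀ Q R : MvPolynomial ℕ S, intx δ (evo δ Q (evo δ R h)) =
      intx δ (evo δ Q R * jetEuler δ h) + intx δ (evo δ Q (jetEuler δ h) * R) := by
    intro Q R
    rw [intx_evo_congr Q (intx_evo δ R h), Derivation.leibniz, smul_eq_mul, smul_eq_mul, map_add,
      add_comm, mul_comm (jetEuler δ h), mul_comm R]
  have h2 := congrArg (fun d => intx δ (d h)) (commutator_evo δ Q R)
  simp only [Derivation.commutator_apply] at h2
  rw [map_sub, h1, h1, intx_evo, sub_mul, map_sub] at h2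
  rw [← sub_eq_zero] at h2 ⊢
  rw [← h2]
  abel

end Jets

section Jets

variable {S : Type*} [CommRing S]

/-! ## The grading -/

/-- Homogeneity for the grading `deg u^{(k)} = k`. -/
abbrev JetHomog (h : MvPolynomial ℕ S) (d : ℕ) : Prop :=
  IsWeightedHomogeneous (fun k : ℕ => k + 1) h d

theorem jetHomog_C (f : S) : JetHomog (C f) 0 := isWeightedHomogeneous_C _ f

theorem jetHomog_X (k : ℕ) : JetHomog (X k : MvPolynomial ℕ S) (k + 1) :=
  isWeightedHomogeneous_X S _ k

theorem JetHomog.of_eq {h : MvPolynomial ℕ S} {d e : ℕ} (hh : JetHomog h d) (hde : d = e) :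
    JetHomog h e := hde ▸ hh

theorem JetHomog.mul {a b : MvPolynomial ℕ S} {d e : ℕ} (ha : JetHomog a d) (hb : JetHomog b e) :
    JetHomog (a * b) (d + e) := IsWeightedHomogeneous.mul ha hb

theorem JetHomog.neg_one_pow_mul {h : MvPolynomial ℕ S} {d : ℕ} (hh : JetHomog h d) (k : ℕ) :
    JetHomog ((-1) ^ k * h) d := by
  obtain h1 | h1 := neg_one_pow_eq_or (MvPolynomial ℕ S) k
  · rwa [h1, one_mul]
  · rw [h1, neg_one_mul]
    exact IsWeightedHomogeneous.neg hh

variable [Algebra ℝ S] (δ : Derivation ℝ S S)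

variable {δ} in
-- The alternative avoids truncated subtraction: a derivative with respect to a coordinate of weight
-- larger than `d` is zero, and otherwise the degree drops by exactly `k`.
theorem JetHomog.jetDeriv {h : MvPolynomial ℕ S} {d : ℕ} (hh : JetHomog h d) (k : ℕ) :
    jetDeriv δ k h = 0 ∨ ∃ e, e + k = d ∧ JetHomog (jetDeriv δ k h) e := by
  obtain _ | k := k
  · refine Or.inr ⟨d, rfl, fun m hm => hh fun h0 => hm ?_⟩
    rw [jetDeriv_zero, coeff_jetPartialU, h0, map_zero]
  · rw [jetDeriv_succ_apply]
    by_cases hk : k + 1 ≤ d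
    · obtain ⟨e, rfl⟩ := Nat.exists_eq_add_of_le' hk
      exact Or.inr ⟨e, rfl, IsWeightedHomogeneous.pderiv hh rfl⟩
    · left
      ext1 m
      rw [coeff_pderiv, coeff_zero]
      refine mul_eq_zero_of_left (hh.coeff_eq_zero _ fun h0 => hk ?_) _
      rw [map_add, Finsupp.weight_single] at h0
      simp only [one_smul] at h0
      omega

variable {δ} in
theorem JetHomog.mul_jetDeriv {a h : MvPolynomial ℕ S} {d e : ℕ} {k : ℕ} (ha : JetHomog a (e + k))
    (hh : JetHomog h d) : JetHomog (a * FormalVar.jetDeriv δ k h) (e + d) := by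
  obtain h0 | ⟨d', rfl, h'⟩ := hh.jetDeriv (δ := δ) k
  · rw [h0, mul_zero]
    exact isWeightedHomogeneous_zero _ _ _
  · convert JetHomog.mul ha h' using 1
    omega

variable {δ} in
theorem JetHomog.totalDeriv {h : MvPolynomial ℕ S} {d : ℕ} (hh : JetHomog h d) :
    JetHomog (totalDeriv δ h) (d + 1) := by
  rw [FormalVar.totalDeriv, gen_eq_sum δ _ _ le_rfl, add_comm d]
  refine IsWeightedHomogeneous.sum _ _ _ fun k _ => JetHomog.mul_jetDeriv ?_ hh
  rw [add_comm]
  exact jetHomog_X k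

variable {δ} in
theorem JetHomog.totalPow {h : MvPolynomial ℕ S} {d : ℕ} (hh : JetHomog h d) (k : ℕ) :
    JetHomog (totalPow δ k h) (d + k) := by
  induction k with
  | zero => exact hh
  | succ k ih => rw [totalPow_succ]; exact ih.totalDeriv

variable {δ} in
theorem JetHomog.evo {R h : MvPolynomial ℕ S} {d e : ℕ} (hR : JetHomog R e) (hh : JetHomog h d) :
    JetHomog (evo δ R h) (e + d) := by
  rw [FormalVar.evo, gen_eq_sum δ _ _ le_rfl]
  exact IsWeightedHomogeneous.sum _ _ _ fun k _ => (hR.totalPow k).mul_jetDeriv hh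

variable {δ} in
theorem JetHomog.evoAdj {a b : MvPolynomial ℕ S} {d e : ℕ} (ha : JetHomog a d)
    (hb : JetHomog b e) : JetHomog (evoAdj δ b a) (d + e) := by
  refine IsWeightedHomogeneous.sum _ _ _ fun k _ => JetHomog.neg_one_pow_mul ?_ k
  obtain h0 | ⟨e', rfl, h'⟩ := hb.jetDeriv (δ := δ) k
  · rw [h0, mul_zero, map_zero]
    exact isWeightedHomogeneous_zero _ _ _
  · rw [← add_assoc]
    exact (JetHomog.mul ha h').totalPow k

/-! ## Differential operators -/

/-- The operator `∑_{s < N} a_s ∂_x^s`. -/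
def diffOp (a : ℕ → MvPolynomial ℕ S) (N : ℕ) : MvPolynomial ℕ S →ₗ[ℝ] MvPolynomial ℕ S :=
  ∑ s ∈ Finset.range N, (LinearMap.mulLeft ℝ (a s)).comp (totalPow δ s)

theorem diffOp_apply (a : ℕ → MvPolynomial ℕ S) (N : ℕ) (h : MvPolynomial ℕ S) :
    diffOp δ a N h = ∑ s ∈ Finset.range N, a s * totalPow δ s h := by
  simp [diffOp]

/-- The formal adjoint of `diffOp`. -/
def diffOpAdj (a : ℕ → MvPolynomial ℕ S) (N : ℕ) (h : MvPolynomial ℕ S) : MvPolynomial ℕ S :=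
  ∑ s ∈ Finset.range N, (-1) ^ s * totalPow δ s (h * a s)

/-- The derivative of the operator `diffOp δ a N` in the direction `R`. -/
def evoOp (R : MvPolynomial ℕ S) (a : ℕ → MvPolynomial ℕ S) (N : ℕ) :
    MvPolynomial ℕ S →ₗ[ℝ] MvPolynomial ℕ S :=
  diffOp δ (fun s => evo δ R (a s)) N

theorem intx_mul_diffOp (a : ℕ → MvPolynomial ℕ S) (N : ℕ) (f g : MvPolynomial ℕ S) :
    intx δ (f * diffOp δ a N g) = intx δ (g * diffOpAdj δ a N f) := by
  rw [diffOp_apply, diffOpAdj, Finset.mul_sum, Finset.mul_sum, map_sum, map_sum]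
  refine Finset.sum_congr rfl fun s _ => ?_
  rw [← intx_mul_totalPow, mul_assoc]

theorem evo_diffOp (R : MvPolynomial ℕ S) (a : ℕ → MvPolynomial ℕ S) (N : ℕ)
    (h : MvPolynomial ℕ S) :
    evo δ R (diffOp δ a N h) = evoOp δ R a N h + diffOp δ a N (evo δ R h) := by
  rw [diffOp_apply, diffOp_apply, evoOp, diffOp_apply, map_sum, ← Finset.sum_add_distrib]
  refine Finset.sum_congr rfl fun s _ => ?_
  rw [Derivation.leibniz, evo_totalPow, smul_eq_mul, smul_eq_mul]
  ring

/-- Homogeneity of degree `n` of the operator `diffOp δ a N`. -/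
def OpHomog (a : ℕ → MvPolynomial ℕ S) (N n : ℕ) : Prop :=
  ∀ s < N, ∃ e, e + s = n ∧ JetHomog (a s) e

variable {δ}

theorem OpHomog.diffOp {a : ℕ → MvPolynomial ℕ S} {N n d : ℕ} (ha : OpHomog a N n)
    {h : MvPolynomial ℕ S} (hh : JetHomog h d) : JetHomog (diffOp δ a N h) (n + d) := by
  rw [diffOp_apply]
  refine IsWeightedHomogeneous.sum _ _ _ fun s hs => ?_
  obtain ⟨e, rfl, he⟩ := ha s (Finset.mem_range.1 hs)
  convert he.mul (hh.totalPow s) using 1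
  omega

theorem OpHomog.diffOpAdj {a : ℕ → MvPolynomial ℕ S} {N n d : ℕ} (ha : OpHomog a N n)
    {h : MvPolynomial ℕ S} (hh : JetHomog h d) : JetHomog (diffOpAdj δ a N h) (n + d) := by
  refine IsWeightedHomogeneous.sum _ _ _ fun s hs => JetHomog.neg_one_pow_mul ?_ s
  obtain ⟨e, rfl, he⟩ := ha s (Finset.mem_range.1 hs)
  convert (hh.mul he).totalPow s using 1
  omega

theorem OpHomog.evo {a : ℕ → MvPolynomial ℕ S} {N n e : ℕ} (ha : OpHomog a N n)
    {R : MvPolynomial ℕ S} (hR : JetHomog R e) : OpHomog (fun s => evo δ R (a s)) N (e + n) := by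
  intro s hs
  obtain ⟨d, rfl, hd⟩ := ha s hs
  exact ⟨e + d, by omega, hR.evo hd⟩

/-! ## Skew-symmetric operators and the Jacobi identity -/

variable (δ) in
/-- Skew-symmetry of an operator with respect to the pairing `∫ f g dx`. -/
def IsSkewOp (P : MvPolynomial ℕ S →ₗ[ℝ] MvPolynomial ℕ S) : Prop :=
  ∀ f g, intx δ (f * P g + g * P f) = 0

theorem IsSkewOp.intx_mul {P : MvPolynomial ℕ S →ₗ[ℝ] MvPolynomial ℕ S} (hP : IsSkewOp δ P)
    (f g : MvPolynomial ℕ S) : intx δ (f * P g) = -intx δ (g * P f) := by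
  rw [eq_neg_iff_add_eq_zero, ← map_add, hP]

variable (δ) in
/-- The form `∫ f (D_{Q h} P) g dx` for `P = diffOp δ a N`. -/
def tripleForm (a : ℕ → MvPolynomial ℕ S) (N : ℕ) (Q : MvPolynomial ℕ S →ₗ[ℝ] MvPolynomial ℕ S)
    (f g h : MvPolynomial ℕ S) :
    MvPolynomial ℕ S ⧸ LinearMap.range (totalDeriv δ : MvPolynomial ℕ S →ₗ[ℝ] MvPolynomial ℕ S) :=
  intx δ (f * evoOp δ (Q h) a N g)

variable (δ) in
/-- The iterated bracket `{{F, G}_P, H}_Q`. -/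
def doubleBracket (P Q : MvPolynomial ℕ S →ₗ[ℝ] MvPolynomial ℕ S) (F G H : MvPolynomial ℕ S) :
    MvPolynomial ℕ S ⧸ LinearMap.range (totalDeriv δ : MvPolynomial ℕ S →ₗ[ℝ] MvPolynomial ℕ S) :=
  intx δ (jetEuler δ (jetEuler δ F * P (jetEuler δ G)) * Q (jetEuler δ H))

/-- By the first variation formula, the outer bracket differentiates the inner density along the
flow `u_t = Q δH`. Leibniz gives one term for each of the two variational derivatives and one for
the coefficients of `P`; skewness of `P` frees the derivative of `δG`. -/
theorem doubleBracket_eq {a : ℕ → MvPolynomial ℕ S} {N : ℕ} (hP : IsSkewOp δ (diffOp δ a N))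
    (Q : MvPolynomial ℕ S →ₗ[ℝ] MvPolynomial ℕ S) (F G H : MvPolynomial ℕ S) :
    doubleBracket δ (diffOp δ a N) Q F G H =
      intx δ (evo δ (Q (jetEuler δ H)) (jetEuler δ F) * diffOp δ a N (jetEuler δ G))
      - intx δ (evo δ (Q (jetEuler δ H)) (jetEuler δ G) * diffOp δ a N (jetEuler δ F))
      + tripleForm δ a N Q (jetEuler δ F) (jetEuler δ G) (jetEuler δ H) := by
  rw [doubleBracket, mul_comm, ← intx_evo, Derivation.leibniz, evo_diffOp, smul_eq_mul, smul_eq_mul,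
    mul_add, map_add, map_add, hP.intx_mul (jetEuler δ F), tripleForm, mul_comm (diffOp δ a N _)]
  abel

/-- The symmetrized Jacobi sum reduces to the derivatives of the coefficients. -/
theorem doubleBracket_cyclic {a b : ℕ → MvPolynomial ℕ S} {N M : ℕ}
    (ha : IsSkewOp δ (diffOp δ a N)) (hb : IsSkewOp δ (diffOp δ b M)) (F G H : MvPolynomial ℕ S) :
    (doubleBracket δ (diffOp δ a N) (diffOp δ b M) F G H
      + doubleBracket δ (diffOp δ a N) (diffOp δ b M) G H F
      + doubleBracket δ (diffOp δ a N) (diffOp δ b M) H F G)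
    + (doubleBracket δ (diffOp δ b M) (diffOp δ a N) F G H
      + doubleBracket δ (diffOp δ b M) (diffOp δ a N) G H F
      + doubleBracket δ (diffOp δ b M) (diffOp δ a N) H F G) =
    (tripleForm δ a N (diffOp δ b M) (jetEuler δ F) (jetEuler δ G) (jetEuler δ H)
      + tripleForm δ a N (diffOp δ b M) (jetEuler δ G) (jetEuler δ H) (jetEuler δ F)
      + tripleForm δ a N (diffOp δ b M) (jetEuler δ H) (jetEuler δ F) (jetEuler δ G))
    + (tripleForm δ b M (diffOp δ a N) (jetEuler δ F) (jetEuler δ G) (jetEuler δ H)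
      + tripleForm δ b M (diffOp δ a N) (jetEuler δ G) (jetEuler δ H) (jetEuler δ F)
      + tripleForm δ b M (diffOp δ a N) (jetEuler δ H) (jetEuler δ F) (jetEuler δ G)) := by
  simp only [doubleBracket_eq ha, doubleBracket_eq hb]
  -- Symmetry of the second variation turns each term in which the Hessian of a functional pairs a
  -- `Q`-flow with a `P`-flow into one that occurs, with the opposite sign, in the sum with `P` and
  -- `Q` exchanged. For `P ≠ Q` this cancellation needs both orderings, whence the symmetrized
  -- statement.
  rw [intx_evo_jetEuler_mul δ F (diffOp δ b M (jetEuler δ H)) (diffOp δ a N (jetEuler δ G)),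
    intx_evo_jetEuler_mul δ G (diffOp δ b M (jetEuler δ H)) (diffOp δ a N (jetEuler δ F)),
    intx_evo_jetEuler_mul δ G (diffOp δ b M (jetEuler δ F)) (diffOp δ a N (jetEuler δ H)),
    intx_evo_jetEuler_mul δ H (diffOp δ b M (jetEuler δ F)) (diffOp δ a N (jetEuler δ G)),
    intx_evo_jetEuler_mul δ H (diffOp δ b M (jetEuler δ G)) (diffOp δ a N (jetEuler δ F)),
    intx_evo_jetEuler_mul δ F (diffOp δ b M (jetEuler δ G)) (diffOp δ a N (jetEuler δ H))]
  abel

/-- The cyclic sum of `tripleForm` is represented in its first argument by a homogeneous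
differential polynomial. -/
theorem exists_tripleForm_cyclic_eq {a b : ℕ → MvPolynomial ℕ S} {N M n m d e : ℕ}
    (ha : OpHomog a N n) (hb : OpHomog b M m) {g h : MvPolynomial ℕ S} (hg : JetHomog g d)
    (hh : JetHomog h e) :
    ∃ W, JetHomog W (n + m + d + e) ∧ ∀ f,
      tripleForm δ a N (diffOp δ b M) f g h + tripleForm δ a N (diffOp δ b M) g h f
      + tripleForm δ a N (diffOp δ b M) h f g = intx δ (f * W) := by
  -- In the three cyclic terms `f` occurs respectively as outer factor, through the direction `Q f`,
  -- and as the argument of the operator. Each summand is obtained by moving the relevant operators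
  -- off `f` by adjunction.
  refine ⟨evoOp δ (diffOp δ b M h) a N g
    + diffOpAdj δ b M (∑ s ∈ Finset.range N, evoAdj δ (a s) (g * totalPow δ s h))
    + diffOpAdj δ (fun s => evo δ (diffOp δ b M g) (a s)) N h, ?_, fun f => ?_⟩
  · refine .add (.add ?_ ?_) ?_
    · exact ((ha.evo (hb.diffOp hh)).diffOp hg).of_eq (by omega)
    · have : JetHomog (∑ s ∈ Finset.range N, evoAdj δ (a s) (g * totalPow δ s h)) (d + e + n) := by
        refine IsWeightedHomogeneous.sum _ _ _ fun s hs => ?_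
        obtain ⟨k, rfl, hk⟩ := ha s (Finset.mem_range.1 hs)
        exact ((hg.mul (hh.totalPow s)).evoAdj hk).of_eq (by omega)
      exact (hb.diffOpAdj this).of_eq (by omega)
    · exact ((ha.evo (hb.diffOp hg)).diffOpAdj hh).of_eq (by omega)
  · rw [mul_add, mul_add, map_add, map_add, tripleForm, tripleForm, tripleForm, ← intx_mul_diffOp,
      ← intx_mul_diffOp]
    congr 2
    rw [mul_comm (∑ s ∈ _, _), Finset.mul_sum, map_sum, evoOp, diffOp_apply, Finset.mul_sum,
      map_sum]
    refine Finset.sum_congr rfl fun s _ => ?_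
    rw [← intx_mul_evo]
    congr 1
    ring

end Jets

section Jets

variable {S : Type*} [CommRing S] [Algebra ℝ S] {δ : Derivation ℝ S S} {X₀ : Type*}

/-! ## Functions of `u` as test functions -/

/-- A realization of a differential algebra by functions on a set, with a coordinate function
centred at each point. -/
structure Realization (δ : Derivation ℝ S S) (X₀ : Type*) where
  /-- The value of a function at a point. -/
  ev : X₀ → S →+* ℝ
  ext : ∀ f g, (∀ x, ev x f = ev x g) → f = g
  /-- The coordinate centred at a point. -/
  coord : X₀ → S
  ev_coord : ∀ x, ev x (coord x) = 0
  deriv_coord : ∀ x, δ (coord x) = 1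

theorem Realization.map_ext (ρ : Realization δ X₀) {p q : MvPolynomial ℕ S}
    (h : ∀ x, map (ρ.ev x) p = map (ρ.ev x) q) : p = q := by
  ext1 m
  refine ρ.ext _ _ fun x => ?_
  simpa only [coeff_map] using congrArg (coeff m) (h x)

/-- Near a zero of `u - a` only the term of lowest order of a derivative of
`(u - a) ^ (k + j) * b` survives. -/
theorem totalPow_coord_pow_mul (ρ : Realization δ X₀) (x : X₀) (k j : ℕ) (b : MvPolynomial ℕ S) :
    ∃ r : MvPolynomial ℕ S, ∃ d : ℕ, d ≠ 0 ∧ totalPow δ k (C (ρ.coord x) ^ (k + j) * b) =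
      C (ρ.coord x) ^ (j + 1) * r + (d : MvPolynomial ℕ S) * (C (ρ.coord x) ^ j * X 0 ^ k * b) := by
  have hv : totalDeriv δ (C (ρ.coord x) : MvPolynomial ℕ S) = X 0 := by
    rw [totalDeriv_C, ρ.deriv_coord, C_1, mul_one]
  induction k generalizing j with
  | zero => exact ⟨0, 1, one_ne_zero, by simp⟩
  | succ k ih =>
    -- The exponent `k + 1 + j` equals `k + (j + 1)`, so after `k` derivatives the factor `(u - a) ^
    -- (j + 1)` remains; the last derivative lowers it once more and contributes the nonzero integer
    -- `j + 1`.
    obtain ⟨r, d, hd, h⟩ := ih (j + 1)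
    refine ⟨((j + 2 : ℕ) : MvPolynomial ℕ S) * X 0 * r + C (ρ.coord x) * totalDeriv δ r
      + (d : MvPolynomial ℕ S) * totalDeriv δ (X 0 ^ k * b), d * (j + 1), mul_ne_zero hd (by omega), ?_⟩
    rw [totalPow_succ, show k + 1 + j = k + (j + 1) by omega, h, mul_assoc (C (ρ.coord x) ^ (j + 1)),
      mul_left_comm (d : MvPolynomial ℕ S), map_add, Derivation.leibniz, Derivation.leibniz,
      Derivation.leibniz_pow, Derivation.leibniz_pow, Derivation.leibniz, Derivation.map_natCast, hv]
    simp only [smul_eq_mul, nsmul_eq_mul, Nat.add_sub_cancel, mul_zero, add_zero]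
    push_cast
    ring

theorem map_ev_coord (ρ : Realization δ X₀) (x : X₀) :
    map (ρ.ev x) (C (ρ.coord x) : MvPolynomial ℕ S) = 0 := by
  rw [map_C, ρ.ev_coord, C_0]

theorem map_ev_totalPow_of_lt (ρ : Realization δ X₀) (x : X₀) {k m : ℕ} (hk : k < m) (b : MvPolynomial ℕ S) :
    map (ρ.ev x) (totalPow δ k (C (ρ.coord x) ^ m * b)) = 0 := by
  obtain ⟨j, rfl⟩ := Nat.exists_eq_add_of_lt hk
  obtain ⟨r, d, -, h⟩ := totalPow_coord_pow_mul ρ x k (j + 1) b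
  rw [add_assoc, h]
  simp [ρ.ev_coord]

/-- At `u = a` every derivative must fall on a factor of `(u - a) ^ k`, so `b` stays
undifferentiated. Functions of `u` can therefore isolate a single power of `∂_x`. -/
theorem exists_map_ev_totalPow_self (ρ : Realization δ X₀) (x : X₀) (k : ℕ) (b : MvPolynomial ℕ S) :
    ∃ d : ℕ, d ≠ 0 ∧ map (ρ.ev x) (totalPow δ k (C (ρ.coord x) ^ k * b)) =
      (d : MvPolynomial ℕ ℝ) * X 0 ^ k * map (ρ.ev x) b := by
  obtain ⟨r, d, hd, h⟩ := totalPow_coord_pow_mul ρ x k 0 b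
  refine ⟨d, hd, ?_⟩
  rw [add_zero] at h
  rw [h]
  simp [ρ.ev_coord, mul_assoc]

theorem eq_zero_of_natCast_mul_X_pow_mul {d k : ℕ} (hd : d ≠ 0) {p : MvPolynomial ℕ ℝ}
    (h : (d : MvPolynomial ℕ ℝ) * X 0 ^ k * p = 0) : p = 0 := by
  simpa [hd] using h

/-- An operator which annihilates all functions of `u` vanishes. -/
theorem diffOp_coeff_eq_zero (ρ : Realization δ X₀) {c : ℕ → MvPolynomial ℕ S} {N : ℕ}
    (h : ∀ f, diffOp δ c N (C f) = 0) : ∀ s < N, c s = 0 := by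
  induction N with
  | zero => simp
  | succ N ih =>
    have hN : c N = 0 := by
      refine ρ.map_ext fun x => ?_
      -- Tested on `(u - x) ^ N` and evaluated at `u = x`, all lower powers of `∂_x` give zero, and
      -- a nonzero multiple of `u_x ^ N c_N` remains.
      have h1 := congrArg (map (ρ.ev x)) (h (ρ.coord x ^ N))
      rw [diffOp_apply, map_sum, map_zero, Finset.sum_range_succ, Finset.sum_eq_zero fun s hs => ?_,
        zero_add, map_mul] at h1
      · obtain ⟨d, hd, h2⟩ := exists_map_ev_totalPow_self ρ x N (1 : MvPolynomial ℕ S)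
        rw [mul_one] at h2
        rw [C_pow, h2, map_one, mul_one, mul_comm] at h1
        rw [eq_zero_of_natCast_mul_X_pow_mul hd h1, map_zero]
      · have h2 := map_ev_totalPow_of_lt ρ x (Finset.mem_range.1 hs) (1 : MvPolynomial ℕ S)
        rw [mul_one] at h2
        rw [map_mul, C_pow, h2, mul_zero]
    intro s hs
    obtain hs | rfl := Nat.lt_succ_iff_lt_or_eq.1 hs
    · refine ih (fun f => ?_) s hs
      simpa [diffOp_apply, Finset.sum_range_succ, hN] using h f
    · exact hN

variable (δ) in
-- Among the jet derivatives only `∂/∂u` sees the factor `f`; this separates the single term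
-- containing `f'` from those containing `f`.
theorem jetEuler_C_mul (f : S) (W : MvPolynomial ℕ S) {N : ℕ} (hN : order W ≤ N) :
    jetEuler δ (C f * W) = C (δ f) * W
      + ∑ k ∈ Finset.range N, (-1) ^ k * totalPow δ k (C f * jetDeriv δ k W) := by
  have h0 : order (C f * W) ≤ N := by
    classical
    refine le_trans (Nat.succ_le_succ (Finset.sup_mono ((vars_mul _ _).trans ?_))) hN
    simp
  have h1 : order W ≠ 0 := by simp [order]
  obtain ⟨N, rfl⟩ := Nat.exists_eq_succ_of_ne_zero (by omega : N ≠ 0)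
  rw [jetEuler_eq_sum _ _ h0, Finset.sum_range_succ', Finset.sum_range_succ']
  simp only [jetDeriv_succ_apply, jetDeriv_zero, pow_zero, one_mul, totalPow_zero,
    Derivation.leibniz, jetPartialU_C, pderiv_C, smul_eq_mul, mul_zero, add_zero]
  ring

/-- A homogeneous differential polynomial of degree at least two, all of whose products with
functions of `u` are total derivatives, is zero. -/
theorem eq_zero_of_intx_C_mul (ρ : Realization δ X₀) {W : MvPolynomial ℕ S} {n : ℕ} (hn : 2 ≤ n) (hW : JetHomog W n)
    (h : ∀ f, intx δ (C f * W) = 0) : W = 0 := by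
  have hE (f : S) := jetEuler_C_mul δ f W le_rfl
  simp only [fun f => jetEuler_eq_zero (h f)] at hE
  -- Descending induction, with `j` measuring the distance of `m` from the order of `W`. The test
  -- function `(u - a) ^ m` kills the terms with `k < m` at `u = a`, and the induction hypothesis
  -- kills those with `k > m`. The condition `2 ≤ m` ensures that `f'` also vanishes at `a`, so that
  -- the term `f' W` disappears.
  have high : ∀ j m, 2 ≤ m → order W ≤ m + j → jetDeriv δ m W = 0 := by
    intro j
    induction j with
    | zero => exact fun m _ hm => jetDeriv_eq_zero_of_order_le hm
    | succ j ih =>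
      intro m hm hj
      by_cases hmN : m < order W
      · refine ρ.map_ext fun x => ?_
        have h1 := congrArg (map (ρ.ev x)) (hE (ρ.coord x ^ m))
        rw [map_zero, map_add, map_sum,
          Finset.sum_eq_single_of_mem m (Finset.mem_range.2 hmN) fun k _ hk => ?_] at h1
        · obtain ⟨d, hd, h2⟩ := exists_map_ev_totalPow_self ρ x m (jetDeriv δ m W)
          obtain ⟨l, rfl⟩ := Nat.exists_eq_add_of_le' hm
          rw [map_mul (map (ρ.ev x)), map_mul (map (ρ.ev x)), C_pow, h2, map_C,
            Derivation.leibniz_pow, ρ.deriv_coord] at h1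
          have h3 : ρ.ev x ((l + 2) • ρ.coord x ^ (l + 2 - 1) • (1 : S)) = 0 := by
            simp [ρ.ev_coord]
          rw [h3, C_0, zero_mul, zero_add, eq_comm, mul_eq_zero] at h1
          rw [map_zero]
          exact eq_zero_of_natCast_mul_X_pow_mul hd (h1.resolve_left (by simp))
        · obtain hk | hk := lt_or_gt_of_ne hk
          · rw [C_pow, map_mul, map_ev_totalPow_of_lt ρ x hk, mul_zero]
          · rw [ih k (by omega) (by omega), mul_zero, map_zero, mul_zero, map_zero]
      · exact jetDeriv_eq_zero_of_order_le (by omega)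
  have high' : ∀ m, 2 ≤ m → jetDeriv δ m W = 0 := fun m hm => high _ m hm (le_add_self)
  -- Now test with `f = u - a`, for which `f' = 1`. At `u = a` only `W` and the first-order term
  -- `-u_x ∂W/∂u_x` survive.
  have low : W = X 0 * pderiv 0 W := by
    refine ρ.map_ext fun x => ?_
    have h1 := jetEuler_C_mul δ (ρ.coord x) W (le_max_left _ 2)
    rw [jetEuler_eq_zero (h _), ρ.deriv_coord, C_1, one_mul,
      ← Finset.sum_subset (Finset.range_mono (le_max_right _ 2)) fun k _ hk => ?_] at h1
    · have h2 := congrArg (map (ρ.ev x)) h1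
      simp only [Finset.sum_range_succ, Finset.range_zero, Finset.sum_empty, totalPow_succ,
        totalPow_zero, Derivation.leibniz, jetDeriv_succ_apply, totalDeriv_C,
        ρ.deriv_coord, C_1, smul_eq_mul, map_add, map_mul, map_ev_coord, map_zero] at h2
      rw [map_mul]
      simp at h2 ⊢
      linear_combination -h2
    · rw [high' k (by simpa [Nat.succ_le_iff] using hk), mul_zero, map_zero, mul_zero]
  ext1 m
  rw [coeff_zero]
  by_contra hm
  -- No variable beyond `u_x` occurs in `W`, so homogeneity leaves only the monomial `u_x ^ n`. The
  -- relation `low` multiplies its coefficient by `n`, which forces the coefficient to vanish unless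
  -- `n = 1`. Degree one is a true exception: `f(u) u_x` is always a total derivative on an
  -- interval.
  have hsupp : ∀ i, m (i + 1) = 0 := by
    intro i
    by_contra hi
    have h1 : coeff (m - Finsupp.single (i + 1) 1) (pderiv (i + 1) W) = 0 := by
      rw [← jetDeriv_succ_apply δ, high' _ (by omega), coeff_zero]
    rw [coeff_pderiv, tsub_add_cancel_of_le (by simpa [Nat.one_le_iff_ne_zero] using hi)] at h1
    refine hm (ρ.ext _ _ fun x => ?_)
    have h2 := congrArg (ρ.ev x) h1
    rw [map_mul, map_zero, map_add, map_natCast, map_one] at h2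
    exact ((mul_eq_zero.1 h2).resolve_right (by positivity)).trans (map_zero _).symm
  have hm0 : m = Finsupp.single 0 (m 0) := by
    ext i
    obtain _ | i := i
    · simp
    · simp [hsupp]
  have hdeg := hW hm
  rw [hm0, Finsupp.weight_single] at hdeg
  simp only [zero_add, smul_eq_mul, mul_one] at hdeg
  have h1 := congrArg (coeff m) low
  rw [coeff_X_mul', if_pos (by simp; omega), coeff_pderiv,
    tsub_add_cancel_of_le (by simp; omega)] at h1
  refine hm (ρ.ext _ _ fun x => ?_)
  have h2 := congrArg (ρ.ev x) h1
  rw [map_mul, map_add, map_natCast, map_one] at h2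
  simp only [Finsupp.coe_tsub, Pi.sub_apply, Finsupp.single_eq_same] at h2
  rw [Nat.cast_sub (by omega), hdeg] at h2
  have h3 : (n : ℝ) - 1 ≠ 0 := by
    have : (2 : ℝ) ≤ n := by exact_mod_cast hn
    linarith
  have h4 : ρ.ev x (coeff m W) * ((n : ℝ) - 1) = 0 := by
    push_cast at h2
    linear_combination -h2
  exact ((mul_eq_zero.1 h4).resolve_right h3).trans (map_zero _).symm

end Jets

/-! ## Sums over antidiagonals -/

section Sums

open Finset hiding antidiagonal mem_antidiagonal
open Finset.HasAntidiagonal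

variable {V : Type*} [AddCommMonoid V]

theorem sum_antidiagonal_triple_swap (n : ℕ) (φ : ℕ → ℕ → ℕ → V) :
    ∑ a ∈ antidiagonal n, ∑ b ∈ antidiagonal a.2, φ a.1 b.1 b.2 =
      ∑ a ∈ antidiagonal n, ∑ b ∈ antidiagonal a.2, φ b.2 b.1 a.1 := by
  rw [sum_sigma', sum_sigma']
  refine sum_nbij' (fun x => ⟨(x.2.2, x.2.1 + x.1.1), (x.2.1, x.1.1)⟩)
    (fun x => ⟨(x.2.2, x.2.1 + x.1.1), (x.2.1, x.1.1)⟩) ?_ ?_ ?_ ?_ ?_ <;>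
  rintro ⟨⟨a, b⟩, ⟨c, d⟩⟩ h <;>
  simp only [mem_sigma, mem_antidiagonal, and_true] at h ⊢
  · omega
  · omega
  · obtain ⟨-, rfl⟩ := h; rfl
  · obtain ⟨-, rfl⟩ := h; rfl

theorem sum_antidiagonal_triple_rotate (n : ℕ) (φ : ℕ → ℕ → ℕ → V) :
    ∑ a ∈ antidiagonal n, ∑ b ∈ antidiagonal a.2, φ a.1 b.1 b.2 =
      ∑ a ∈ antidiagonal n, ∑ b ∈ antidiagonal a.2, φ b.2 a.1 b.1 := by
  rw [sum_sigma', sum_sigma']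
  refine sum_nbij' (fun x => ⟨(x.2.1, x.2.2 + x.1.1), (x.2.2, x.1.1)⟩)
    (fun x => ⟨(x.2.2, x.1.1 + x.2.1), (x.1.1, x.2.1)⟩) ?_ ?_ ?_ ?_ ?_ <;>
  rintro ⟨⟨a, b⟩, ⟨c, d⟩⟩ h <;>
  simp only [mem_sigma, mem_antidiagonal, and_true] at h ⊢
  · omega
  · omega
  · obtain ⟨-, rfl⟩ := h; rfl
  · obtain ⟨-, rfl⟩ := h; rfl

/-- For iterated brackets: the orders `k`, `l` contributed by the two operators are gathered into
one total `t.1`, separating them from the orders of the three functionals. -/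
theorem sum_antidiagonal_quintuple (n : ℕ) (φ : ℕ → ℕ → ℕ → ℕ → ℕ → V) :
    ∑ a ∈ antidiagonal n, ∑ b ∈ antidiagonal a.2,
      ∑ a' ∈ antidiagonal a.1, ∑ b' ∈ antidiagonal a'.2, φ a'.1 b'.1 b'.2 b.1 b.2 =
    ∑ t ∈ antidiagonal n, ∑ s ∈ antidiagonal t.2,
      ∑ r ∈ antidiagonal s.2, ∑ k ∈ antidiagonal t.1, φ s.1 k.1 r.1 k.2 r.2 := by
  simp only [sum_sigma']
  refine sum_nbij'
    (fun x => ⟨(x.2.2.2.1 + x.2.1.1, x.2.2.1.1 + (x.2.2.2.2 + x.2.1.2)),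
      ⟨(x.2.2.1.1, x.2.2.2.2 + x.2.1.2), ⟨(x.2.2.2.2, x.2.1.2), (x.2.2.2.1, x.2.1.1)⟩⟩⟩)
    (fun x => ⟨(x.2.1.1 + (x.2.2.2.1 + x.2.2.1.1), x.2.2.2.2 + x.2.2.1.2),
      ⟨(x.2.2.2.2, x.2.2.1.2), ⟨(x.2.1.1, x.2.2.2.1 + x.2.2.1.1), (x.2.2.2.1, x.2.2.1.1)⟩⟩⟩)
    ?_ ?_ ?_ ?_ ?_ <;>
  rintro ⟨⟨a, b⟩, ⟨⟨c, d⟩, ⟨⟨e, f⟩, ⟨g, h⟩⟩⟩⟩ hx <;>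
  simp only [mem_sigma, mem_antidiagonal, and_true] at hx ⊢
  · omega
  · omega
  · obtain ⟨-, rfl, rfl, rfl⟩ := hx; rfl
  · obtain ⟨-, rfl, rfl, rfl⟩ := hx; rfl

/-- The inductive step in `ε`: once the bracket terms of order below `n` contribute nothing, only
the order `n` term applied to the leading parts of the functionals remains. -/
theorem sum_antidiagonal_triple_eq_single (n : ℕ) (φ : ℕ → ℕ → ℕ → V)
    (h : ∀ i k j, k < n → φ i k j = 0) :
    ∑ a ∈ antidiagonal n, ∑ b ∈ antidiagonal a.2, φ a.1 b.1 b.2 = φ 0 n 0 := by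
  rw [sum_eq_single_of_mem (0, n) (by simp), sum_eq_single_of_mem (n, 0) (by simp)]
  · rintro ⟨k, j⟩ hb hne
    rw [mem_antidiagonal] at hb
    refine h _ _ _ (lt_of_le_of_ne (by simp at hb; omega) fun hk => hne ?_)
    simp at hb hk
    simp; omega
  · rintro ⟨i, m⟩ ha hne
    refine sum_eq_zero fun b hb => h _ _ _ ?_
    rw [mem_antidiagonal] at ha hb
    simp only at ha hb
    rcases Nat.eq_zero_or_pos i with rfl | hi
    · exact absurd (by simp at ha; simp [ha]) hne
    · omega

end Sums

/-! ## Brackets of local functionals -/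

section Jets

variable {S : Type*} [CommRing S]

/-- Rigidity needs homogeneous input; this principle passes to arbitrary differential polynomials by
additivity. -/
theorem jetHomog_induction {p : MvPolynomial ℕ S → Prop} (hadd : ∀ a b, p a → p b → p (a + b))
    (hhom : ∀ d a, JetHomog a d → p a) (a : MvPolynomial ℕ S) : p a := by
  induction a using MvPolynomial.monomial_add_induction_on with
  | C a => exact hhom 0 _ (jetHomog_C a)
  | monomial_add m b f _ _ hf =>
    exact hadd _ _ (hhom _ _ (isWeightedHomogeneous_monomial _ m b rfl)) hf

variable [Algebra ℝ S] (δ : Derivation ℝ S S) {X₀ : Type*}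

/-- The operator `∑_s A_{k,s} ∂_x^s`. -/
abbrev bracketOp (A : ℕ → ℕ → MvPolynomial ℕ S) (k : ℕ) :
    MvPolynomial ℕ S →ₗ[ℝ] MvPolynomial ℕ S := diffOp δ (A k) (k + 2)

/-- The density of the bracket of two local functionals. -/
def jetBracket (A : ℕ → ℕ → MvPolynomial ℕ S) (F G : ℕ → MvPolynomial ℕ S) (n : ℕ) :
    MvPolynomial ℕ S :=
  ∑ a ∈ antidiagonal n, ∑ b ∈ antidiagonal a.2,
    jetEuler δ (F a.1) * bracketOp δ A b.1 (jetEuler δ (G b.2))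

/-- The coefficients of order `k` of a graded bracket are homogeneous of degree `k + 1`. -/
def JetGraded (A : ℕ → ℕ → MvPolynomial ℕ S) : Prop := ∀ k, OpHomog (A k) (k + 2) (k + 1)

variable {δ}

theorem jetEuler_C (f : S) : jetEuler δ (C f) = C (δ f) := by
  rw [jetEuler_eq_sum (N := 1) _ _ (by simp [order])]
  simp [jetDeriv_zero]

theorem jetEuler_zero : jetEuler δ 0 = 0 := by
  simpa using jetEuler_C (δ := δ) 0

theorem jetEuler_sum {ι : Type*} (s : Finset ι) (f : ι → MvPolynomial ℕ S) :
    jetEuler δ (∑ i ∈ s, f i) = ∑ i ∈ s, jetEuler δ (f i) :=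
  map_sum (AddMonoidHom.mk' (jetEuler δ) (jetEuler_add δ)) f s

/-! ### Uniqueness of a graded bracket with a large commuting family. -/

/-- Two graded brackets with the same leading term and a common sufficiently large commuting
family coincide. -/
theorem jetBracket_unique (ρ : Realization δ X₀) (hδ : Function.Surjective δ) {N : ℕ}
    {A B : ℕ → ℕ → MvPolynomial ℕ S} (hA : JetGraded A) (hB : JetGraded B) (h0 : A 0 = B 0)
    (hA' : ∀ k s, k + 1 < s → A k s = 0) (hB' : ∀ k s, k + 1 < s → B k s = 0)
    {H : S → ℕ → MvPolynomial ℕ S} (hH : ∀ f, H f 0 = C f)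
    (hAH : ∀ f g, ∀ n < N, intx δ (jetBracket δ A (H f) (H g) n) = 0)
    (hBH : ∀ f g, ∀ n < N, intx δ (jetBracket δ B (H f) (H g) n) = 0) :
    ∀ k < N, A k = B k := by
  intro k
  induction k using Nat.strong_induction_on with
  | _ k ih =>
  intro hk
  obtain rfl | hk0 := Nat.eq_zero_or_pos k
  · exact h0
  have hop : ∀ g, diffOp δ (fun s => A k s - B k s) (k + 2) g =
      bracketOp δ A k g - bracketOp δ B k g := by
    intro g
    simp only [diffOp_apply, sub_mul, Finset.sum_sub_distrib]
  have hAB : OpHomog (fun s => A k s - B k s) (k + 2) (k + 1) := by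
    intro s hs
    obtain ⟨e, he, h⟩ := hA k s hs
    obtain ⟨e', he', h'⟩ := hB k s hs
    obtain rfl : e = e' := by omega
    exact ⟨e, he, IsWeightedHomogeneous.sub h h'⟩
  -- The lower orders of the two brackets agree, so subtracting the commutation relations leaves `∫
  -- F' (A_k - B_k) G' = 0`. Surjectivity of `δ` makes `F'` and `G'` arbitrary. The expression
  -- multiplying `F'` has degree `k + 1 ≥ 2`, which is where `k > 0` is used.
  have hzero : ∀ g, diffOp δ (fun s => A k s - B k s) (k + 2) (C g) = 0 := by
    intro g
    refine eq_zero_of_intx_C_mul ρ (n := k + 1) (by omega) (hAB.diffOp (jetHomog_C g)) fun f => ?_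
    obtain ⟨F, rfl⟩ := hδ f
    obtain ⟨G, rfl⟩ := hδ g
    have h1 : jetBracket δ A (H F) (H G) k - jetBracket δ B (H F) (H G) k =
        jetEuler δ (H F 0) * bracketOp δ A k (jetEuler δ (H G 0)) -
        jetEuler δ (H F 0) * bracketOp δ B k (jetEuler δ (H G 0)) := by
      simp only [jetBracket, ← Finset.sum_sub_distrib]
      exact sum_antidiagonal_triple_eq_single k (fun i k j =>
        jetEuler δ (H F i) * bracketOp δ A k (jetEuler δ (H G j)) -
        jetEuler δ (H F i) * bracketOp δ B k (jetEuler δ (H G j)))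
        fun i l j hl => by rw [bracketOp, ih l hl (by omega), sub_self]
    rw [hH, hH, jetEuler_C, jetEuler_C, ← mul_sub, ← hop] at h1
    rw [← h1, map_sub, hAH F G k hk, hBH F G k hk, sub_zero]
  funext s
  by_cases hs : s < k + 2
  · exact sub_eq_zero.1 (diffOp_coeff_eq_zero ρ hzero s hs)
  · rw [hA' k s (by omega), hB' k s (by omega)]

/-! ### Antisymmetry from commutativity. -/

theorem jetBracket_add (A : ℕ → ℕ → MvPolynomial ℕ S) (F G : ℕ → MvPolynomial ℕ S) (n : ℕ) :
    jetBracket δ A F G n + jetBracket δ A G F n =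
      ∑ a ∈ antidiagonal n, ∑ b ∈ antidiagonal a.2,
        (jetEuler δ (F a.1) * bracketOp δ A b.1 (jetEuler δ (G b.2)) +
          jetEuler δ (G b.2) * bracketOp δ A b.1 (jetEuler δ (F a.1))) := by
  simp only [Finset.sum_add_distrib]
  rw [jetBracket, jetBracket, sum_antidiagonal_triple_swap n fun i k j =>
    jetEuler δ (G i) * bracketOp δ A k (jetEuler δ (F j))]

/-- A bracket with a sufficiently large commuting family is skew-symmetric. -/
theorem isSkewOp_of_commute (ρ : Realization δ X₀) (hδ : Function.Surjective δ) {N : ℕ}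
    {A : ℕ → ℕ → MvPolynomial ℕ S} (hA : JetGraded A) (h0 : IsSkewOp δ (bracketOp δ A 0))
    {H : S → ℕ → MvPolynomial ℕ S} (hH : ∀ f, H f 0 = C f)
    (hAH : ∀ f g, ∀ n < N, intx δ (jetBracket δ A (H f) (H g) n) = 0) :
    ∀ k < N, IsSkewOp δ (bracketOp δ A k) := by
  intro k
  induction k using Nat.strong_induction_on with
  | _ k ih =>
  intro hk
  -- The order zero operator has degree one, where rigidity fails; its skewness is therefore a
  -- hypothesis.
  obtain rfl | hk0 := Nat.eq_zero_or_pos k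
  · exact h0
  set P := bracketOp δ A k with hP
  -- On functions of `u`: in the sum of the two commutation relations, the lower orders cancel
  -- because those operators are already skew.
  have hfun : ∀ f g : S, intx δ (C f * P (C g) + C g * P (C f)) = 0 := by
    intro f g
    obtain ⟨F, rfl⟩ := hδ f
    obtain ⟨G, rfl⟩ := hδ g
    have h1 := congrArg (intx δ) (jetBracket_add (δ := δ) A (H F) (H G) k)
    simp only [map_add (intx δ) (jetBracket δ A (H F) (H G) k), hAH F G k hk, hAH G F k hk,
      map_sum, add_zero] at h1
    rw [sum_antidiagonal_triple_eq_single k (fun i k j => intx δ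
      (jetEuler δ (H F i) * bracketOp δ A k (jetEuler δ (H G j)) +
        jetEuler δ (H G j) * bracketOp δ A k (jetEuler δ (H F i))))
      fun i l j hl => ih l hl (by omega) _ _, hH, hH, jetEuler_C, jetEuler_C] at h1
    exact h1.symm
  have hslot : ∀ f g, intx δ (f * P g + g * P f) =
      intx δ (f * (P g + diffOpAdj δ (A k) (k + 2) g)) := by
    intro f g
    rw [mul_add, map_add, map_add, hP, intx_mul_diffOp δ _ _ g f]
  have hW : ∀ {d : ℕ} {g : MvPolynomial ℕ S}, JetHomog g d →
      JetHomog (P g + diffOpAdj δ (A k) (k + 2) g) (k + 1 + d) :=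
    fun hg => .add ((hA k).diffOp hg) ((hA k).diffOpAdj hg)
  -- The two slots are freed one after the other. Here the first becomes arbitrary while the second
  -- is still a function of `u`; afterwards the roles are exchanged.
  have h1 : ∀ f g, intx δ (f * P (C g) + C g * P f) = 0 := by
    intro f g
    rw [hslot, eq_zero_of_intx_C_mul ρ (by omega) (hW (jetHomog_C g)) fun φ => by
      rw [← hslot, hfun], mul_zero, map_zero]
  intro f g
  induction g using jetHomog_induction with
  | hadd a b ha hb =>
    rw [show f * P (a + b) + (a + b) * P f = (f * P a + a * P f) + (f * P b + b * P f) by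
      rw [map_add]; ring, map_add, ha, hb, add_zero]
  | hhom d g hg =>
    rw [hslot, eq_zero_of_intx_C_mul ρ (by omega) (hW hg) fun φ => by
      rw [← hslot, add_comm, h1], mul_zero, map_zero]

/-! ## The Jacobi identity -/

/-- The cyclic sum of the derivatives of the coefficients, in order `N`. -/
def jacobiForm (δ : Derivation ℝ S S) (A : ℕ → ℕ → MvPolynomial ℕ S) (N : ℕ)
    (f g h : MvPolynomial ℕ S) :
    MvPolynomial ℕ S ⧸ LinearMap.range (totalDeriv δ : MvPolynomial ℕ S →ₗ[ℝ] MvPolynomial ℕ S) :=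
  ∑ k ∈ antidiagonal N,
    (tripleForm δ (A k.1) (k.1 + 2) (bracketOp δ A k.2) f g h
      + tripleForm δ (A k.1) (k.1 + 2) (bracketOp δ A k.2) g h f
      + tripleForm δ (A k.1) (k.1 + 2) (bracketOp δ A k.2) h f g)

/-- Cyclic symmetry lets additivity and representability, proved in the first slot only, be used in
every slot. -/
theorem jacobiForm_rotate (A : ℕ → ℕ → MvPolynomial ℕ S) (N : ℕ) (f g h : MvPolynomial ℕ S) :
    jacobiForm δ A N f g h = jacobiForm δ A N g h f := by
  refine Finset.sum_congr rfl fun k _ => ?_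
  abel

theorem evo_add (Q R h : MvPolynomial ℕ S) : evo δ (Q + R) h = evo δ Q h + evo δ R h := by
  simp only [evo, gen_eq_sum δ _ _ le_rfl, map_add, add_mul, Finset.sum_add_distrib]

theorem tripleForm_add_left (a : ℕ → MvPolynomial ℕ S) (N : ℕ)
    (Q : MvPolynomial ℕ S →ₗ[ℝ] MvPolynomial ℕ S) (f f' g h : MvPolynomial ℕ S) :
    tripleForm δ a N Q (f + f') g h = tripleForm δ a N Q f g h + tripleForm δ a N Q f' g h := by
  rw [tripleForm, add_mul, map_add]; rfl

theorem tripleForm_add_middle (a : ℕ → MvPolynomial ℕ S) (N : ℕ)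
    (Q : MvPolynomial ℕ S →ₗ[ℝ] MvPolynomial ℕ S) (f g g' h : MvPolynomial ℕ S) :
    tripleForm δ a N Q f (g + g') h = tripleForm δ a N Q f g h + tripleForm δ a N Q f g' h := by
  rw [tripleForm, map_add, mul_add, map_add]; rfl

theorem tripleForm_add_right (a : ℕ → MvPolynomial ℕ S) (N : ℕ)
    (Q : MvPolynomial ℕ S →ₗ[ℝ] MvPolynomial ℕ S) (f g h h' : MvPolynomial ℕ S) :
    tripleForm δ a N Q f g (h + h') = tripleForm δ a N Q f g h + tripleForm δ a N Q f g h' := by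
  simp only [tripleForm, evoOp, diffOp_apply, map_add, evo_add, add_mul, Finset.sum_add_distrib,
    mul_add]

theorem jacobiForm_add (A : ℕ → ℕ → MvPolynomial ℕ S) (N : ℕ) (f f' g h : MvPolynomial ℕ S) :
    jacobiForm δ A N (f + f') g h = jacobiForm δ A N f g h + jacobiForm δ A N f' g h := by
  rw [jacobiForm, jacobiForm, jacobiForm, ← Finset.sum_add_distrib]
  refine Finset.sum_congr rfl fun k _ => ?_
  rw [tripleForm_add_left, tripleForm_add_middle, tripleForm_add_right]
  abel

/-- The two operators together have degree `N + 2`, so rigidity is available already at order `N =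
0`, with no separate check of the Jacobi identity of the leading term. -/
theorem exists_jacobiForm_eq {A : ℕ → ℕ → MvPolynomial ℕ S} (hA : JetGraded A) (N : ℕ) {d e : ℕ}
    {g h : MvPolynomial ℕ S} (hg : JetHomog g d) (hh : JetHomog h e) :
    ∃ W, JetHomog W (N + 2 + d + e) ∧ ∀ f, jacobiForm δ A N f g h = intx δ (f * W) := by
  choose! W hW hf using fun k : ℕ × ℕ =>
    exists_tripleForm_cyclic_eq (δ := δ) (hA k.1) (hA k.2) hg hh
  refine ⟨∑ k ∈ antidiagonal N, W k, IsWeightedHomogeneous.sum _ _ _ fun k hk =>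
    (hW k).of_eq ?_, fun f => ?_⟩
  · rw [mem_antidiagonal] at hk
    omega
  · rw [Finset.mul_sum, map_sum]
    exact Finset.sum_congr rfl fun k _ => hf k f

/-- The Jacobi form vanishes once it vanishes on functions of `u`. -/
theorem jacobiForm_eq_zero (ρ : Realization δ X₀) {A : ℕ → ℕ → MvPolynomial ℕ S}
    (hA : JetGraded A) {N : ℕ} (hN : ∀ f g h : S, jacobiForm δ A N (C f) (C g) (C h) = 0)
    (f g h : MvPolynomial ℕ S) : jacobiForm δ A N f g h = 0 := by
  -- One slot at a time: for fixed homogeneous `g` and `h`, vanishing on functions in the first slot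
  -- gives `W = 0`, hence vanishing for all `f`. The remaining slots are brought to the front by
  -- rotation.
  have key : ∀ {d e : ℕ} {g h : MvPolynomial ℕ S}, JetHomog g d → JetHomog h e →
      (∀ φ : S, jacobiForm δ A N (C φ) g h = 0) → ∀ f, jacobiForm δ A N f g h = 0 := by
    intro d e g h hg hh h0 f
    obtain ⟨W, hW, hf⟩ := exists_jacobiForm_eq (δ := δ) hA N hg hh
    rw [hf, eq_zero_of_intx_C_mul ρ (by omega) hW fun φ => by rw [← hf, h0], mul_zero, map_zero]
  have h1 : ∀ (f : MvPolynomial ℕ S) (g h : S), jacobiForm δ A N f (C g) (C h) = 0 :=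
    fun f g h => key (jetHomog_C g) (jetHomog_C h) (fun φ => hN φ g h) f
  have h2 : ∀ (f g : MvPolynomial ℕ S) (h : S), jacobiForm δ A N f g (C h) = 0 := by
    intro f g h
    induction g using jetHomog_induction with
    | hadd a b ha hb =>
      rw [jacobiForm_rotate] at ha hb ⊢
      rw [jacobiForm_add, ha, hb, add_zero]
    | hhom d g hg =>
      refine key hg (jetHomog_C h) (fun φ => ?_) f
      rw [jacobiForm_rotate, h1]
  induction g using jetHomog_induction with
  | hadd a b ha hb =>
    rw [jacobiForm_rotate] at ha hb ⊢
    rw [jacobiForm_add, ha, hb, add_zero]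
  | hhom d g hg =>
    induction h using jetHomog_induction with
    | hadd a b ha hb =>
      rw [jacobiForm_rotate, jacobiForm_rotate] at ha hb ⊢
      rw [jacobiForm_add, ha, hb, add_zero]
    | hhom e h hh =>
      refine key hg hh (fun φ => ?_) f
      rw [jacobiForm_rotate, h2]

variable (δ) in
/-- The Jacobi sum of order `N` of three functionals without `ε`. -/
def jacobiSum (A : ℕ → ℕ → MvPolynomial ℕ S) (N : ℕ) (F G H : MvPolynomial ℕ S) :
    MvPolynomial ℕ S ⧸ LinearMap.range (totalDeriv δ : MvPolynomial ℕ S →ₗ[ℝ] MvPolynomial ℕ S) :=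
  ∑ k ∈ antidiagonal N,
    (doubleBracket δ (bracketOp δ A k.1) (bracketOp δ A k.2) F G H
      + doubleBracket δ (bracketOp δ A k.1) (bracketOp δ A k.2) G H F
      + doubleBracket δ (bracketOp δ A k.1) (bracketOp δ A k.2) H F G)

/-- The second variations cancel only after symmetrization in the two operators, but the sum over
the antidiagonal is itself symmetric under that exchange. So twice the identity holds, and the
factor two is cancelled in a real vector space. -/
theorem jacobiSum_eq {A : ℕ → ℕ → MvPolynomial ℕ S} {N : ℕ}
    (hA : ∀ k ≤ N, IsSkewOp δ (bracketOp δ A k)) (F G H : MvPolynomial ℕ S) :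
    jacobiSum δ A N F G H =
      jacobiForm δ A N (jetEuler δ F) (jetEuler δ G) (jetEuler δ H) := by
  have h2 : jacobiSum δ A N F G H + jacobiSum δ A N F G H =
      jacobiForm δ A N (jetEuler δ F) (jetEuler δ G) (jetEuler δ H) +
      jacobiForm δ A N (jetEuler δ F) (jetEuler δ G) (jetEuler δ H) := by
    nth_rewrite 2 [jacobiSum]
    nth_rewrite 2 [jacobiForm]
    rw [← Finset.Nat.sum_antidiagonal_swap, ← Finset.Nat.sum_antidiagonal_swap (n := N) (f := fun k =>
      tripleForm δ (A k.1) (k.1 + 2) (bracketOp δ A k.2) (jetEuler δ F) (jetEuler δ G) (jetEuler δ H)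
      + tripleForm δ (A k.1) (k.1 + 2) (bracketOp δ A k.2) (jetEuler δ G) (jetEuler δ H)
        (jetEuler δ F)
      + tripleForm δ (A k.1) (k.1 + 2) (bracketOp δ A k.2) (jetEuler δ H) (jetEuler δ F)
        (jetEuler δ G)),
      jacobiSum, jacobiForm, ← Finset.sum_add_distrib, ← Finset.sum_add_distrib]
    refine Finset.sum_congr rfl fun k hk => ?_
    have hk' := mem_antidiagonal.1 hk
    exact doubleBracket_cyclic (hA k.1 (by omega)) (hA k.2 (by omega)) F G H
  rw [← two_smul ℝ, ← two_smul ℝ] at h2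
  exact smul_right_injective _ (two_ne_zero' ℝ) h2

theorem intx_jetBracket_jetBracket (A : ℕ → ℕ → MvPolynomial ℕ S) (F G H : ℕ → MvPolynomial ℕ S)
    (n : ℕ) :
    intx δ (jetBracket δ A (jetBracket δ A F G) H n) =
      ∑ t ∈ antidiagonal n, ∑ s ∈ antidiagonal t.2, ∑ r ∈ antidiagonal s.2,
        ∑ k ∈ antidiagonal t.1,
          doubleBracket δ (bracketOp δ A k.1) (bracketOp δ A k.2) (F s.1) (G r.1) (H r.2) := by
  rw [← sum_antidiagonal_quintuple n fun i k j l m =>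
    doubleBracket δ (bracketOp δ A k) (bracketOp δ A l) (F i) (G j) (H m)]
  simp only [jetBracket, map_sum, jetEuler_sum, Finset.sum_mul, doubleBracket]

/-- The orders of the three functionals are relabelled so that all three cyclic terms refer to the
same components of `F`, `G`, `H`. -/
theorem sum_cyclic {V W : Type*} [AddCommGroup V] (n : ℕ) (F G H : ℕ → W)
    (Φ : ℕ × ℕ → W → W → W → V) :
    ∑ t ∈ antidiagonal n, ∑ s ∈ antidiagonal t.2, ∑ r ∈ antidiagonal s.2,
        ∑ k ∈ antidiagonal t.1, Φ k (F s.1) (G r.1) (H r.2)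
      + ∑ t ∈ antidiagonal n, ∑ s ∈ antidiagonal t.2, ∑ r ∈ antidiagonal s.2,
        ∑ k ∈ antidiagonal t.1, Φ k (G s.1) (H r.1) (F r.2)
      + ∑ t ∈ antidiagonal n, ∑ s ∈ antidiagonal t.2, ∑ r ∈ antidiagonal s.2,
        ∑ k ∈ antidiagonal t.1, Φ k (H s.1) (F r.1) (G r.2) =
    ∑ t ∈ antidiagonal n, ∑ s ∈ antidiagonal t.2, ∑ r ∈ antidiagonal s.2,
      ∑ k ∈ antidiagonal t.1, (Φ k (F s.1) (G r.1) (H r.2) + Φ k (G r.1) (H r.2) (F s.1)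
        + Φ k (H r.2) (F s.1) (G r.1)) := by
  rw [← Finset.sum_add_distrib, ← Finset.sum_add_distrib]
  refine Finset.sum_congr rfl fun t _ => ?_
  have h1 := sum_antidiagonal_triple_rotate t.2 fun m i j => ∑ k ∈ antidiagonal t.1,
    Φ k (G i) (H j) (F m)
  have h2 := sum_antidiagonal_triple_rotate t.2 fun m i j => ∑ k ∈ antidiagonal t.1,
    Φ k (H m) (F i) (G j)
  rw [← h1, h2]
  simp only [Finset.sum_add_distrib]

theorem intx_jacobi (A : ℕ → ℕ → MvPolynomial ℕ S) (F G H : ℕ → MvPolynomial ℕ S) (n : ℕ) :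
    intx δ (jetBracket δ A (jetBracket δ A F G) H n + jetBracket δ A (jetBracket δ A G H) F n
      + jetBracket δ A (jetBracket δ A H F) G n) =
    ∑ t ∈ antidiagonal n, ∑ s ∈ antidiagonal t.2, ∑ r ∈ antidiagonal s.2,
      jacobiSum δ A t.1 (F s.1) (G r.1) (H r.2) := by
  rw [map_add, map_add, intx_jetBracket_jetBracket, intx_jetBracket_jetBracket,
    intx_jetBracket_jetBracket]
  exact sum_cyclic n F G H fun k =>
    doubleBracket δ (bracketOp δ A k.1) (bracketOp δ A k.2)

/-- A bracket with a sufficiently large commuting family satisfies the Jacobi identity. -/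
theorem jacobiSum_eq_zero (ρ : Realization δ X₀) (hδ : Function.Surjective δ) {N : ℕ}
    {A : ℕ → ℕ → MvPolynomial ℕ S} (hA : JetGraded A)
    (hskew : ∀ k < N, IsSkewOp δ (bracketOp δ A k))
    {H : S → ℕ → MvPolynomial ℕ S} (hH : ∀ f, H f 0 = C f)
    (hAH : ∀ f g, ∀ n < N, intx δ (jetBracket δ A (H f) (H g) n) = 0) :
    ∀ k < N, ∀ F G K, jacobiSum δ A k F G K = 0 := by
  intro k
  induction k using Nat.strong_induction_on with
  | _ k ih =>
  intro hk F G K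
  rw [jacobiSum_eq fun l hl => hskew l (by omega)]
  refine jacobiForm_eq_zero ρ hA (fun f g h => ?_) _ _ _
  obtain ⟨f, rfl⟩ := hδ f
  obtain ⟨g, rfl⟩ := hδ g
  obtain ⟨h, rfl⟩ := hδ h
  -- The inner bracket of commuting Hamiltonians is a total derivative at every order in question,
  -- so its variational derivative, and with it the double bracket, is zero.
  have hz : ∀ f g h, jetBracket δ A (jetBracket δ A (H f) (H g)) (H h) k = 0 := by
    intro f g h
    refine Finset.sum_eq_zero fun a ha => Finset.sum_eq_zero fun b _ => ?_
    rw [mem_antidiagonal] at ha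
    rw [jetEuler_eq_zero (hAH f g a.1 (by omega)), zero_mul]
  have h1 := intx_jacobi (δ := δ) A (H f) (H g) (H h) k
  rw [hz, hz, hz, add_zero, add_zero, map_zero,
    Finset.sum_eq_single_of_mem (k, 0) (by simp) fun t ht hne => ?_] at h1
  · simp only [Finset.Nat.antidiagonal_zero, Finset.sum_singleton, hH] at h1
    rw [jacobiSum_eq fun l hl => hskew l (by omega), jetEuler_C, jetEuler_C, jetEuler_C] at h1
    exact h1.symm
  -- The other summands involve Jacobi sums of strictly lower order. They vanish by induction for
  -- all functionals, in particular for the higher coefficients of `H f`, `H g`, `H h`.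
  · rw [mem_antidiagonal] at ht
    have hlt : t.1 < k := by
      refine lt_of_le_of_ne (by omega) fun h => hne (Prod.ext h ?_)
      simp only
      omega
    refine Finset.sum_eq_zero fun s _ => Finset.sum_eq_zero fun r _ => ih t.1 hlt (by omega) _ _ _

/-- A graded bracket with skew-symmetric leading term and a sufficiently large commuting family is
a Poisson bracket. -/
theorem jetBracket_isPoisson (ρ : Realization δ X₀) (hδ : Function.Surjective δ) {N : ℕ}
    {A : ℕ → ℕ → MvPolynomial ℕ S} (hA : JetGraded A) (h0 : IsSkewOp δ (bracketOp δ A 0))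
    {H : S → ℕ → MvPolynomial ℕ S} (hH : ∀ f, H f 0 = C f)
    (hAH : ∀ f g, ∀ n < N, intx δ (jetBracket δ A (H f) (H g) n) = 0) :
    (∀ F G, ∀ n < N, intx δ (jetBracket δ A F G n + jetBracket δ A G F n) = 0) ∧
    ∀ F G K, ∀ n < N, intx δ (jetBracket δ A (jetBracket δ A F G) K n
      + jetBracket δ A (jetBracket δ A G K) F n + jetBracket δ A (jetBracket δ A K F) G n) = 0 := by
  have hskew := isSkewOp_of_commute ρ hδ hA h0 hH hAH
  refine ⟨fun F G n hn => ?_, fun F G K n hn => ?_⟩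
  · rw [jetBracket_add, map_sum]
    refine Finset.sum_eq_zero fun a ha => ?_
    rw [map_sum]
    refine Finset.sum_eq_zero fun b hb => ?_
    rw [mem_antidiagonal] at ha hb
    exact hskew b.1 (by omega) _ _
  · rw [intx_jacobi]
    refine Finset.sum_eq_zero fun t ht => Finset.sum_eq_zero fun s _ => Finset.sum_eq_zero fun r _ =>
      jacobiSum_eq_zero ρ hδ hA hskew hH hAH t.1 ?_ _ _ _
    rw [mem_antidiagonal] at ht
    omega

end Jets

/-! ## Differential polynomials of low degree -/

section Jets

variable {S : Type*} [CommRing S]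

/-- The general differential polynomial of degree two. -/
def quadratic (a b : S) : MvPolynomial ℕ S := C a * X 1 + C b * X 0 ^ 2

/-- The general differential polynomial of degree three. -/
def cubic (a b d : S) : MvPolynomial ℕ S := C a * X 2 + C b * (X 0 * X 1) + C d * X 0 ^ 3

/-- The general differential polynomial of degree four. -/
def quartic (a4 a13 a22 a112 a1111 : S) : MvPolynomial ℕ S :=
  C a4 * X 3 + C a13 * (X 0 * X 2) + C a22 * X 1 ^ 2 + C a112 * (X 0 ^ 2 * X 1) + C a1111 * X 0 ^ 4

/-- The general differential polynomial of degree five. -/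
def quintic (a5 a14 a23 a113 a122 a1112 a11111 : S) : MvPolynomial ℕ S :=
  C a5 * X 4 + C a14 * (X 0 * X 3) + C a23 * (X 1 * X 2) + C a113 * (X 0 ^ 2 * X 2)
    + C a122 * (X 0 * X 1 ^ 2) + C a1112 * (X 0 ^ 3 * X 1) + C a11111 * X 0 ^ 5

variable (a b d e f a' b' d' e' f' : S)

theorem cubic_add : cubic a b d + cubic a' b' d' = cubic (a + a') (b + b') (d + d') := by
  simp only [cubic, C_add]; ring

theorem quintic_add (a5 a14 a23 a113 a122 a1112 a11111 b5 b14 b23 b113 b122 b1112 b11111 : S) :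
    quintic a5 a14 a23 a113 a122 a1112 a11111 + quintic b5 b14 b23 b113 b122 b1112 b11111 =
    quintic (a5 + b5) (a14 + b14) (a23 + b23) (a113 + b113) (a122 + b122) (a1112 + b1112)
      (a11111 + b11111) := by
  simp only [quintic, C_add]; ring

theorem C_mul_cubic : C e * cubic a b d = cubic (e * a) (e * b) (e * d) := by
  simp only [cubic, C_mul]; ring

theorem C_mul_quintic (a5 a14 a23 a113 a122 a1112 a11111 : S) :
    C e * quintic a5 a14 a23 a113 a122 a1112 a11111 =
    quintic (e * a5) (e * a14) (e * a23) (e * a113) (e * a122) (e * a1112) (e * a11111) := by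
  simp only [quintic, C_mul]; ring

theorem quadratic_mul_X_zero_mul_C :
    quadratic a b * (X 0 * C e) = cubic 0 (a * e) (b * e) := by
  simp only [quadratic, cubic, C_mul, C_0]; ring

theorem quartic_mul_X_zero_mul_C :
    quartic a b d e f * (X 0 * C a') =
      quintic 0 (a * a') 0 (b * a') (d * a') (e * a') (f * a') := by
  simp only [quartic, quintic, C_mul, C_0]; ring

theorem quadratic_mul_cubic :
    quadratic a b * cubic a' b' d' =
      quintic 0 0 (a * a') (b * a') (a * b') (a * d' + b * b') (b * d') := by
  simp only [quadratic, cubic, quintic, C_mul, C_0, C_add]; ring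

theorem order_le_of_vars_subset {h : MvPolynomial ℕ S} {N : ℕ} (hN : h.vars ⊆ Finset.range N) :
    order h ≤ N + 1 :=
  Nat.succ_le_succ <| Finset.sup_le fun k hk => Finset.mem_range.1 (hN hk)

theorem vars_C_mul_X_pow (k n : ℕ) : (C a * X k ^ n : MvPolynomial ℕ S).vars ⊆ {k} := by
  classical
  obtain hS | hS := subsingleton_or_nontrivial S
  · rw [Subsingleton.elim (C a * X k ^ n) 0, vars_0]
    exact Finset.empty_subset _
  refine (vars_mul _ _).trans ?_
  rw [vars_C, Finset.empty_union]
  exact (vars_pow _ _).trans (by rw [vars_X])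

variable [Algebra ℝ S] (δ : Derivation ℝ S S)

theorem derivation_ofNat {A : Type*} [CommRing A] [Algebra ℝ A] (d : Derivation ℝ A A) (n : ℕ)
    [n.AtLeastTwo] : d ofNat(n) = 0 :=
  d.map_natCast n

theorem totalDeriv_quadratic :
    totalDeriv δ (quadratic a b) = cubic a (δ a + 2 * b) (δ b) := by
  simp only [quadratic, cubic, map_add (totalDeriv δ), Derivation.leibniz, Derivation.leibniz_pow,
    totalDeriv_C, totalDeriv_X, smul_eq_mul, nsmul_eq_mul, C_add, C_mul, map_ofNat]
  push_cast
  ring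

theorem totalDeriv_cubic :
    totalDeriv δ (cubic a b d) = quartic a (δ a + b) b (δ b + 3 * d) (δ d) := by
  simp only [quartic, cubic, map_add (totalDeriv δ), Derivation.leibniz, Derivation.leibniz_pow,
    totalDeriv_C, totalDeriv_X, smul_eq_mul, nsmul_eq_mul, C_add, C_mul, map_ofNat]
  push_cast
  ring

theorem totalDeriv_quartic :
    totalDeriv δ (quartic a b d e f) =
      quintic a (δ a + b) (b + 2 * d) (δ b + e) (δ d + 2 * e) (δ e + 4 * f) (δ f) := by
  simp only [quartic, quintic, map_add (totalDeriv δ), Derivation.leibniz, Derivation.leibniz_pow,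
    totalDeriv_C, totalDeriv_X, smul_eq_mul, nsmul_eq_mul, C_add, C_mul, map_ofNat]
  push_cast
  ring

theorem totalPow_one (h : MvPolynomial ℕ S) : totalPow δ 1 h = totalDeriv δ h := rfl

theorem totalPow_two_C : totalPow δ 2 (C f) = quadratic (δ f) (δ (δ f)) := by
  rw [totalPow_succ, totalPow_one, totalDeriv_C, Derivation.leibniz, totalDeriv_C, totalDeriv_X]
  simp only [quadratic, smul_eq_mul]
  ring

theorem totalPow_three_C :
    totalPow δ 3 (C f) = cubic (δ f) (3 * δ (δ f)) (δ (δ (δ f))) := by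
  rw [totalPow_succ, totalPow_two_C, totalDeriv_quadratic]
  congr 1
  ring

theorem totalPow_four_C :
    totalPow δ 4 (C f) = quartic (δ f) (4 * δ (δ f)) (3 * δ (δ f)) (6 * δ (δ (δ f)))
      (δ (δ (δ (δ f)))) := by
  rw [totalPow_succ, totalPow_three_C, totalDeriv_cubic]
  have h3 : δ (3 * δ (δ f)) = 3 * δ (δ (δ f)) := by
    rw [Derivation.leibniz, derivation_ofNat, smul_zero, add_zero, smul_eq_mul]
  rw [h3]
  congr 1 <;> ring

theorem totalPow_five_C :
    totalPow δ 5 (C f) = quintic (δ f) (5 * δ (δ f)) (10 * δ (δ f)) (10 * δ (δ (δ f)))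
      (15 * δ (δ (δ f))) (10 * δ (δ (δ (δ f)))) (δ (δ (δ (δ (δ f))))) := by
  rw [totalPow_succ, totalPow_four_C, totalDeriv_quartic]
  have h3 : δ (3 * δ (δ f)) = 3 * δ (δ (δ f)) := by
    rw [Derivation.leibniz, derivation_ofNat, smul_zero, add_zero, smul_eq_mul]
  have h4 : δ (4 * δ (δ f)) = 4 * δ (δ (δ f)) := by
    rw [Derivation.leibniz, derivation_ofNat, smul_zero, add_zero, smul_eq_mul]
  have h6 : δ (6 * δ (δ (δ f))) = 6 * δ (δ (δ (δ f))) := by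
    rw [Derivation.leibniz, derivation_ofNat, smul_zero, add_zero, smul_eq_mul]
  rw [h3, h4, h6]
  congr 1 <;> ring

/-! ## Variational derivatives -/

theorem jetEuler_C_mul_X_zero_sq :
    jetEuler δ (C a * X 0 ^ 2) = quadratic (-2 * a) (-δ a) := by
  rw [jetEuler_eq_sum δ (N := 2) _
    (order_le_of_vars_subset ((vars_C_mul_X_pow a 0 2).trans (by decide)))]
  simp only [Finset.sum_range_succ, Finset.sum_range_zero, jetDeriv_zero, jetDeriv_succ_apply,
    totalPow_zero, totalPow_succ, Derivation.leibniz, Derivation.leibniz_pow, jetPartialU_C,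
    jetPartialU_X, pderiv_C, pderiv_X_self, totalDeriv_C, totalDeriv_X,
    Derivation.map_one_eq_zero, Derivation.map_natCast, smul_eq_mul, nsmul_eq_mul, map_add, map_zero]
  simp only [Nat.add_one_sub_one, pow_one, quadratic, C_neg, C_mul, map_ofNat]
  push_cast
  ring

theorem jetEuler_C_mul_X_zero_pow_four :
    jetEuler δ (C a * X 0 ^ 4) = quartic 0 0 0 (-12 * a) (-3 * δ a) := by
  rw [jetEuler_eq_sum δ (N := 2) _
    (order_le_of_vars_subset ((vars_C_mul_X_pow a 0 4).trans (by decide)))]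
  simp only [Finset.sum_range_succ, Finset.sum_range_zero, jetDeriv_zero, jetDeriv_succ_apply,
    totalPow_zero, totalPow_succ, Derivation.leibniz, Derivation.leibniz_pow, jetPartialU_C,
    jetPartialU_X, pderiv_C, pderiv_X_self, totalDeriv_C, totalDeriv_X,
    Derivation.map_one_eq_zero, Derivation.map_natCast, smul_eq_mul, nsmul_eq_mul, map_add, map_zero]
  simp only [Nat.add_one_sub_one, pow_one, quartic, C_neg, C_mul, map_ofNat, C_0]
  push_cast
  ring

theorem jetEuler_C_mul_X_one_sq :
    jetEuler δ (C a * X 1 ^ 2) = quartic (2 * a) (4 * δ a) (3 * δ a) (2 * δ (δ a)) 0 := by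
  rw [jetEuler_eq_sum δ (N := 3) _
    (order_le_of_vars_subset ((vars_C_mul_X_pow a 1 2).trans (by decide)))]
  simp only [Finset.sum_range_succ, Finset.sum_range_zero, jetDeriv_zero, jetDeriv_succ_apply,
    totalPow_zero, totalPow_succ, Derivation.leibniz, Derivation.leibniz_pow, jetPartialU_C,
    jetPartialU_X, pderiv_C, pderiv_X_self, pderiv_X_of_ne (one_ne_zero : (1 : ℕ) ≠ 0), totalDeriv_C, totalDeriv_X,
    Derivation.map_one_eq_zero, Derivation.map_natCast, smul_eq_mul, nsmul_eq_mul, map_add, map_zero]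
  simp only [Nat.add_one_sub_one, Nat.reduceSub, pow_one, quartic, C_mul, map_ofNat, C_0]
  push_cast
  ring

/-! ## Operators of orders zero, two and four -/

theorem leading_C (q h : S) : C q * totalDeriv δ (C f) + C h * X 0 * C f =
    X 0 * C (q * δ f + h * f) := by
  simp only [totalDeriv_C, C_add, C_mul]; ring

theorem leading_quadratic (q h : S) :
    C q * totalDeriv δ (quadratic a b) + C h * X 0 * quadratic a b =
      cubic (q * a) (q * (δ a + 2 * b) + h * a) (q * δ b + h * b) := by
  rw [totalDeriv_quadratic]
  simp only [quadratic, cubic, C_add, C_mul]; ring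

theorem leading_quartic (q h : S) :
    C q * totalDeriv δ (quartic a b d e f) + C h * X 0 * quartic a b d e f =
      quintic (q * a) (q * (δ a + b) + h * a) (q * (b + 2 * d)) (q * (δ b + e) + h * b)
        (q * (δ d + 2 * e) + h * d) (q * (δ e + 4 * f) + h * e) (q * δ f + h * f) := by
  rw [totalDeriv_quartic]
  simp only [quartic, quintic, C_add, C_mul]; ring

/-- The coefficients of the operator are free parameters here, so the jet computation is done once
with short expressions and the actual coefficients are substituted only afterwards. -/
theorem orderTwo_C (j3 j2 j1_11 j1_2 j0_111 j0_12 j0_3 : S) :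
    C j3 * totalPow δ 3 (C f) + C j2 * X 0 * totalPow δ 2 (C f)
      + (C j1_11 * X 0 ^ 2 + C j1_2 * X 1) * totalDeriv δ (C f)
      + (C j0_111 * X 0 ^ 3 + C j0_12 * X 0 * X 1 + C j0_3 * X 2) * C f =
    cubic (j3 * δ f + j0_3 * f) (3 * (j3 * δ (δ f)) + j2 * δ f + j1_2 * δ f + j0_12 * f)
      (j3 * δ (δ (δ f)) + j2 * δ (δ f) + j1_11 * δ f + j0_111 * f) := by
  rw [totalPow_three_C, totalPow_two_C, totalDeriv_C]
  simp only [quadratic, cubic, C_add, C_mul, map_ofNat]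
  ring

theorem orderTwo_quadratic (j3 j2 j1_11 j1_2 j0_111 j0_12 j0_3 : S) :
    C j3 * totalPow δ 3 (quadratic a b) + C j2 * X 0 * totalPow δ 2 (quadratic a b)
      + (C j1_11 * X 0 ^ 2 + C j1_2 * X 1) * totalDeriv δ (quadratic a b)
      + (C j0_111 * X 0 ^ 3 + C j0_12 * X 0 * X 1 + C j0_3 * X 2) * quadratic a b =
    quintic (j3 * a) (j3 * (3 * δ a + 2 * b) + j2 * a) (j3 * (4 * δ a + 6 * b) + (j1_2 + j0_3) * a)
      (j3 * (3 * δ (δ a) + 7 * δ b) + j2 * (2 * δ a + 2 * b) + j1_11 * a + j0_3 * b)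
      (j3 * (3 * δ (δ a) + 12 * δ b) + j2 * (δ a + 2 * b) + j1_2 * (δ a + 2 * b) + j0_12 * a)
      (j3 * (δ (δ (δ a)) + 9 * δ (δ b)) + j2 * (δ (δ a) + 5 * δ b) + j1_11 * (δ a + 2 * b)
        + j1_2 * δ b + j0_111 * a + j0_12 * b)
      (j3 * δ (δ (δ b)) + j2 * δ (δ b) + j1_11 * δ b + j0_111 * b) := by
  have h2 : totalPow δ 2 (quadratic a b) = quartic a (2 * δ a + 2 * b) (δ a + 2 * b)
      (δ (δ a) + 5 * δ b) (δ (δ b)) := by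
    rw [totalPow_succ, totalPow_one, totalDeriv_quadratic, totalDeriv_cubic, map_add,
      Derivation.leibniz, derivation_ofNat, smul_zero, add_zero, smul_eq_mul]
    congr 1 <;> ring
  rw [totalPow_succ, h2, totalDeriv_quartic, totalDeriv_quadratic]
  simp only [map_add δ, Derivation.leibniz, derivation_ofNat, smul_eq_mul]
  simp only [quadratic, cubic, quartic, quintic, C_add, C_mul, C_0, map_ofNat]
  ring

theorem orderFour_C (k5 k4 k3_11 k3_2 k2_111 k2_12 k2_3 k1_1111 k1_112 k1_22 k1_13 k1_4 k0_11111
    k0_1112 k0_122 k0_113 k0_23 k0_14 k0_5 : S) :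
    C k5 * totalPow δ 5 (C f) + C k4 * X 0 * totalPow δ 4 (C f)
      + (C k3_11 * X 0 ^ 2 + C k3_2 * X 1) * totalPow δ 3 (C f)
      + (C k2_111 * X 0 ^ 3 + C k2_12 * X 0 * X 1 + C k2_3 * X 2) * totalPow δ 2 (C f)
      + (C k1_1111 * X 0 ^ 4 + C k1_112 * X 0 ^ 2 * X 1 + C k1_22 * X 1 ^ 2 + C k1_13 * X 0 * X 2
        + C k1_4 * X 3) * totalDeriv δ (C f)
      + (C k0_11111 * X 0 ^ 5 + C k0_1112 * X 0 ^ 3 * X 1 + C k0_122 * X 0 * X 1 ^ 2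
        + C k0_113 * X 0 ^ 2 * X 2 + C k0_23 * X 1 * X 2 + C k0_14 * X 0 * X 3
        + C k0_5 * X 4) * C f =
    quintic (k5 * δ f + k0_5 * f)
      (5 * (k5 * δ (δ f)) + k4 * δ f + k1_4 * δ f + k0_14 * f)
      (10 * (k5 * δ (δ f)) + k3_2 * δ f + k2_3 * δ f + k0_23 * f)
      (10 * (k5 * δ (δ (δ f))) + 4 * (k4 * δ (δ f)) + k3_11 * δ f + k2_3 * δ (δ f) + k1_13 * δ f
        + k0_113 * f)
      (15 * (k5 * δ (δ (δ f))) + 3 * (k4 * δ (δ f)) + 3 * (k3_2 * δ (δ f)) + k2_12 * δ f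
        + k1_22 * δ f + k0_122 * f)
      (10 * (k5 * δ (δ (δ (δ f)))) + 6 * (k4 * δ (δ (δ f))) + 3 * (k3_11 * δ (δ f))
        + k3_2 * δ (δ (δ f)) + k2_111 * δ f + k2_12 * δ (δ f) + k1_112 * δ f + k0_1112 * f)
      (k5 * δ (δ (δ (δ (δ f)))) + k4 * δ (δ (δ (δ f))) + k3_11 * δ (δ (δ f)) + k2_111 * δ (δ f)
        + k1_1111 * δ f + k0_11111 * f) := by
  rw [totalPow_five_C, totalPow_four_C, totalPow_three_C, totalPow_two_C, totalDeriv_C]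
  simp only [quadratic, cubic, quartic, quintic, C_add, C_mul, map_ofNat]
  ring

end Jets

/-! ## Smooth coefficients -/

/-- Derivations of an algebra into itself. -/
abbrev SelfDerivation (S : Type*) [CommRing S] [Algebra ℝ S] := Derivation ℝ S S

-- The algebra structure, restated over the semiring underlying the ring structure, which is the
-- form used by the calculus over a general commutative ring.
instance smoothFunAlgebra : @Algebra ℝ (SmoothFun I) _ (CommRing.toCommSemiring).toSemiring :=
  inferInstanceAs (Algebra ℝ (SmoothFun I))

/-- The derivative of smooth functions, as a derivation. -/
def derivF : SelfDerivation (SmoothFun I) := derivD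

theorem derivF_apply (f : SmoothFun I) : derivF f = D f := rfl

set_option maxHeartbeats 1000000 in
theorem dx_eq (h : DiffPoly I) : dx h = totalDeriv derivF h := by
  rw [totalDeriv_apply, jetPartialU_apply]
  rfl

theorem dx_iterate_eq (k : ℕ) (h : DiffPoly I) : dx^[k] h = totalPow derivF k h := by
  rw [totalPow_apply, show (dx : DiffPoly I → DiffPoly I) = totalDeriv derivF from funext dx_eq]

theorem euler_eq (h : DiffPoly I) : euler h = jetEuler derivF h := by
  unfold euler jetEuler
  simp only [dx_iterate_eq]
  rfl

theorem applyOp_eq (A : BracketCoeffs I) (k : ℕ) (h : DiffPoly I) :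
    applyOp A k h = diffOp derivF (A k) (k + 2) h := by
  rw [diffOp_apply]
  simp only [applyOp, dx_iterate_eq]

theorem vanishesMod_iff {N : ℕ} {h : Density I} :
    VanishesMod N h ↔ ∀ n < N, intx derivF (h n) = 0 := by
  simp only [VanishesMod, intx_eq_zero_iff, dx_eq]

theorem bracket_eq (A : BracketCoeffs I) (F G : Density I) (n : ℕ) :
    bracket A F G n = jetBracket derivF A F G n := by
  simp only [bracket, euler_eq, applyOp_eq]
  rfl

/-- Smooth functions on an open set of the line, realized by their values. -/
def realizationF : Realization (derivF (I := I)) I where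
  ev := evalFun
  ext _ _ h := smoothFun_ext h
  coord x := coordSub x
  ev_coord x := by rw [evalFun_apply, coordSub_apply, sub_self]
  deriv_coord x := D_coordSub (x : ℝ)

/-- This is the surjectivity hypothesis of the general results: the leading parts of the variational
derivatives `δH_f` exhaust all smooth functions of `u`. -/
theorem derivF_surjective (hI : IsConnected (I : Set ℝ)) :
    Function.Surjective (derivF (I := I)) := exists_D_eq hI

theorem IsGraded.jetGraded {A : BracketCoeffs I} (hA : IsGraded A) : JetGraded A := by
  intro k s hs
  exact ⟨k + 1 - s, by omega, (hA k s).1 (by omega)⟩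

theorem hamDensity_zero (c p s f : SmoothFun I) : hamDensity c p s f 0 = C f := rfl

theorem bracket_unique (hI : IsConnected (I : Set ℝ)) {N : ℕ} {A B : BracketCoeffs I}
    (hA : IsGraded A) (hB : IsGraded B) (h0 : A 0 = B 0) {H : SmoothFun I → Density I}
    (hH : ∀ f, H f 0 = C f) (hAH : ∀ f g, VanishesMod N (bracket A (H f) (H g)))
    (hBH : ∀ f g, VanishesMod N (bracket B (H f) (H g))) : ∀ k < N, A k = B k := by
  simp only [vanishesMod_iff, bracket_eq] at hAH hBH
  exact jetBracket_unique realizationF (derivF_surjective hI) hA.jetGraded hB.jetGraded h0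
    (fun k s => (hA k s).2) (fun k s => (hB k s).2) hH hAH hBH

theorem isPoissonMod_of_commute (hI : IsConnected (I : Set ℝ)) {N : ℕ} {A : BracketCoeffs I}
    (hA : IsGraded A)
    (h0 : ∀ f g : DiffPoly I, ∃ r, dx r = f * applyOp A 0 g + g * applyOp A 0 f)
    {H : SmoothFun I → Density I} (hH : ∀ f, H f 0 = C f)
    (hAH : ∀ f g, VanishesMod N (bracket A (H f) (H g))) : IsPoissonMod N A := by
  have hb : ∀ F G, bracket A F G = jetBracket derivF A F G :=
    fun F G => funext fun n => bracket_eq A F G n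
  simp only [vanishesMod_iff, bracket_eq] at hAH
  have h0' : IsSkewOp derivF (bracketOp derivF A 0) := by
    intro f g
    obtain ⟨r, hr⟩ := h0 f g
    rw [intx_eq_zero_iff]
    refine ⟨r, ?_⟩
    rw [← dx_eq, hr, applyOp_eq, applyOp_eq]
  obtain ⟨h1, h2⟩ := jetBracket_isPoisson realizationF (derivF_surjective hI) hA.jetGraded h0' hH hAH
  simp only [IsPoissonMod, vanishesMod_iff, hb]
  exact ⟨h1, h2⟩

/-! ### Variational derivatives of the Hamiltonians -/

theorem dx_C (f : SmoothFun I) : dx (C f : DiffPoly I) = X 0 * C (D f) := by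
  rw [dx_eq]; exact totalDeriv_C derivF f

theorem dx_quadratic (a b : SmoothFun I) :
    dx (quadratic a b) = cubic a (D a + 2 * b) (D b) := by
  rw [dx_eq]; exact totalDeriv_quadratic a b derivF

theorem dx_quartic (a b d e f : SmoothFun I) :
    dx (quartic a b d e f) =
      quintic a (D a + b) (b + 2 * d) (D b + e) (D d + 2 * e) (D e + 4 * f) (D f) := by
  rw [dx_eq]; exact totalDeriv_quartic a b d e f derivF

theorem euler_zero : euler (0 : DiffPoly I) = 0 := by
  rw [euler_eq]; exact jetEuler_zero

theorem euler_hamDensity_zero (c p f : SmoothFun I) :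
    euler (hamDensity c p 0 f 0) = C (D f) := by
  rw [euler_eq]; exact jetEuler_C f

theorem euler_hamDensity_two (c p f : SmoothFun I) :
    euler (hamDensity c p 0 f 2) = quadratic (-2 * -((1/24 : ℝ) • (c * D^[3] f)))
      (-D (-((1/24 : ℝ) • (c * D^[3] f)))) := by
  have h : hamDensity c p 0 f 2 = C (-((1/24 : ℝ) • (c * D^[3] f))) * X 0 ^ 2 := by
    rw [C_neg]; rfl
  rw [euler_eq, h]
  exact jetEuler_C_mul_X_zero_sq _ derivF

/-- The coefficient of `ε⁴ u_xx²` in the Hamiltonian. -/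
def hamA (c p f : SmoothFun I) : SmoothFun I := p * D^[3] f + (1/480 : ℝ) • (c ^ 2 * D^[4] f)

/-- The coefficient of `-ε⁴ u_x⁴` in the Hamiltonian. -/
def hamB (c p f : SmoothFun I) : SmoothFun I :=
  (1/1152 : ℝ) • (c * D^[2] c * D^[4] f) + (1/1152 : ℝ) • (c * D c * D^[5] f)
    + (1/3456 : ℝ) • (c ^ 2 * D^[6] f) + (1/6 : ℝ) • (D p * D^[4] f) + (1/6 : ℝ) • (p * D^[5] f)

theorem quartic_add {S : Type*} [CommRing S] (a b d e f a' b' d' e' f' : S) :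
    quartic a b d e f + quartic a' b' d' e' f' =
      quartic (a + a') (b + b') (d + d') (e + e') (f + f') := by
  simp only [quartic, C_add]; ring

theorem add_C_neg_mul {S : Type*} [CommRing S] (h : MvPolynomial ℕ S) (a : S)
    (m : MvPolynomial ℕ S) : h + C (-a) * m = h - C a * m := by
  rw [C_neg]; ring

theorem hamDensity_of_odd (c p f : SmoothFun I) {n : ℕ} (hn : Odd n) : hamDensity c p 0 f n = 0 := by
  match n, hn with
  | 0, hn => exact absurd hn (by decide)
  | 1, _ => rfl
  | 2, hn => exact absurd hn (by decide)
  | 3, _ => rfl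
  | 4, hn => exact absurd hn (by decide)
  | n + 5, _ => rfl

/-! ### The second bracket on the variational derivatives -/

section Jets

variable {S : Type*} [CommRing S] [Algebra ℝ S] (δ : Derivation ℝ S S)

theorem diffOp_two (a : ℕ → MvPolynomial ℕ S) (h : MvPolynomial ℕ S) :
    diffOp δ a 2 h = a 1 * totalDeriv δ h + a 0 * h := by
  rw [diffOp_apply]
  simp only [Finset.sum_range_succ, Finset.sum_range_zero, totalPow_zero, totalPow_one]
  ring

theorem diffOp_four (a : ℕ → MvPolynomial ℕ S) (h : MvPolynomial ℕ S) :
    diffOp δ a 4 h = a 3 * totalPow δ 3 h + a 2 * totalPow δ 2 h + a 1 * totalDeriv δ h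
      + a 0 * h := by
  rw [diffOp_apply]
  simp only [Finset.sum_range_succ, Finset.sum_range_zero, totalPow_zero, totalPow_one]
  ring

theorem diffOp_six (a : ℕ → MvPolynomial ℕ S) (h : MvPolynomial ℕ S) :
    diffOp δ a 6 h = a 5 * totalPow δ 5 h + a 4 * totalPow δ 4 h + a 3 * totalPow δ 3 h
      + a 2 * totalPow δ 2 h + a 1 * totalDeriv δ h + a 0 * h := by
  rw [diffOp_apply]
  simp only [Finset.sum_range_succ, Finset.sum_range_zero, totalPow_zero, totalPow_one]
  ring

end Jets

variable (c q : SmoothFun I) (hq : ∀ x, (D q).1 x ≠ 0)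

theorem applyOp_secondBracket_zero_C (f : SmoothFun I) :
    applyOp (secondBracket c q hq) 0 (C f) =
      X 0 * C (q * D f + (1/2 : ℝ) • D q * f) := by
  rw [applyOp_eq]
  refine (diffOp_two derivF _ _).trans ?_
  exact leading_C f derivF q ((1/2 : ℝ) • D q)

theorem applyOp_secondBracket_zero_quadratic (a b : SmoothFun I) :
    applyOp (secondBracket c q hq) 0 (quadratic a b) =
      cubic (q * a) (q * (D a + 2 * b) + (1/2 : ℝ) • D q * a)
        (q * D b + (1/2 : ℝ) • D q * b) := by
  rw [applyOp_eq]
  refine (diffOp_two derivF _ _).trans ?_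
  exact leading_quadratic a b derivF q ((1/2 : ℝ) • D q)

section

variable (q1 q2 q3 q4 q5 q6 q7 c0 c1 c2 c3 c4 r : SmoothFun I)

theorem diffOp_orderTwoTerm_C (f : SmoothFun I) :
    diffOp derivF (orderTwoTerm c0 c1 c2 q1 q2 q3 q4) 4 (C f) =
    cubic ((1/8 : ℝ) • (c0 * q1) * D f + (1/24 : ℝ) • (c0 * q2) * f)
      (3 * ((1/8 : ℝ) • (c0 * q1) * D (D f))
        + ((3/16 : ℝ) • (c1 * q1) + (3/16 : ℝ) • (c0 * q2)) * D f
        + ((1/16 : ℝ) • (c1 * q1) + (7/48 : ℝ) • (c0 * q2)) * D f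
        + ((1/12 : ℝ) • (c1 * q2) + (1/12 : ℝ) • (c0 * q3)) * f)
      ((1/8 : ℝ) • (c0 * q1) * D (D (D f))
        + ((3/16 : ℝ) • (c1 * q1) + (3/16 : ℝ) • (c0 * q2)) * D (D f)
        + ((1/16 : ℝ) • (c2 * q1) + (1/6 : ℝ) • (c1 * q2) + (5/48 : ℝ) • (c0 * q3)) * D f
        + ((1/48 : ℝ) • (c2 * q2) + (1/24 : ℝ) • (c1 * q3) + (1/48 : ℝ) • (c0 * q4)) * f) := by
  refine (diffOp_four derivF _ _).trans ?_
  exact orderTwo_C f derivF _ _ _ _ _ _ _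

theorem diffOp_orderTwoTerm_quadratic (a b : SmoothFun I) :
    diffOp derivF (orderTwoTerm c0 c1 c2 q1 q2 q3 q4) 4 (quadratic a b) =
    quintic ((1/8 : ℝ) • (c0 * q1) * a)
      ((1/8 : ℝ) • (c0 * q1) * (3 * D a + 2 * b)
        + ((3/16 : ℝ) • (c1 * q1) + (3/16 : ℝ) • (c0 * q2)) * a)
      ((1/8 : ℝ) • (c0 * q1) * (4 * D a + 6 * b)
        + (((1/16 : ℝ) • (c1 * q1) + (7/48 : ℝ) • (c0 * q2)) + (1/24 : ℝ) • (c0 * q2)) * a)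
      ((1/8 : ℝ) • (c0 * q1) * (3 * D (D a) + 7 * D b)
        + ((3/16 : ℝ) • (c1 * q1) + (3/16 : ℝ) • (c0 * q2)) * (2 * D a + 2 * b)
        + ((1/16 : ℝ) • (c2 * q1) + (1/6 : ℝ) • (c1 * q2) + (5/48 : ℝ) • (c0 * q3)) * a
        + (1/24 : ℝ) • (c0 * q2) * b)
      ((1/8 : ℝ) • (c0 * q1) * (3 * D (D a) + 12 * D b)
        + ((3/16 : ℝ) • (c1 * q1) + (3/16 : ℝ) • (c0 * q2)) * (D a + 2 * b)
        + ((1/16 : ℝ) • (c1 * q1) + (7/48 : ℝ) • (c0 * q2)) * (D a + 2 * b)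
        + ((1/12 : ℝ) • (c1 * q2) + (1/12 : ℝ) • (c0 * q3)) * a)
      ((1/8 : ℝ) • (c0 * q1) * (D (D (D a)) + 9 * D (D b))
        + ((3/16 : ℝ) • (c1 * q1) + (3/16 : ℝ) • (c0 * q2)) * (D (D a) + 5 * D b)
        + ((1/16 : ℝ) • (c2 * q1) + (1/6 : ℝ) • (c1 * q2) + (5/48 : ℝ) • (c0 * q3)) * (D a + 2 * b)
        + ((1/16 : ℝ) • (c1 * q1) + (7/48 : ℝ) • (c0 * q2)) * D b
        + ((1/48 : ℝ) • (c2 * q2) + (1/24 : ℝ) • (c1 * q3) + (1/48 : ℝ) • (c0 * q4)) * a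
        + ((1/12 : ℝ) • (c1 * q2) + (1/12 : ℝ) • (c0 * q3)) * b)
      ((1/8 : ℝ) • (c0 * q1) * D (D (D b))
        + ((3/16 : ℝ) • (c1 * q1) + (3/16 : ℝ) • (c0 * q2)) * D (D b)
        + ((1/16 : ℝ) • (c2 * q1) + (1/6 : ℝ) • (c1 * q2) + (5/48 : ℝ) • (c0 * q3)) * D b
        + ((1/48 : ℝ) • (c2 * q2) + (1/24 : ℝ) • (c1 * q3) + (1/48 : ℝ) • (c0 * q4)) * b) := by
  refine (diffOp_four derivF _ _).trans ?_
  exact orderTwo_quadratic a b derivF _ _ _ _ _ _ _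

theorem diffOp_orderFourTerm_C (f : SmoothFun I) :
    diffOp derivF (orderFourTerm c0 c1 c2 c3 c4 q1 q2 q3 q4 q5 q6 q7 r) 6 (C f) =
    quintic (k5 c0 c1 q1 q2 * D f + k0_5 c0 c1 q2 q3 r * f)
      (5 * (k5 c0 c1 q1 q2 * D (D f)) + k4_1 c0 c1 c2 q1 q2 q3 * D f
        + k1_4 c0 c1 c2 q1 q2 q3 r * D f + k0_1_4 c0 c1 c2 q2 q3 q4 r * f)
      (10 * (k5 c0 c1 q1 q2 * D (D f)) + k3_2 c0 c1 c2 q1 q2 q3 r * D f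
        + k2_3 c0 c1 c2 q1 q2 q3 r * D f + k0_2_3 c0 c1 c2 q2 q3 q4 r * f)
      (10 * (k5 c0 c1 q1 q2 * D (D (D f))) + 4 * (k4_1 c0 c1 c2 q1 q2 q3 * D (D f))
        + k3_11 c0 c1 c2 c3 q1 q2 q3 q4 r * D f + k2_3 c0 c1 c2 q1 q2 q3 r * D (D f)
        + k1_1_3 c0 c1 c2 c3 q1 q2 q3 q4 r * D f + k0_11_3 c0 c1 c2 c3 q2 q3 q4 q5 r * f)
      (15 * (k5 c0 c1 q1 q2 * D (D (D f))) + 3 * (k4_1 c0 c1 c2 q1 q2 q3 * D (D f))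
        + 3 * (k3_2 c0 c1 c2 q1 q2 q3 r * D (D f)) + k2_1_2 c0 c1 c2 c3 q1 q2 q3 q4 r * D f
        + k1_22 c0 c1 c2 c3 q1 q2 q3 q4 r * D f + k0_1_22 c0 c1 c2 c3 q2 q3 q4 q5 r * f)
      (10 * (k5 c0 c1 q1 q2 * D (D (D (D f)))) + 6 * (k4_1 c0 c1 c2 q1 q2 q3 * D (D (D f)))
        + 3 * (k3_11 c0 c1 c2 c3 q1 q2 q3 q4 r * D (D f))
        + k3_2 c0 c1 c2 q1 q2 q3 r * D (D (D f))
        + k2_111 c0 c1 c2 c3 c4 q1 q2 q3 q4 q5 r * D f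
        + k2_1_2 c0 c1 c2 c3 q1 q2 q3 q4 r * D (D f)
        + k1_11_2 c0 c1 c2 c3 c4 q1 q2 q3 q4 q5 r * D f
        + k0_111_2 c0 c1 c2 c3 c4 q2 q3 q4 q5 q6 r * f)
      (k5 c0 c1 q1 q2 * D (D (D (D (D f)))) + k4_1 c0 c1 c2 q1 q2 q3 * D (D (D (D f)))
        + k3_11 c0 c1 c2 c3 q1 q2 q3 q4 r * D (D (D f))
        + k2_111 c0 c1 c2 c3 c4 q1 q2 q3 q4 q5 r * D (D f)
        + k1_1111 c0 c1 c2 c3 c4 q2 q3 q4 q5 q6 r * D f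
        + k0_11111 c0 c1 c2 c3 c4 q2 q3 q4 q5 q6 q7 r * f) := by
  refine (diffOp_six derivF _ _).trans ?_
  exact orderFour_C f derivF _ _ _ _ _ _ _ _ _ _ _ _ _ _ _ _ _ _ _

end

theorem jetEuler_sq_add_pow_four {S : Type*} [CommRing S] [Algebra ℝ S] (δ : Derivation ℝ S S)
    (a b : S) :
    jetEuler δ (C a * X 1 ^ 2 + C (-b) * X 0 ^ 4) =
      quartic (2 * a) (4 * δ a) (3 * δ a) (2 * δ (δ a) + 12 * b) (3 * δ b) := by
  rw [jetEuler_add, jetEuler_C_mul_X_one_sq, jetEuler_C_mul_X_zero_pow_four, quartic_add, map_neg]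
  congr 1 <;> ring

theorem hamDensity_four (c p f : SmoothFun I) :
    hamDensity c p 0 f 4 = C (hamA c p f) * X 1 ^ 2 - C (hamB c p f - 0 * D^[3] f) * X 0 ^ 4 := rfl

theorem euler_hamDensity_four (c p f : SmoothFun I) :
    euler (hamDensity c p 0 f 4) = quartic (2 * hamA c p f) (4 * D (hamA c p f))
      (3 * D (hamA c p f)) (2 * D (D (hamA c p f)) + 12 * hamB c p f) (3 * D (hamB c p f)) := by
  have h : hamDensity c p 0 f 4 = C (hamA c p f) * X 1 ^ 2 + C (-hamB c p f) * X 0 ^ 4 := by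
    rw [hamDensity_four, zero_mul, sub_zero]
    exact (add_C_neg_mul _ _ _).symm
  rw [euler_eq, h]
  exact jetEuler_sq_add_pow_four derivF _ _

/-! ### Identities between the coefficients -/

theorem add_val (f g : SmoothFun I) (x : I) : (f + g).1 x = f.1 x + g.1 x := rfl
theorem sub_val (f g : SmoothFun I) (x : I) : (f - g).1 x = f.1 x - g.1 x := rfl
theorem neg_val (f : SmoothFun I) (x : I) : (-f).1 x = -f.1 x := rfl
theorem mul_val (f g : SmoothFun I) (x : I) : (f * g).1 x = f.1 x * g.1 x := rfl
theorem smul_val (a : ℝ) (f : SmoothFun I) (x : I) : (a • f).1 x = a * f.1 x := rfl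
theorem pow_val (f : SmoothFun I) (n : ℕ) (x : I) : (f ^ n).1 x = f.1 x ^ n := rfl
theorem zero_val (x : I) : (0 : SmoothFun I).1 x = 0 := rfl
theorem ofNat_val (n : ℕ) [n.AtLeastTwo] (x : I) : (ofNat(n) : SmoothFun I).1 x = OfNat.ofNat n := rfl
theorem D_ofNat (n : ℕ) [n.AtLeastTwo] : D (ofNat(n) : SmoothFun I) = 0 := derivation_ofNat derivD n
theorem D_sq (f : SmoothFun I) : D (f ^ 2) = 2 * (f * D f) := by
  rw [pow_two, D_mul]; ring
theorem D_cube (f : SmoothFun I) : D (f ^ 3) = 3 * (f ^ 2 * D f) := by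
  rw [pow_succ, D_mul, D_sq]; ring

/-- `f i` is the `i`-th derivative of `f 0`. -/
def IsDerivSeq (f : ℕ → SmoothFun I) : Prop := ∀ i, D (f i) = f (i + 1)

theorem isDerivSeq_iterate (f : SmoothFun I) : IsDerivSeq fun i => D^[i] f :=
  fun i => (Function.iterate_succ_apply' D i f).symm

/-! ### Derivatives of the Lenard partner `t` and of the parameter `p`. -/

/-- The relation `ht2` is the order zero Lenard recursion. Expanding the derivatives of `t` in those
of `g` and `q` turns the higher-order recursions into polynomial identities. Eight derivatives are
enough: the fourth-order density contains `f` up to its sixth derivative, its Euler–Lagrange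
expression the seventh, and `∂_x` adds one. -/
theorem primitive_deriv_three {q g t : ℕ → SmoothFun I} (hq : IsDerivSeq q) (hg : IsDerivSeq g)
    (ht : IsDerivSeq t) (ht2 : t 2 = q 0 * g 2 + (1/2 : ℝ) • (q 1 * g 1)) :
    t 3 = (g 3 * q 0) + (3/2 : ℝ) • (g 2 * q 1) + (1/2 : ℝ) • (g 1 * q 2) := by
  rw [← ht 2, ht2]
  simp only [D_add, D_mul, D_smul, hq _, hg _, Nat.reduceAdd]
  ext x
  simp only [add_val, mul_val, smul_val]
  ring

theorem primitive_deriv_four {q g t : ℕ → SmoothFun I} (hq : IsDerivSeq q) (hg : IsDerivSeq g)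
    (ht : IsDerivSeq t) (ht2 : t 2 = q 0 * g 2 + (1/2 : ℝ) • (q 1 * g 1)) :
    t 4 = (g 4 * q 0) + (5/2 : ℝ) • (g 3 * q 1) + (2 : ℝ) • (g 2 * q 2)
       + (1/2 : ℝ) • (g 1 * q 3) := by
  rw [← ht 3, primitive_deriv_three hq hg ht ht2]
  simp only [D_add, D_mul, D_smul, hq _, hg _, Nat.reduceAdd]
  ext x
  simp only [add_val, mul_val, smul_val]
  ring

theorem primitive_deriv_five {q g t : ℕ → SmoothFun I} (hq : IsDerivSeq q) (hg : IsDerivSeq g)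
    (ht : IsDerivSeq t) (ht2 : t 2 = q 0 * g 2 + (1/2 : ℝ) • (q 1 * g 1)) :
    t 5 = (g 5 * q 0) + (7/2 : ℝ) • (g 4 * q 1) + (9/2 : ℝ) • (g 3 * q 2)
       + (5/2 : ℝ) • (g 2 * q 3) + (1/2 : ℝ) • (g 1 * q 4) := by
  rw [← ht 4, primitive_deriv_four hq hg ht ht2]
  simp only [D_add, D_mul, D_smul, hq _, hg _, Nat.reduceAdd]
  ext x
  simp only [add_val, mul_val, smul_val]
  ring

theorem primitive_deriv_six {q g t : ℕ → SmoothFun I} (hq : IsDerivSeq q) (hg : IsDerivSeq g)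
    (ht : IsDerivSeq t) (ht2 : t 2 = q 0 * g 2 + (1/2 : ℝ) • (q 1 * g 1)) :
    t 6 = (g 6 * q 0) + (9/2 : ℝ) • (g 5 * q 1) + (8 : ℝ) • (g 4 * q 2)
       + (7 : ℝ) • (g 3 * q 3) + (3 : ℝ) • (g 2 * q 4) + (1/2 : ℝ) • (g 1 * q 5) := by
  rw [← ht 5, primitive_deriv_five hq hg ht ht2]
  simp only [D_add, D_mul, D_smul, hq _, hg _, Nat.reduceAdd]
  ext x
  simp only [add_val, mul_val, smul_val]
  ring

theorem primitive_deriv_seven {q g t : ℕ → SmoothFun I} (hq : IsDerivSeq q) (hg : IsDerivSeq g)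
    (ht : IsDerivSeq t) (ht2 : t 2 = q 0 * g 2 + (1/2 : ℝ) • (q 1 * g 1)) :
    t 7 = (g 7 * q 0) + (11/2 : ℝ) • (g 6 * q 1) + (25/2 : ℝ) • (g 5 * q 2)
       + (15 : ℝ) • (g 4 * q 3) + (10 : ℝ) • (g 3 * q 4) + (7/2 : ℝ) • (g 2 * q 5)
       + (1/2 : ℝ) • (g 1 * q 6) := by
  rw [← ht 6, primitive_deriv_six hq hg ht ht2]
  simp only [D_add, D_mul, D_smul, hq _, hg _, Nat.reduceAdd]
  ext x
  simp only [add_val, mul_val, smul_val]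
  ring

theorem primitive_deriv_eight {q g t : ℕ → SmoothFun I} (hq : IsDerivSeq q) (hg : IsDerivSeq g)
    (ht : IsDerivSeq t) (ht2 : t 2 = q 0 * g 2 + (1/2 : ℝ) • (q 1 * g 1)) :
    t 8 = (g 8 * q 0) + (13/2 : ℝ) • (g 7 * q 1) + (18 : ℝ) • (g 6 * q 2)
       + (55/2 : ℝ) • (g 5 * q 3) + (25 : ℝ) • (g 4 * q 4) + (27/2 : ℝ) • (g 3 * q 5)
       + (4 : ℝ) • (g 2 * q 6) + (1/2 : ℝ) • (g 1 * q 7) := by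
  rw [← ht 7, primitive_deriv_seven hq hg ht ht2]
  simp only [D_add, D_mul, D_smul, hq _, hg _, Nat.reduceAdd]
  ext x
  simp only [add_val, mul_val, smul_val]
  ring

/-- The letter `r` plays the role of `1 / q'` and is known only through its derivative, so `p` and
its derivatives become polynomials in the `c i`, `q i` and `r`. Three derivatives of `p` occur in
the fourth-order recursion. -/
theorem param_deriv_one {c q p : ℕ → SmoothFun I} {r : SmoothFun I} (hc : IsDerivSeq c)
    (hq : IsDerivSeq q) (hp : IsDerivSeq p) (hr : D r = -(r ^ 2 * q 2))
    (hp0 : p 0 = (1/192 : ℝ) • (c 0 * c 1) - (1/960 : ℝ) • (c 0 ^ 2 * q 2 * r)) :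
    p 1 = (1/192 : ℝ) • (c 1 ^ 2) + (1/960 : ℝ) • (c 0 ^ 2 * q 2 ^ 2 * r ^ 2) + (1/192 : ℝ) • (c 0 * c 2)
       - (1/480 : ℝ) • (c 0 * c 1 * q 2 * r) - (1/960 : ℝ) • (c 0 ^ 2 * q 3 * r) := by
  rw [← hp 0, hp0]
  simp only [D_sub, D_mul, D_smul, D_sq, hr, hc _, hq _, Nat.reduceAdd]
  ext x
  simp only [add_val, sub_val, neg_val, mul_val, smul_val, pow_val, ofNat_val]
  ring

theorem param_deriv_two {c q p : ℕ → SmoothFun I} {r : SmoothFun I} (hc : IsDerivSeq c)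
    (hq : IsDerivSeq q) (hp : IsDerivSeq p) (hr : D r = -(r ^ 2 * q 2))
    (hp0 : p 0 = (1/192 : ℝ) • (c 0 * c 1) - (1/960 : ℝ) • (c 0 ^ 2 * q 2 * r)) :
    p 2 = (1/64 : ℝ) • (c 1 * c 2) + (1/320 : ℝ) • (c 0 ^ 2 * q 2 * q 3 * r ^ 2) + (1/240 : ℝ) • (c 0 * c 1 * q 2 ^ 2 * r ^ 2)
       + (1/192 : ℝ) • (c 0 * c 3) - (1/480 : ℝ) • (c 0 * c 2 * q 2 * r) - (1/240 : ℝ) • (c 0 * c 1 * q 3 * r)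
       - (1/480 : ℝ) • (c 1 ^ 2 * q 2 * r) - (1/480 : ℝ) • (c 0 ^ 2 * q 2 ^ 3 * r ^ 3) - (1/960 : ℝ) • (c 0 ^ 2 * q 4 * r) := by
  rw [← hp 1, param_deriv_one hc hq hp hr hp0]
  simp only [D_add, D_sub, D_mul, D_smul, D_sq, hr, hc _, hq _, Nat.reduceAdd]
  ext x
  simp only [add_val, sub_val, neg_val, mul_val, smul_val, pow_val, ofNat_val]
  ring

theorem param_deriv_three {c q p : ℕ → SmoothFun I} {r : SmoothFun I} (hc : IsDerivSeq c)
    (hq : IsDerivSeq q) (hp : IsDerivSeq p) (hr : D r = -(r ^ 2 * q 2))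
    (hp0 : p 0 = (1/192 : ℝ) • (c 0 * c 1) - (1/960 : ℝ) • (c 0 ^ 2 * q 2 * r)) :
    p 3 = (1/64 : ℝ) • (c 2 ^ 2) + (1/160 : ℝ) • (c 0 * c 2 * q 2 ^ 2 * r ^ 2) + (1/320 : ℝ) • (c 0 ^ 2 * q 3 ^ 2 * r ^ 2)
       + (3/160 : ℝ) • (c 0 * c 1 * q 2 * q 3 * r ^ 2) + (1/192 : ℝ) • (c 0 * c 4) + (1/160 : ℝ) • (c 1 ^ 2 * q 2 ^ 2 * r ^ 2)
       + (1/48 : ℝ) • (c 1 * c 3) + (1/160 : ℝ) • (c 0 ^ 2 * q 2 ^ 4 * r ^ 4) + (1/240 : ℝ) • (c 0 ^ 2 * q 2 * q 4 * r ^ 2)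
       - (1/160 : ℝ) • (c 0 * c 2 * q 3 * r) - (1/160 : ℝ) • (c 1 * c 2 * q 2 * r) - (1/160 : ℝ) • (c 1 ^ 2 * q 3 * r)
       - (1/80 : ℝ) • (c 0 ^ 2 * q 2 ^ 2 * q 3 * r ^ 3) - (1/960 : ℝ) • (c 0 ^ 2 * q 5 * r) - (1/80 : ℝ) • (c 0 * c 1 * q 2 ^ 3 * r ^ 3)
       - (1/160 : ℝ) • (c 0 * c 1 * q 4 * r) - (1/480 : ℝ) • (c 0 * c 3 * q 2 * r) := by
  rw [← hp 2, param_deriv_two hc hq hp hr hp0]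
  simp only [D_add, D_sub, D_mul, D_smul, D_sq, D_cube, hr, hc _, hq _, Nat.reduceAdd]
  ext x
  simp only [add_val, sub_val, neg_val, mul_val, smul_val, pow_val, ofNat_val]
  ring

theorem cubic_congr {S : Type*} [CommRing S] {a b d a' b' d' : S} (ha : a = a') (hb : b = b')
    (hd : d = d') : cubic a b d = cubic a' b' d' := by
  rw [ha, hb, hd]

theorem quintic_congr {S : Type*} [CommRing S]
    {a5 a14 a23 a113 a122 a1112 a11111 b5 b14 b23 b113 b122 b1112 b11111 : S} (h5 : a5 = b5)
    (h14 : a14 = b14) (h23 : a23 = b23) (h113 : a113 = b113) (h122 : a122 = b122)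
    (h1112 : a1112 = b1112) (h11111 : a11111 = b11111) :
    quintic a5 a14 a23 a113 a122 a1112 a11111 = quintic b5 b14 b23 b113 b122 b1112 b11111 := by
  rw [h5, h14, h23, h113, h122, h1112, h11111]

variable {c q g t p : ℕ → SmoothFun I} {r : SmoothFun I}

/-! ### The Lenard recursion at orders two and four. -/

/-- The order two part of `P₂ δH_g = ∂_x δH_t`. It holds as a polynomial identity and involves
neither `p` nor `1 / q'`. -/
theorem orderTwo_identity (hc : IsDerivSeq c) (hq : IsDerivSeq q) (hg : IsDerivSeq g)
    (ht : IsDerivSeq t) (ht2 : t 2 = q 0 * g 2 + (1/2 : ℝ) • (q 1 * g 1)) :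
    cubic (q 0 * (-2 * -((1/24 : ℝ) • (c 0 * g 3))))
        (q 0 * (D (-2 * -((1/24 : ℝ) • (c 0 * g 3))) + 2 * -D (-((1/24 : ℝ) • (c 0 * g 3))))
          + (1/2 : ℝ) • D (q 0) * (-2 * -((1/24 : ℝ) • (c 0 * g 3))))
        (q 0 * D (-D (-((1/24 : ℝ) • (c 0 * g 3))))
          + (1/2 : ℝ) • D (q 0) * -D (-((1/24 : ℝ) • (c 0 * g 3))))
      + diffOp derivF (orderTwoTerm (c 0) (c 1) (c 2) (q 1) (q 2) (q 3) (q 4)) 4 (C (g 1)) =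
    dx (quadratic (-2 * -((1/24 : ℝ) • (c 0 * t 3))) (-D (-((1/24 : ℝ) • (c 0 * t 3))))) := by
  rw [diffOp_orderTwoTerm_C, dx_quadratic]
  refine (cubic_add ..).trans (cubic_congr ?_ ?_ ?_) <;> ext x <;>
  simp only [D_add, D_mul, D_smul, D_neg, D_ofNat, hc _, hq _, hg _, ht _,
    Nat.reduceAdd] <;>
  simp only [primitive_deriv_three hq hg ht ht2, primitive_deriv_four hq hg ht ht2,
    primitive_deriv_five hq hg ht ht2, add_val, mul_val, smul_val, neg_val, ofNat_val,
    zero_val] <;>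
  ring

/-- `hamA` in terms of sequences of derivatives. -/
def seqA (c p g : ℕ → SmoothFun I) : SmoothFun I :=
  p 0 * g 3 + (1/480 : ℝ) • (c 0 ^ 2 * g 4)

/-- `hamB` in terms of sequences of derivatives. -/
def seqB (c p g : ℕ → SmoothFun I) : SmoothFun I :=
  (1/1152 : ℝ) • (c 0 * c 2 * g 4) + (1/1152 : ℝ) • (c 0 * c 1 * g 5)
    + (1/3456 : ℝ) • (c 0 ^ 2 * g 6) + (1/6 : ℝ) • (p 1 * g 4) + (1/6 : ℝ) • (p 0 * g 5)

-- The order four part of `P₂ δH_g = ∂_x δH_t`: the leading, second-order and fourth-order operators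
-- act on the fourth-order, second-order and leading parts of `δH_g`. This is the only place where
-- the particular form of `p` is needed.
set_option maxHeartbeats 4000000 in
theorem orderFour_identity (hc : IsDerivSeq c) (hq : IsDerivSeq q) (hg : IsDerivSeq g)
    (ht : IsDerivSeq t) (hp : IsDerivSeq p) (hr : D r = -(r ^ 2 * q 2)) (hrq : r * q 1 = 1)
    (ht2 : t 2 = q 0 * g 2 + (1/2 : ℝ) • (q 1 * g 1))
    (hp0 : p 0 = (1/192 : ℝ) • (c 0 * c 1) - (1/960 : ℝ) • (c 0 ^ 2 * q 2 * r)) :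
    diffOp derivF (leadingTerm (q 0)) 2 (quartic (2 * seqA c p g) (4 * D (seqA c p g))
        (3 * D (seqA c p g)) (2 * D (D (seqA c p g)) + 12 * seqB c p g) (3 * D (seqB c p g)))
      + diffOp derivF (orderTwoTerm (c 0) (c 1) (c 2) (q 1) (q 2) (q 3) (q 4)) 4
        (quadratic (-2 * -((1/24 : ℝ) • (c 0 * g 3))) (-D (-((1/24 : ℝ) • (c 0 * g 3)))))
      + diffOp derivF (orderFourTerm (c 0) (c 1) (c 2) (c 3) (c 4) (q 1) (q 2) (q 3) (q 4) (q 5)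
        (q 6) (q 7) r) 6 (C (g 1)) =
    dx (quartic (2 * seqA c p t) (4 * D (seqA c p t))
        (3 * D (seqA c p t)) (2 * D (D (seqA c p t)) + 12 * seqB c p t) (3 * D (seqB c p t))) := by
  have hl := (diffOp_two derivF (leadingTerm (q 0)) (quartic (2 * seqA c p g) (4 * D (seqA c p g))
        (3 * D (seqA c p g)) (2 * D (D (seqA c p g)) + 12 * seqB c p g) (3 * D (seqB c p g)))).trans
    (leading_quartic _ _ _ _ _ derivF (q 0) ((1/2 : ℝ) • D (q 0)))
  rw [hl, diffOp_orderTwoTerm_quadratic, diffOp_orderFourTerm_C, dx_quartic]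
  refine (congrArg (· + _) (quintic_add ..)).trans ((quintic_add ..).trans
    (quintic_congr ?_ ?_ ?_ ?_ ?_ ?_ ?_)) <;> ext x <;>
  have hrx : r.1 x * (q 1).1 x = 1 := congrArg (fun f : SmoothFun I => f.1 x) hrq
  all_goals
    simp only [seqA, seqB, derivF_apply, D_add, D_mul, D_smul, D_neg, D_sq, D_ofNat, D_zero,
      hc _, hq _, hg _, ht _,
      hp _, Nat.reduceAdd]
    simp only [primitive_deriv_three hq hg ht ht2, primitive_deriv_four hq hg ht ht2,
      primitive_deriv_five hq hg ht ht2, primitive_deriv_six hq hg ht ht2,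
      primitive_deriv_seven hq hg ht ht2, primitive_deriv_eight hq hg ht ht2, hp0,
      param_deriv_one hc hq hp hr hp0, param_deriv_two hc hq hp hr hp0,
      param_deriv_three hc hq hp hr hp0, k5, k4_1, k3_11, k3_2, k2_111, k2_1_2, k2_3, k1_1111,
      k1_11_2, k1_22, k1_1_3, k1_4, k0_11111, k0_111_2, k0_1_22, k0_11_3, k0_2_3, k0_1_4, k0_5,
      add_val, sub_val, mul_val, smul_val, neg_val, pow_val, ofNat_val, zero_val]
  -- With `r` treated as an independent letter, the two sides of each of the seven coefficient
  -- identities differ by a multiple of `r q' - 1`; the multiplier given is that cofactor.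
  · linear_combination (1/320 * (c 0).1 x ^ 2 * (g 2).1 x * (q 2).1 x) * hrx
  · linear_combination (7/480 * (c 0).1 x ^ 2 * (g 3).1 x * (q 2).1 x + 3/160 * (c 0).1 x * (c 1).1 x * (g 2).1 x
      * (q 2).1 x - 3/320 * (c 0).1 x ^ 2 * (g 2).1 x * (q 2).1 x ^ 2 * r.1 x + 3/320 * (c 0).1
      x ^ 2 * (g 2).1 x * (q 3).1 x) * hrx
  · linear_combination (1/64 * (c 0).1 x ^ 2 * (g 2).1 x * (q 3).1 x - 1/64 * (c 0).1 x ^ 2 * (g 2).1 x * (q 2).1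
      x ^ 2 * r.1 x + 1/32 * (c 0).1 x * (c 1).1 x * (g 2).1 x * (q 2).1 x + 5/192 * (c 0).1 x ^
      2 * (g 3).1 x * (q 2).1 x) * hrx
  · linear_combination (-11/320 * (c 0).1 x ^ 2 * (g 3).1 x * (q 2).1 x ^ 2 * r.1 x + 11/320 * (c 0).1 x ^ 2 * (g
      3).1 x * (q 3).1 x + 13/480 * (c 0).1 x ^ 2 * (g 4).1 x * (q 2).1 x + 11/160 * (c 0).1 x *
      (c 1).1 x * (g 3).1 x * (q 2).1 x - 3/80 * (c 0).1 x * (c 1).1 x * (g 2).1 x * (q 2).1 x ^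
      2 * r.1 x + 3/80 * (c 0).1 x * (c 1).1 x * (g 2).1 x * (q 3).1 x + 3/160 * (c 1).1 x ^ 2 *
      (g 2).1 x * (q 2).1 x + 3/320 * (c 0).1 x ^ 2 * (g 2).1 x * (q 4).1 x + 3/160 * (c 0).1 x
      ^ 2 * (g 2).1 x * (q 2).1 x ^ 3 * r.1 x ^ 2 - 9/320 * (c 0).1 x ^ 2 * (g 2).1 x * (q 2).1
      x * (q 3).1 x * r.1 x + 3/160 * (c 0).1 x * (c 2).1 x * (g 2).1 x * (q 2).1 x) * hrx
  · linear_combination (29/640 * (c 0).1 x ^ 2 * (g 3).1 x * (q 3).1 x - 29/640 * (c 0).1 x ^ 2 * (g 3).1 x * (q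
      2).1 x ^ 2 * r.1 x + 37/960 * (c 0).1 x ^ 2 * (g 4).1 x * (q 2).1 x + 29/320 * (c 0).1 x *
      (c 1).1 x * (g 3).1 x * (q 2).1 x + 7/160 * (c 0).1 x * (c 1).1 x * (g 2).1 x * (q 3).1 x
      - 7/160 * (c 0).1 x * (c 1).1 x * (g 2).1 x * (q 2).1 x ^ 2 * r.1 x + 7/320 * (c 1).1 x ^
      2 * (g 2).1 x * (q 2).1 x + 7/640 * (c 0).1 x ^ 2 * (g 2).1 x * (q 4).1 x - 21/640 * (c
      0).1 x ^ 2 * (g 2).1 x * (q 2).1 x * (q 3).1 x * r.1 x + 7/320 * (c 0).1 x ^ 2 * (g 2).1 x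
      * (q 2).1 x ^ 3 * r.1 x ^ 2 + 7/320 * (c 0).1 x * (c 2).1 x * (g 2).1 x * (q 2).1 x) * hrx
  · linear_combination (-3/40 * (c 0).1 x ^ 2 * (g 3).1 x * (q 2).1 x * (q 3).1 x * r.1 x + 1/20 * (c 0).1 x ^ 2 *
      (g 3).1 x * (q 2).1 x ^ 3 * r.1 x ^ 2 - 23/480 * (c 0).1 x ^ 2 * (g 4).1 x * (q 2).1 x ^ 2
      * r.1 x - 1/10 * (c 0).1 x * (c 1).1 x * (g 3).1 x * (q 2).1 x ^ 2 * r.1 x + 23/480 * (c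
      0).1 x ^ 2 * (g 4).1 x * (q 3).1 x + 1/10 * (c 0).1 x * (c 1).1 x * (g 3).1 x * (q 3).1 x
      + 23/240 * (c 0).1 x * (c 1).1 x * (g 4).1 x * (q 2).1 x + 1/20 * (c 0).1 x * (c 2).1 x *
      (g 3).1 x * (q 2).1 x + 1/20 * (c 1).1 x ^ 2 * (g 3).1 x * (q 2).1 x + 1/40 * (c 0).1 x ^
      2 * (g 3).1 x * (q 4).1 x + 5/192 * (c 0).1 x ^ 2 * (g 5).1 x * (q 2).1 x + 1/320 * (c
      0).1 x ^ 2 * (g 2).1 x * (q 5).1 x - 9/160 * (c 0).1 x * (c 1).1 x * (g 2).1 x * (q 2).1 x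
      * (q 3).1 x * r.1 x + 3/80 * (c 0).1 x * (c 1).1 x * (g 2).1 x * (q 2).1 x ^ 3 * r.1 x ^ 2
      - 3/160 * (c 1).1 x ^ 2 * (g 2).1 x * (q 2).1 x ^ 2 * r.1 x + 3/160 * (c 1).1 x ^ 2 * (g
      2).1 x * (q 3).1 x + 3/160 * (c 1).1 x * (c 2).1 x * (g 2).1 x * (q 2).1 x + 3/160 * (c
      0).1 x * (c 1).1 x * (g 2).1 x * (q 4).1 x - 1/80 * (c 0).1 x ^ 2 * (g 2).1 x * (q 2).1 x
      * (q 4).1 x * r.1 x + 1/160 * (c 0).1 x * (c 3).1 x * (g 2).1 x * (q 2).1 x + 3/80 * (c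
      0).1 x ^ 2 * (g 2).1 x * (q 2).1 x ^ 2 * (q 3).1 x * r.1 x ^ 2 - 3/160 * (c 0).1 x ^ 2 *
      (g 2).1 x * (q 2).1 x ^ 4 * r.1 x ^ 3 - 3/160 * (c 0).1 x * (c 2).1 x * (g 2).1 x * (q
      2).1 x ^ 2 * r.1 x - 3/320 * (c 0).1 x ^ 2 * (g 2).1 x * (q 3).1 x ^ 2 * r.1 x + 3/160 *
      (c 0).1 x * (c 2).1 x * (g 2).1 x * (q 3).1 x) * hrx
  · linear_combination (1/48 * (c 0).1 x * (c 1).1 x * (g 4).1 x * (q 3).1 x - 1/64 * (c 0).1 x ^ 2 * (g 4).1 x *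
      (q 2).1 x * (q 3).1 x * r.1 x + 5/768 * (c 0).1 x ^ 2 * (g 5).1 x * (q 3).1 x - 1/48 * (c
      0).1 x * (c 1).1 x * (g 4).1 x * (q 2).1 x ^ 2 * r.1 x + 1/96 * (c 0).1 x ^ 2 * (g 4).1 x
      * (q 2).1 x ^ 3 * r.1 x ^ 2 - 5/768 * (c 0).1 x ^ 2 * (g 5).1 x * (q 2).1 x ^ 2 * r.1 x +
      1/96 * (c 0).1 x * (c 2).1 x * (g 4).1 x * (q 2).1 x + 1/96 * (c 1).1 x ^ 2 * (g 4).1 x *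
      (q 2).1 x + 5/384 * (c 0).1 x * (c 1).1 x * (g 5).1 x * (q 2).1 x + 1/384 * (c 0).1 x ^ 2
      * (g 6).1 x * (q 2).1 x + 1/192 * (c 0).1 x ^ 2 * (g 4).1 x * (q 4).1 x + 1/768 * (c 0).1
      x ^ 2 * (g 3).1 x * (q 5).1 x + 1/128 * (c 1).1 x ^ 2 * (g 3).1 x * (q 3).1 x - 3/128 * (c
      0).1 x * (c 1).1 x * (g 3).1 x * (q 2).1 x * (q 3).1 x * r.1 x - 1/128 * (c 1).1 x ^ 2 *
      (g 3).1 x * (q 2).1 x ^ 2 * r.1 x + 1/64 * (c 0).1 x * (c 1).1 x * (g 3).1 x * (q 2).1 x ^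
      3 * r.1 x ^ 2 + 1/128 * (c 1).1 x * (c 2).1 x * (g 3).1 x * (q 2).1 x + 1/128 * (c 0).1 x
      * (c 1).1 x * (g 3).1 x * (q 4).1 x - 1/192 * (c 0).1 x ^ 2 * (g 3).1 x * (q 2).1 x * (q
      4).1 x * r.1 x + 1/384 * (c 0).1 x * (c 3).1 x * (g 3).1 x * (q 2).1 x + 1/64 * (c 0).1 x
      ^ 2 * (g 3).1 x * (q 2).1 x ^ 2 * (q 3).1 x * r.1 x ^ 2 - 1/128 * (c 0).1 x ^ 2 * (g 3).1
      x * (q 2).1 x ^ 4 * r.1 x ^ 3 - 1/128 * (c 0).1 x * (c 2).1 x * (g 3).1 x * (q 2).1 x ^ 2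
      * r.1 x - 1/256 * (c 0).1 x ^ 2 * (g 3).1 x * (q 3).1 x ^ 2 * r.1 x + 1/128 * (c 0).1 x *
      (c 2).1 x * (g 3).1 x * (q 3).1 x) * hrx

variable {c p f g : ℕ → SmoothFun I}

/-! ### Primitives of the bracket densities for the first bracket. -/

/-- The primitive is forced: its `u_xx` coefficient is read off from `u_xxx` and its `u_x ^ 2`
coefficient from `u_x u_xx`. The coefficient of `u_x ^ 3` is then a consistency check. -/
theorem dx_mul_identity_two (hc : IsDerivSeq c) (hf : IsDerivSeq f) (hg : IsDerivSeq g) :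
    C (f 1) * dx (quadratic (-2 * -((1/24 : ℝ) • (c 0 * g 3))) (-D (-((1/24 : ℝ) • (c 0 * g 3))))) + (quadratic (-2 * -((1/24 : ℝ) • (c 0 * f 3))) (-D (-((1/24 : ℝ) • (c 0 * f 3))))) * dx (C (g 1)) =
      dx (quadratic ((1/12 : ℝ) • (c 0 * f 1 * g 3))
      ((1/24 : ℝ) • (c 0 * f 1 * g 4) + (1/24 : ℝ) • (c 1 * f 1 * g 3) + (1/24 : ℝ) • (c 0 * f 3 * g 2)
       - (1/24 : ℝ) • (c 0 * f 2 * g 3))) := by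
  rw [dx_quadratic, dx_quadratic, dx_C]
  refine (congrArg₂ (· + ·) (C_mul_cubic ..) (quadratic_mul_X_zero_mul_C ..)).trans
    ((cubic_add ..).trans (cubic_congr ?_ ?_ ?_)) <;> ext x <;>
  simp only [D_add, D_sub, D_mul, D_smul, D_neg, D_ofNat, hc _, hf _, hg _,
    Nat.reduceAdd, add_val, sub_val, mul_val, smul_val, neg_val, ofNat_val, zero_val] <;>
  ring

-- The five coefficients of the primitive are determined in turn by the coefficients of `u_5`, `u_1
-- u_4`, `u_2 u_3`, `u_1 ^ 2 u_3` and `u_1 ^ 3 u_2`, where `u_k` is the `k`-th derivative. The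
-- remaining two, of `u_1 u_2 ^ 2` and `u_1 ^ 5`, are the integrability conditions. Here `p` is an
-- arbitrary function, unrelated to `c`.
set_option maxHeartbeats 4000000 in
theorem dx_mul_identity_four (hc : IsDerivSeq c) (hp : IsDerivSeq p) (hf : IsDerivSeq f)
    (hg : IsDerivSeq g) :
    C (f 1) * dx (quartic (2 * seqA c p g) (4 * D (seqA c p g)) (3 * D (seqA c p g))
        (2 * D (D (seqA c p g)) + 12 * seqB c p g) (3 * D (seqB c p g))) + (quadratic (-2 * -((1/24 : ℝ) • (c 0 * f 3))) (-D (-((1/24 : ℝ) • (c 0 * f 3))))) * dx (quadratic (-2 * -((1/24 : ℝ) • (c 0 * g 3))) (-D (-((1/24 : ℝ) • (c 0 * g 3))))) + (quartic (2 * seqA c p f) (4 * D (seqA c p f)) (3 * D (seqA c p f))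
        (2 * D (D (seqA c p f)) + 12 * seqB c p f) (3 * D (seqB c p f))) * dx (C (g 1)) =
      dx (quartic ((2 : ℝ) • (f 1 * g 3 * p 0) + (1/240 : ℝ) • (c 0 ^ 2 * f 1 * g 4))
      ((1/120 : ℝ) • (c 0 ^ 2 * f 1 * g 5) + (4 : ℝ) • (f 1 * g 3 * p 1) + (4 : ℝ) • (f 1 * g 4 * p 0)
       + (1/60 : ℝ) • (c 0 * c 1 * f 1 * g 4) + (2 : ℝ) • (f 3 * g 2 * p 0) + (1/240 : ℝ) • (c 0 ^ 2 * f 4 * g 2)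
       - (2 : ℝ) • (f 2 * g 3 * p 0) - (1/240 : ℝ) • (c 0 ^ 2 * f 2 * g 4))
      ((1/160 : ℝ) • (c 0 ^ 2 * f 1 * g 5) + (3 : ℝ) • (f 1 * g 3 * p 1) + (3 : ℝ) • (f 1 * g 4 * p 0)
       + (1/80 : ℝ) • (c 0 * c 1 * f 1 * g 4) + (1/288 : ℝ) • (c 0 ^ 2 * f 3 * g 3) + (f 2 * g 3 * p 0)
       + (1/480 : ℝ) • (c 0 ^ 2 * f 2 * g 4) - (f 3 * g 2 * p 0) - (1/480 : ℝ) • (c 0 ^ 2 * f 4 * g 2))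
      ((3/160 : ℝ) • (c 0 * c 2 * f 1 * g 4) + (2 : ℝ) • (f 1 * g 3 * p 2) + (4 : ℝ) • (f 1 * g 5 * p 0)
       + (13/480 : ℝ) • (c 0 * c 1 * f 1 * g 5) + (6 : ℝ) • (f 1 * g 4 * p 1) + (1/120 : ℝ) • (c 1 ^ 2 * f 1 * g 4)
       + (11/1440 : ℝ) • (c 0 ^ 2 * f 1 * g 6) + (1/288 : ℝ) • (c 0 * c 1 * f 3 * g 3) + (2 : ℝ) • (f 4 * g 2 * p 0)
       + (2 : ℝ) • (f 3 * g 2 * p 1) + (1/120 : ℝ) • (c 0 * c 1 * f 4 * g 2) + (1/240 : ℝ) • (c 0 ^ 2 * f 5 * g 2)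
       + (1/240 : ℝ) • (c 0 ^ 2 * f 3 * g 4) - (1/1440 : ℝ) • (c 0 ^ 2 * f 4 * g 3) - (1/240 : ℝ) • (c 0 ^ 2 * f 2 * g 5)
       - (2 : ℝ) • (f 2 * g 3 * p 1) - (2 : ℝ) • (f 2 * g 4 * p 0) - (1/120 : ℝ) • (c 0 * c 1 * f 2 * g 4))
      ((1/192 : ℝ) • (c 0 * c 2 * f 1 * g 5) + (1/384 : ℝ) • (c 1 * c 2 * f 1 * g 4) + (1/2 : ℝ) • (f 1 * g 4 * p 2)
       + (f 1 * g 5 * p 1) + (1/384 : ℝ) • (c 1 ^ 2 * f 1 * g 5) + (5/1152 : ℝ) • (c 0 * c 1 * f 1 * g 6)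
       + (1/1152 : ℝ) • (c 0 ^ 2 * f 1 * g 7) + (1/2 : ℝ) • (f 1 * g 6 * p 0) + (1/384 : ℝ) • (c 0 * c 3 * f 1 * g 4)
       + (1/1152 : ℝ) • (c 0 ^ 2 * f 4 * g 4) + (1/384 : ℝ) • (c 0 * c 1 * f 3 * g 4) + (1/1152 : ℝ) • (c 1 ^ 2 * f 3 * g 3)
       + (1/1152 : ℝ) • (c 0 ^ 2 * f 3 * g 5) + (1/2 : ℝ) • (f 4 * g 2 * p 1) + (1/384 : ℝ) • (c 0 * c 2 * f 4 * g 2)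
       + (1/384 : ℝ) • (c 0 * c 1 * f 5 * g 2) + (1/1152 : ℝ) • (c 0 ^ 2 * f 6 * g 2) + (1/2 : ℝ) • (f 5 * g 2 * p 0)
       + (1/2 : ℝ) • (f 3 * g 4 * p 0) - (1/1152 : ℝ) • (c 0 * c 1 * f 4 * g 3) - (1/384 : ℝ) • (c 0 * c 2 * f 2 * g 4)
       - (1/2 : ℝ) • (f 2 * g 5 * p 0) - (1/384 : ℝ) • (c 0 * c 1 * f 2 * g 5) - (1/2 : ℝ) • (f 2 * g 4 * p 1)
       - (1/1152 : ℝ) • (c 0 ^ 2 * f 2 * g 6) - (1/2 : ℝ) • (f 4 * g 3 * p 0) - (1/1152 : ℝ) • (c 0 ^ 2 * f 5 * g 3))) := by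
  rw [dx_quartic, dx_quartic, dx_quadratic, dx_C]
  refine (congrArg₂ (· + ·) (congrArg₂ (· + ·) (C_mul_quintic ..) (quadratic_mul_cubic ..))
    (quartic_mul_X_zero_mul_C ..)).trans ((congrArg (· + _) (quintic_add ..)).trans
    ((quintic_add ..).trans (quintic_congr ?_ ?_ ?_ ?_ ?_ ?_ ?_))) <;> ext x <;>
  simp only [seqA, seqB, D_add, D_sub, D_mul, D_smul, D_neg, D_sq, D_ofNat, D_zero, hc _, hp _,
    hf _, hg _, Nat.reduceAdd, add_val, sub_val, mul_val, smul_val, neg_val, pow_val, ofNat_val,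
    zero_val] <;>
  ring

/-! ### Commutativity -/

section

variable {M : Type*} [AddCommMonoid M] {T : ℕ → ℕ → M}

theorem sum_antidiagonal_of_odd (hT : ∀ k j, Odd k ∨ Odd j → T k j = 0) {n : ℕ} (hn : Odd n) :
    ∑ a ∈ antidiagonal n, T a.1 a.2 = 0 := by
  refine Finset.sum_eq_zero fun a ha => hT _ _ ?_
  rw [mem_antidiagonal] at ha
  rw [← ha, Nat.odd_add] at hn
  by_cases h : Odd a.1
  · exact Or.inl h
  · exact Or.inr (Nat.not_even_iff_odd.1 fun h' => h (hn.2 h'))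

theorem sum_antidiagonal_two (hT : ∀ k j, Odd k ∨ Odd j → T k j = 0) :
    ∑ a ∈ antidiagonal 2, T a.1 a.2 = T 0 2 + T 2 0 := by
  rw [Finset.Nat.sum_antidiagonal_eq_sum_range_succ]
  simp only [Finset.sum_range_succ, Finset.sum_range_zero, Nat.reduceSub, zero_add, Nat.sub_zero]
  rw [hT 1 1 (Or.inl odd_one), add_zero]

theorem sum_antidiagonal_four (hT : ∀ k j, Odd k ∨ Odd j → T k j = 0) :
    ∑ a ∈ antidiagonal 4, T a.1 a.2 = T 0 4 + T 2 2 + T 4 0 := by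
  rw [Finset.Nat.sum_antidiagonal_eq_sum_range_succ]
  simp only [Finset.sum_range_succ, Finset.sum_range_zero, Nat.reduceSub, zero_add, Nat.sub_zero]
  rw [hT 1 3 (Or.inl odd_one), hT 3 1 (Or.inr odd_one), add_zero, add_zero]

end

theorem bracket_apply (A : BracketCoeffs I) (F G : Density I) (n : ℕ) :
    bracket A F G n = ∑ a ∈ antidiagonal n,
      euler (F a.1) * ∑ b ∈ antidiagonal a.2, applyOp A b.1 (euler (G b.2)) := by
  rw [bracket]
  exact Finset.sum_congr rfl fun a _ => (Finset.mul_sum ..).symm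

theorem dx_zero : dx (0 : DiffPoly I) = 0 := by
  rw [dx_eq]; exact map_zero _

theorem applyOp_of_eq_zero {A : BracketCoeffs I} {k : ℕ} (hA : A k = 0) (h : DiffPoly I) :
    applyOp A k h = 0 := by
  rw [applyOp, hA]
  exact Finset.sum_eq_zero fun s _ => zero_mul _

theorem applyOp_zero (A : BracketCoeffs I) (k : ℕ) : applyOp A k 0 = 0 := by
  rw [applyOp_eq]; exact map_zero _

theorem firstBracket_of_ne_zero {k : ℕ} (hk : k ≠ 0) : (firstBracket (I := I)) k = 0 := by
  obtain ⟨k, rfl⟩ := Nat.exists_eq_succ_of_ne_zero hk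
  rfl

/-- The first bracket is the case `q = 1` of the leading term, so its grading and skewness need no
separate argument. -/
theorem leadingTerm_one : leadingTerm (1 : SmoothFun I) = firstBracket 0 := by
  funext s
  match s with
  | 0 =>
    change C ((1/2 : ℝ) • D 1) * ux = 0
    rw [D_one, smul_zero]
    exact (congrArg (· * ux) C_0).trans (zero_mul _)
  | 1 => rfl
  | s + 2 => rfl

theorem applyOp_firstBracket_zero (h : DiffPoly I) : applyOp firstBracket 0 h = dx h := by
  rw [applyOp_eq, dx_eq]
  refine (diffOp_two derivF _ _).trans ?_
  change 1 * _ + 0 * _ = _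
  rw [one_mul, zero_mul, add_zero]

theorem sum_applyOp_firstBracket (G : Density I) (m : ℕ) :
    ∑ b ∈ antidiagonal m, applyOp firstBracket b.1 (euler (G b.2)) = dx (euler (G m)) := by
  rw [Finset.sum_eq_single_of_mem (0, m) (by simp) fun b hb hne => ?_]
  · exact applyOp_firstBracket_zero _
  · refine applyOp_of_eq_zero (firstBracket_of_ne_zero fun h => hne ?_) _
    rw [mem_antidiagonal, h, zero_add] at hb
    exact Prod.ext h hb

theorem euler_hamDensity_of_odd (c p f : SmoothFun I) {n : ℕ} (hn : Odd n) :
    euler (hamDensity c p 0 f n) = 0 := by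
  rw [hamDensity_of_odd c p f hn, euler_zero]

theorem secondBracket_of_odd (c q : SmoothFun I) (hq : ∀ x, (D q).1 x ≠ 0) {n : ℕ} (hn : Odd n) :
    secondBracket c q hq n = 0 := by
  match n, hn with
  | 0, hn => exact absurd hn (by decide)
  | 1, _ => rfl
  | 2, hn => exact absurd hn (by decide)
  | 3, _ => rfl
  | 4, hn => exact absurd hn (by decide)
  | n + 5, _ => rfl

theorem even_or_odd_lt_six {n : ℕ} (hn : n < 6) : n = 0 ∨ n = 2 ∨ n = 4 ∨ Odd n := by
  rcases Nat.even_or_odd n with ⟨k, rfl⟩ | h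
  · omega
  · exact Or.inr (Or.inr (Or.inr h))

theorem firstBracket_commute (hI : IsConnected (I : Set ℝ)) (c p f g : SmoothFun I) :
    VanishesMod 6 (bracket firstBracket (hamDensity c p 0 f) (hamDensity c p 0 g)) := by
  intro n hn
  have hT : ∀ k j, Odd k ∨ Odd j → euler (hamDensity c p 0 f k) * dx (euler (hamDensity c p 0 g j))
      = 0 := by
    rintro k j (h | h)
    · rw [euler_hamDensity_of_odd c p f h, zero_mul]
    · rw [euler_hamDensity_of_odd c p g h, dx_zero, mul_zero]
  rw [bracket_apply]
  simp only [sum_applyOp_firstBracket]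
  obtain rfl | rfl | rfl | h := even_or_odd_lt_six hn
  -- At order zero the density is `f' g'' u_x`, which is `∂_x` of any primitive of `f' g''`.
  · obtain ⟨φ, hφ⟩ := exists_D_eq hI (D f * D (D g))
    refine ⟨C φ, ?_⟩
    rw [Finset.Nat.antidiagonal_zero, Finset.sum_singleton, euler_hamDensity_zero,
      euler_hamDensity_zero, dx_C, dx_C, hφ]
    rw [C_mul]
    ring
  · rw [sum_antidiagonal_two hT, euler_hamDensity_zero, euler_hamDensity_zero, euler_hamDensity_two,
      euler_hamDensity_two]
    exact ⟨_, (dx_mul_identity_two (isDerivSeq_iterate c) (isDerivSeq_iterate f)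
      (isDerivSeq_iterate g)).symm⟩
  · rw [sum_antidiagonal_four hT, euler_hamDensity_zero, euler_hamDensity_zero, euler_hamDensity_two,
      euler_hamDensity_two, euler_hamDensity_four, euler_hamDensity_four]
    exact ⟨_, (dx_mul_identity_four (isDerivSeq_iterate c) (isDerivSeq_iterate p)
      (isDerivSeq_iterate f) (isDerivSeq_iterate g)).symm⟩
  · exact ⟨0, by rw [dx_zero, sum_antidiagonal_of_odd hT h]⟩

/-- The Lenard recursion `P₂ δH_g = ∂_x δH_t` at every order below six. Odd orders are empty, since
neither the Hamiltonians nor the bracket have odd terms. -/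
theorem sum_applyOp_secondBracket {c q p g t : SmoothFun I} (hq : ∀ x, (D q).1 x ≠ 0)
    (hp : ∀ x, p.1 x = (5 * c.1 x * (D c).1 x
      - (c.1 x) ^ 2 * ((D^[2] q).1 x / (D q).1 x)) / 960)
    (ht : D (D t) = q * D (D g) + (1/2 : ℝ) • (D q * D g)) {m : ℕ} (hm : m < 6) :
    ∑ b ∈ antidiagonal m, applyOp (secondBracket c q hq) b.1 (euler (hamDensity c p 0 g b.2)) =
      dx (euler (hamDensity c p 0 t m)) := by
  have hT : ∀ k j, Odd k ∨ Odd j →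
      applyOp (secondBracket c q hq) k (euler (hamDensity c p 0 g j)) = 0 := by
    rintro k j (h | h)
    · exact applyOp_of_eq_zero (secondBracket_of_odd c q hq h) _
    · rw [euler_hamDensity_of_odd c p g h, applyOp_zero]
  obtain rfl | rfl | rfl | h := even_or_odd_lt_six hm
  · rw [Finset.Nat.antidiagonal_zero, Finset.sum_singleton, euler_hamDensity_zero,
      euler_hamDensity_zero, dx_C, ht, applyOp_secondBracket_zero_C]
    simp only [smul_mul_assoc]
  · rw [sum_antidiagonal_two hT, euler_hamDensity_zero, euler_hamDensity_two, euler_hamDensity_two,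
      applyOp_secondBracket_zero_quadratic, applyOp_eq]
    have h := orderTwo_identity (isDerivSeq_iterate c) (isDerivSeq_iterate q)
      (isDerivSeq_iterate g) (isDerivSeq_iterate t) ht
    exact h
  · rw [sum_antidiagonal_four hT, euler_hamDensity_zero, euler_hamDensity_two, euler_hamDensity_four,
      euler_hamDensity_four, applyOp_eq, applyOp_eq, applyOp_eq]
    have hr : recip (D q) hq * D^[1] q = 1 := by
      ext x
      exact inv_mul_cancel₀ (hq x)
    have hp0 : p = (1/192 : ℝ) • (c * D^[1] c) - (1/960 : ℝ) • (c ^ 2 * D^[2] q * recip (D q) hq) := by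
      ext x
      refine (hp x).trans ?_
      change _ = 1/192 * (c.1 x * (D c).1 x) - 1/960 * (c.1 x ^ 2 * (D^[2] q).1 x * ((D q).1 x)⁻¹)
      ring
    have h := orderFour_identity (isDerivSeq_iterate c) (isDerivSeq_iterate q)
      (isDerivSeq_iterate g) (isDerivSeq_iterate t) (isDerivSeq_iterate p) (D_recip (D q) hq) hr ht hp0
    exact h
  · rw [sum_antidiagonal_of_odd hT h, euler_hamDensity_of_odd c p t h, dx_zero]

theorem secondBracket_commute (hI : IsConnected (I : Set ℝ)) {c q p : SmoothFun I}
    (hq : ∀ x, (D q).1 x ≠ 0)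
    (hp : ∀ x, p.1 x = (5 * c.1 x * (D c).1 x
      - (c.1 x) ^ 2 * ((D^[2] q).1 x / (D q).1 x)) / 960) (f g : SmoothFun I) :
    VanishesMod 6 (bracket (secondBracket c q hq) (hamDensity c p 0 f) (hamDensity c p 0 g)) := by
  intro n hn
  -- Two integrations produce the Lenard partner `t`; below order six the density of `{H_f, H_g}_2`
  -- is then literally that of `{H_f, H_t}_1`, so the same primitive serves.
  obtain ⟨t', ht'⟩ := exists_D_eq hI (q * D (D g) + (1/2 : ℝ) • (D q * D g))
  obtain ⟨t, rfl⟩ := exists_D_eq hI t'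
  obtain ⟨r, hr⟩ := firstBracket_commute hI c p f t n hn
  refine ⟨r, hr.trans ?_⟩
  rw [bracket_apply, bracket_apply]
  refine Finset.sum_congr rfl fun a ha => ?_
  rw [mem_antidiagonal] at ha
  rw [sum_applyOp_firstBracket, sum_applyOp_secondBracket hq hp ht' (by omega)]

/-! ### Grading -/

section Jets

variable {S : Type*} [CommRing S] {d : ℕ}

theorem jetHomog_C_mul_X (a : S) (i : ℕ) (hd : i + 1 = d) : JetHomog (C a * X i) d :=
  ((jetHomog_C a).mul (jetHomog_X i)).of_eq (by omega)

theorem jetHomog_C_mul_X_pow (a : S) (i m : ℕ) (hd : m * (i + 1) = d) :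
    JetHomog (C a * X i ^ m) d :=
  ((jetHomog_C a).mul (IsWeightedHomogeneous.pow (jetHomog_X i) m)).of_eq (by simpa using hd)

theorem JetHomog.mul_X {h : MvPolynomial ℕ S} {e : ℕ} (hh : JetHomog h e) (i : ℕ)
    (hd : e + (i + 1) = d) : JetHomog (h * X i) d :=
  (hh.mul (jetHomog_X i)).of_eq hd

theorem JetHomog.mul_X_pow {h : MvPolynomial ℕ S} {e : ℕ} (hh : JetHomog h e) (i m : ℕ)
    (hd : e + m * (i + 1) = d) : JetHomog (h * X i ^ m) d :=
  (hh.mul (IsWeightedHomogeneous.pow (jetHomog_X i) m)).of_eq (by simpa using hd)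

end Jets

theorem isHomog_zero (d : ℕ) : IsHomog (0 : DiffPoly I) d := isWeightedHomogeneous_zero ..

theorem isGraded_of_forall {A : BracketCoeffs I} (hA : ∀ k, ∀ s ≤ k + 1, IsHomog (A k s) (k + 1 - s))
    (hA' : ∀ k s, k + 1 < s → A k s = 0) : IsGraded A := fun k s => ⟨hA k s, hA' k s⟩

theorem isHomog_leadingTerm (q : SmoothFun I) (s : ℕ) : IsHomog (leadingTerm q s) (1 - s) := by
  match s with
  | 0 => exact jetHomog_C_mul_X _ 0 rfl
  | 1 => exact jetHomog_C q
  | s + 2 => exact isHomog_zero _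

theorem isHomog_orderTwoTerm (c c1 c2 q1 q2 q3 q4 : SmoothFun I) (s : ℕ) :
    IsHomog (orderTwoTerm c c1 c2 q1 q2 q3 q4 s) (3 - s) := by
  match s with
  | 0 => exact ((jetHomog_C_mul_X_pow _ 0 3 rfl).add
      ((jetHomog_C_mul_X _ 0 rfl).mul_X 1 rfl)).add (jetHomog_C_mul_X _ 2 rfl)
  | 1 => exact (jetHomog_C_mul_X_pow _ 0 2 rfl).add (jetHomog_C_mul_X _ 1 rfl)
  | 2 => exact jetHomog_C_mul_X _ 0 rfl
  | 3 => exact jetHomog_C _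
  | s + 4 => exact isHomog_zero _

theorem isHomog_orderFourTerm (c c1 c2 c3 c4 q1 q2 q3 q4 q5 q6 q7 r : SmoothFun I) (s : ℕ) :
    IsHomog (orderFourTerm c c1 c2 c3 c4 q1 q2 q3 q4 q5 q6 q7 r s) (5 - s) := by
  match s with
  | 0 => exact ((((((jetHomog_C_mul_X_pow _ 0 5 rfl).add
      ((jetHomog_C_mul_X_pow _ 0 3 rfl).mul_X 1 rfl)).add
      ((jetHomog_C_mul_X _ 0 rfl).mul_X_pow 1 2 rfl)).add
      ((jetHomog_C_mul_X_pow _ 0 2 rfl).mul_X 2 rfl)).add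
      ((jetHomog_C_mul_X _ 1 rfl).mul_X 2 rfl)).add
      ((jetHomog_C_mul_X _ 0 rfl).mul_X 3 rfl)).add (jetHomog_C_mul_X _ 4 rfl)
  | 1 => exact ((((jetHomog_C_mul_X_pow _ 0 4 rfl).add
      ((jetHomog_C_mul_X_pow _ 0 2 rfl).mul_X 1 rfl)).add (jetHomog_C_mul_X_pow _ 1 2 rfl)).add
      ((jetHomog_C_mul_X _ 0 rfl).mul_X 2 rfl)).add (jetHomog_C_mul_X _ 3 rfl)
  | 2 => exact ((jetHomog_C_mul_X_pow _ 0 3 rfl).add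
      ((jetHomog_C_mul_X _ 0 rfl).mul_X 1 rfl)).add (jetHomog_C_mul_X _ 2 rfl)
  | 3 => exact (jetHomog_C_mul_X_pow _ 0 2 rfl).add (jetHomog_C_mul_X _ 1 rfl)
  | 4 => exact jetHomog_C_mul_X _ 0 rfl
  | 5 => exact jetHomog_C _
  | s + 6 => exact isHomog_zero _

theorem isGraded_secondBracket (c q : SmoothFun I) (hq : ∀ x, (D q).1 x ≠ 0) :
    IsGraded (secondBracket c q hq) := by
  refine isGraded_of_forall (fun k s _ => ?_) fun k s h => ?_
  · match k with
    | 0 => exact isHomog_leadingTerm q s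
    | 1 => exact isHomog_zero _
    | 2 => exact isHomog_orderTwoTerm _ _ _ _ _ _ _ s
    | 3 => exact isHomog_zero _
    | 4 => exact isHomog_orderFourTerm _ _ _ _ _ _ _ _ _ _ _ _ _ s
    | k + 5 => exact isHomog_zero _
  · match k, s, h with
    | 0, s + 2, _ => rfl
    | 1, _, _ => rfl
    | 2, s + 4, _ => rfl
    | 3, _, _ => rfl
    | 4, s + 6, _ => rfl
    | k + 5, _, _ => rfl

theorem isGraded_firstBracket : IsGraded (firstBracket (I := I)) := by
  refine isGraded_of_forall (fun k s _ => ?_) fun k s h => ?_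
  · match k with
    | 0 => rw [← leadingTerm_one]; exact isHomog_leadingTerm 1 s
    | k + 1 => exact isHomog_zero _
  · match k, s, h with
    | 0, s + 2, _ => rfl
    | k + 1, _, _ => rfl

section Jets

variable {S : Type*} [CommRing S] [Algebra ℝ S]

theorem sub_smul_zero (h : MvPolynomial ℕ S) (lam : ℝ) :
    h - lam • (0 : MvPolynomial ℕ S) = h := by
  rw [smul_zero, sub_zero]

theorem C_sub_smul_one (a : S) (lam : ℝ) :
    C a - lam • (1 : MvPolynomial ℕ S) = C (a - lam • 1) := by
  rw [C_sub, ← C_1, ← algebraMap_smul S lam (1 : S), ← algebraMap_smul S lam (C 1), smul_eq_C_mul,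
    smul_eq_mul, C_mul]

end Jets

theorem IsGraded.pencil {A₁ A₂ : BracketCoeffs I} (h₁ : IsGraded A₁) (h₂ : IsGraded A₂) (lam : ℝ) :
    IsGraded (pencil A₁ A₂ lam) := by
  refine fun k s => ⟨fun h => ?_, fun h => ?_⟩
  · have h1 := (h₁ k s).1 h
    have h2 := (h₂ k s).1 h
    exact IsWeightedHomogeneous.sub h2
      ((weightedHomogeneousSubmodule (SmoothFun I) (fun k : ℕ => k + 1) _).smul_of_tower_mem lam h1)
  · rw [FormalVar.pencil, (h₁ k s).2 h, (h₂ k s).2 h]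
    exact sub_smul_zero 0 lam

/-! ### The pencil -/

theorem leadingTerm_skew {A : BracketCoeffs I} {q : SmoothFun I} (hA : A 0 = leadingTerm q)
    (f g : DiffPoly I) : ∃ r, dx r = f * applyOp A 0 g + g * applyOp A 0 f := by
  -- The coefficient `½ q'` is exactly what makes `f P g + g P f` the derivative of `q f g`.
  refine ⟨C q * (f * g), ?_⟩
  have key : ∀ h : DiffPoly I, applyOp A 0 h = C q * dx h + C ((1/2 : ℝ) • D q) * ux * h := by
    intro h
    rw [applyOp_eq, hA, dx_eq]
    exact diffOp_two derivF _ _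
  have hmul : ∀ a b : DiffPoly I, dx (a * b) = a * dx b + b * dx a := by
    intro a b
    rw [dx_eq, dx_eq, dx_eq]
    exact Derivation.leibniz (totalDeriv derivF) a b
  have hhalf : C (D q) = 2 * (C ((1/2 : ℝ) • D q) : DiffPoly I) := by
    rw [two_mul, ← C_add, ← add_smul]
    norm_num
  rw [key, key, hmul, hmul, dx_C, hhalf]
  ring

/-- Subtracting `λ δ'` only replaces `q` by `q - λ`, which has the same derivative. The leading term
thus keeps its form and remains skew, even if `q - λ` has zeros. -/
theorem pencil_zero (c q : SmoothFun I) (hq : ∀ x, (D q).1 x ≠ 0) (lam : ℝ) :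
    pencil firstBracket (secondBracket c q hq) lam 0 = leadingTerm (q - lam • 1) := by
  have hD : D (q - lam • 1) = D q := by rw [D_sub, D_smul, D_one, smul_zero, sub_zero]
  funext s
  match s with
  | 0 =>
    change C ((1/2 : ℝ) • D q) * ux - lam • (0 : DiffPoly I) = C ((1/2 : ℝ) • D (q - lam • 1)) * ux
    rw [hD]
    exact sub_smul_zero _ lam
  | 1 =>
    exact C_sub_smul_one q lam
  | s + 2 =>
    exact sub_smul_zero 0 lam

theorem jetBracket_pencil {S : Type*} [CommRing S] [Algebra ℝ S] (δ : Derivation ℝ S S)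
    (A₁ A₂ : ℕ → ℕ → MvPolynomial ℕ S) (lam : ℝ) (F G : ℕ → MvPolynomial ℕ S) (n : ℕ) :
    jetBracket δ (fun k s => A₂ k s - lam • A₁ k s) F G n =
      jetBracket δ A₂ F G n - lam • jetBracket δ A₁ F G n := by
  simp only [jetBracket, bracketOp, diffOp_apply, sub_mul, smul_mul_assoc, Finset.sum_sub_distrib,
    mul_sub, ← Finset.smul_sum, mul_smul_comm]

theorem VanishesMod.pencil {N : ℕ} {A₁ A₂ : BracketCoeffs I} {F G : Density I}
    (h₁ : VanishesMod N (bracket A₁ F G)) (h₂ : VanishesMod N (bracket A₂ F G)) (lam : ℝ) :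
    VanishesMod N (bracket (pencil A₁ A₂ lam) F G) := by
  intro n hn
  obtain ⟨r₁, hr₁⟩ := h₁ n hn
  obtain ⟨r₂, hr₂⟩ := h₂ n hn
  refine ⟨r₂ - lam • r₁, ?_⟩
  rw [bracket_eq, dx_eq] at *
  refine Eq.trans ?_ (jetBracket_pencil derivF A₁ A₂ lam F G n).symm
  rw [← hr₁, ← hr₂]
  exact (map_sub (totalDeriv derivF) r₂ (lam • r₁)).trans
    (congrArg (_ - ·) (Derivation.map_smul (totalDeriv derivF) lam r₁))

end FormalVar

end

/-! ### The theorem: commutativity first, then the pencil and uniqueness as its consequences. -/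

theorem mainTheorem6
    (I : TopologicalSpace.Opens ℝ) (hI : IsConnected (I : Set ℝ))
    (c q : FormalVar.SmoothFun I)
    (hq : ∀ x, (FormalVar.D q).1 x ≠ 0)
    (p : FormalVar.SmoothFun I)
    (hp : ∀ x, p.1 x = (5 * c.1 x * (FormalVar.D c).1 x
      - (c.1 x) ^ 2 * ((FormalVar.D^[2] q).1 x / (FormalVar.D q).1 x)) / 960) :
    -- commutativity with respect to the first and to the second bracket
    (∀ f g : FormalVar.SmoothFun I, FormalVar.VanishesMod 6
      (FormalVar.bracket FormalVar.firstBracket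
        (FormalVar.hamDensity c p 0 f) (FormalVar.hamDensity c p 0 g))) ∧
    (∀ f g : FormalVar.SmoothFun I, FormalVar.VanishesMod 6
      (FormalVar.bracket (FormalVar.secondBracket c q hq)
        (FormalVar.hamDensity c p 0 f) (FormalVar.hamDensity c p 0 g))) ∧
    -- the two brackets form a Poisson pencil
    FormalVar.IsPoissonMod 6 (FormalVar.firstBracket (I := I)) ∧
    (∀ lam : ℝ, FormalVar.IsPoissonMod 6
      (FormalVar.pencil FormalVar.firstBracket (FormalVar.secondBracket c q hq) lam)) ∧
    -- the second bracket is a graded deformation of its leading term, and the only one with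
    -- respect to which the Hamiltonians commute
    FormalVar.IsGraded (FormalVar.secondBracket c q hq) ∧
    (∀ A : FormalVar.BracketCoeffs I, FormalVar.IsGraded A → A 0 = FormalVar.leadingTerm q →
      (∀ f g : FormalVar.SmoothFun I, FormalVar.VanishesMod 6
        (FormalVar.bracket A (FormalVar.hamDensity c p 0 f) (FormalVar.hamDensity c p 0 g))) →
      ∀ k < 6, A k = FormalVar.secondBracket c q hq k) := by
  have h1 := FormalVar.firstBracket_commute hI c p
  have h2 := FormalVar.secondBracket_commute hI hq hp
  have hg2 := FormalVar.isGraded_secondBracket c q hq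
  have hH := FormalVar.hamDensity_zero c p 0
  refine ⟨h1, h2, ?_, fun lam => ?_, hg2, fun A hA h0 hAH => ?_⟩
  · exact FormalVar.isPoissonMod_of_commute hI FormalVar.isGraded_firstBracket
      (FormalVar.leadingTerm_skew FormalVar.leadingTerm_one.symm) hH h1
  -- Commutativity is linear in the bracket, so the family `H_f` commutes for every member of the
  -- pencil, and the Poisson property follows for each `lam` separately.
  · exact FormalVar.isPoissonMod_of_commute hI (FormalVar.isGraded_firstBracket.pencil hg2 lam)
      (FormalVar.leadingTerm_skew (FormalVar.pencil_zero c q hq lam)) hH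
      fun f g => (h1 f g).pencil (h2 f g) lam
  · exact FormalVar.bracket_unique hI hA hg2 h0 hH hAH h2
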